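/- **Setting.** Let $\lambda,\mu,\rho,\omega>0$ and put $C_p=\sqrt{(\lambda+2\mu)/\rho}$, $C_s=\sqrt{\mu/\rho}$ (so $C_p^2>2C_s^2$). Consider the time-harmonic Navier equations $-(\Delta^e+\omega^2\rho)\vec u=\vec f$, $\Delta^e\vec u=\mu\Delta\vec u+(\lambda+\mu)\nabla(\nabla\cdot\vec u)$, on $\mathbb R^2$, with the subdomains $\Omega_1=(-\infty,\delta)\times\mathbb R$ and $\Omega_2=(0,\infty)\times\mathbb R$ of overlap $\delta$. From an initial guess $\vec u_1^0,\vec u_2^0$, the Schwarz algorithm with (zeroth order) Taylor transmission conditions solves, for $n\ge1$, $$-(\Delta^e+\omega^2\rho)\vec u_j^n=\vec f\ \text{ in }\Omega_j\ (j=1,2),$$ $$(\mathcal T_1+\mathcal S)\vec u_1^n=(\mathcal T_1+\mathcal S)\vec u_2^{n-1}\ \text{ at }x=\delta,\qquad (\mathcal T_2+\mathcal S)\vec u_2^n=(\mathcal T_2+\mathcal S)\vec u_1^{n-1}\ \text{ at }x=0,$$ where $\mathcal T_j\vec u=2\mu\,\partial_{n_j}\vec u+\lambda\,\vec n_j\,\nabla\cdot\vec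 u+\mu\,\vec n_j\times(\nabla\times\vec u)$ is the traction for the normal $\vec n_j$ with $\vec n_1=(1,0)$, $\vec n_2=(-1,0)$, and $\mathcal S=\mathrm{diag}(\mathrm i\rho\omega C_p,\ \mathrm i\rho\omega C_s)$. The algorithm is considered for each Fourier mode $k$ in $y$ separately, i.e. for $\hat{\vec u}(x,k)=\int e^{-\mathrm iky}\vec u(x,y)\,dy$, so that $\partial_y$ becomes $\mathrm ik$. Put $\lambda_1=\sqrt{k^2-\omega^2/C_s^2}$, $\lambda_2=\sqrt{k^2-\omega^2/C_p^2}$ (principal roots). Solutions satisfy the radiation condition that, as $x\to\pm\infty$, $(\partial_x\pm\lambda_2)$ applied to the divergence and $(\partial_x\pm\lambda_1)$ applied to the scalar curl tend to $0$ (on $\Omega_1$ for $x\to-\infty$, on $\Omega_2$ for $x\to+\infty$, on $\mathbb R^2$ for both). The algorithm *converges for $k$* if, for every right-hand side $\hat{\vec f}$ for which the problem on $\mathbb R^2$ has a solution $\hat{\vec u}$ for this mode, it can be run from every $C^1$ initial guess, and there is $r<1$, independent of the right-hand side and of the initial guess, such that $\sup_{x}|\hat{\vec u}{}_j^n(x)-\hat{\vec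 u}(x)|\le C r^n$ for $j=1,2$ and all $n\ge1$, the supremum being over $x\le\delta$ for $j=1$ and $x\ge0$ for $j=2$, with $C$ independent of $n$. **Theorem.** The equation $$\alpha C_p^2\left(C_p\cosh\alpha+C_s\right)-\left(C_p^3+3C_p^2C_s-4C_s^3\right)\sinh\alpha=0$$ has exactly one positive root $\alpha$. With this $\alpha$ let $$\delta^*(C_p,C_s,\omega)=\frac{C_s\sqrt{C_p^2-C_s^2}\,(C_p+2C_s)^2}{C_p\,\omega\,(C_s+C_p)}\cdot\frac{\sinh\alpha}{C_p\cosh\alpha+C_s}.$$ If $\delta>\delta^*(C_p,C_s,\omega)$, then the algorithm converges for every $k\in[0,\infty)\setminus\{\omega/C_p,\ \omega/C_s\}$. -/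

import Mathlib

open Set Filter Topology

noncomputable section

namespace ElasticSchwarz

/-- Physical data of the time-harmonic Navier equations: Lamé coefficients `lam`, `mu`,
density `rho`, angular frequency `omega`. -/
structure Medium where
  lam : ℝ
  mu : ℝ
  rho : ℝ
  omega : ℝ

/-- The standing assumption that all physical parameters are positive. -/
structure Medium.IsPhysical (M : Medium) : Prop where
  lam_pos : 0 < M.lam
  mu_pos : 0 < M.mu
  rho_pos : 0 < M.rho
  omega_pos : 0 < M.omega

/-- Speed of the pressure waves. -/
def Medium.Cp (M : Medium) : ℝ := √((M.lam + 2 * M.mu) / M.rho)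

/-- Speed of the shear waves. -/
def Medium.Cs (M : Medium) : ℝ := √(M.mu / M.rho)

/-- Principal complex square root of a real number: `√a` for `0 ≤ a` and `i √(-a)` for `a < 0`
(`Real.sqrt` vanishes on negative numbers). -/
def principalSqrt (a : ℝ) : ℂ := (√a : ℂ) + Complex.I * (√(-a) : ℂ)

/-- `λ₁ = √(k² - ω²/Cₛ²)`. -/
def Medium.rootS (M : Medium) (k : ℝ) : ℂ := principalSqrt (k ^ 2 - M.omega ^ 2 / M.Cs ^ 2)

/-- `λ₂ = √(k² - ω²/Cₚ²)`. -/
def Medium.rootP (M : Medium) (k : ℝ) : ℂ := principalSqrt (k ^ 2 - M.omega ^ 2 / M.Cp ^ 2)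

/-- A Fourier mode: for a fixed frequency `k`, the function `x ↦ û(x, k) ∈ ℂ²`, where
`û(x, k) = ∫ e^{-iky} u(x, y) dy`, so that `∂_y` becomes multiplication by `i k`.
Only the values on the subdomain at hand matter. -/
abbrev Mode := ℝ → Fin 2 → ℂ

/-- The derivative `∂ₓ û` on the (closed) interval `D`, one-sided at an end point of `D`. -/
def dx (D : Set ℝ) (u : Mode) : Mode := fun x => derivWithin u D x

/-- Fourier symbol of `∇·u = ∂ₓ u₁ + ∂_y u₂`. -/
def divergence (k : ℝ) (D : Set ℝ) (u : Mode) : ℝ → ℂ :=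
  fun x => dx D u x 0 + Complex.I * k * u x 1

/-- Fourier symbol of the scalar curl `∂ₓ u₂ - ∂_y u₁`. -/
def scalarCurl (k : ℝ) (D : Set ℝ) (u : Mode) : ℝ → ℂ :=
  fun x => dx D u x 1 - Complex.I * k * u x 0

/-- Fourier symbol of the gradient of a scalar function. -/
def gradient (k : ℝ) (D : Set ℝ) (p : ℝ → ℂ) : Mode :=
  fun x => ![derivWithin p D x, Complex.I * k * p x]

/-- Fourier symbol of the (componentwise) Laplacian, `∂ₓ² - k²`. -/
def laplacian (k : ℝ) (D : Set ℝ) (u : Mode) : Mode :=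
  fun x => dx D (dx D u) x - ((k : ℂ) ^ 2) • u x

/-- `Δᵉ u = μ Δu + (λ + μ) ∇(∇·u)` for the Fourier mode `k`. -/
def Medium.elasticOp (M : Medium) (k : ℝ) (D : Set ℝ) (u : Mode) : Mode :=
  fun x => (M.mu : ℂ) • laplacian k D u x
    + ((M.lam + M.mu : ℝ) : ℂ) • gradient k D (divergence k D u) x

/-- `u` is a classical solution, up to the boundary, of `-(Δᵉ + ω²ρ) u = f` on the closed
interval `D`, for the Fourier mode `k`. -/
structure Medium.IsSolution (M : Medium) (k : ℝ) (D : Set ℝ) (f u : Mode) : Prop where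
  contDiffOn : ContDiffOn ℝ 2 u D
  equation : ∀ x ∈ D,
    -(M.elasticOp k D u x + ((M.omega ^ 2 * M.rho : ℝ) : ℂ) • u x) = f x

/-- Radiation condition as `x → +∞`: the pressure part (seen by the divergence) and the shear part
(seen by the curl) contain only the decaying or outgoing waves `e^{-λ₂ x}` and `e^{-λ₁ x}`. -/
def Medium.RadiatesRight (M : Medium) (k : ℝ) (D : Set ℝ) (u : Mode) : Prop :=
  Tendsto (fun x => derivWithin (divergence k D u) D x + M.rootP k * divergence k D u x)
    atTop (𝓝 0) ∧
  Tendsto (fun x => derivWithin (scalarCurl k D u) D x + M.rootS k * scalarCurl k D u x)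
    atTop (𝓝 0)

/-- Radiation condition as `x → -∞`: only the waves `e^{λ₂ x}` and `e^{λ₁ x}` occur. -/
def Medium.RadiatesLeft (M : Medium) (k : ℝ) (D : Set ℝ) (u : Mode) : Prop :=
  Tendsto (fun x => derivWithin (divergence k D u) D x - M.rootP k * divergence k D u x)
    atBot (𝓝 0) ∧
  Tendsto (fun x => derivWithin (scalarCurl k D u) D x - M.rootS k * scalarCurl k D u x)
    atBot (𝓝 0)

/-- The traction operator `T(u) = 2μ ∂u/∂n + λ n ∇·u + μ n × (∇ × u)` for the unit normal
`n = (ν, 0)`, `ν = ±1`; here `n × (∇ × u) = (0, -ν (∂ₓ u₂ - ∂_y u₁))`. -/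
def Medium.traction (M : Medium) (k : ℝ) (D : Set ℝ) (ν : ℝ) (u : Mode) : Mode :=
  fun x => ((2 * M.mu * ν : ℝ) : ℂ) • dx D u x
    + (M.lam : ℂ) • ![(ν : ℂ) * divergence k D u x, 0]
    + (M.mu : ℂ) • ![0, -((ν : ℂ) * scalarCurl k D u x)]

/-- The zeroth order Taylor symbol `diag(iρωCₚ, iρωCₛ)`. It is used for both operators `S₁` and
`S₂`, whose symbols differ only by the signs of the off-diagonal entries, which vanish here. -/
def Medium.taylorSymbol (M : Medium) : Matrix (Fin 2) (Fin 2) ℂ :=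
  !![Complex.I * M.rho * M.omega * M.Cp, 0; 0, Complex.I * M.rho * M.omega * M.Cs]

/-- The transmission operator `T + S` with normal `(ν, 0)` and Taylor symbol `S`. -/
def Medium.transmission (M : Medium) (k : ℝ) (D : Set ℝ) (ν : ℝ) (u : Mode) : Mode :=
  fun x => M.traction k D ν u x + M.taylorSymbol.mulVec (u x)

/-- `u₁ n` and `u₂ n` are the `n`-th iterates, for the Fourier mode `k`, of the parallel Schwarz
algorithm with Taylor transmission conditions on the subdomains `Ω₁ = (-∞, δ) × ℝ` and
`Ω₂ = (0, ∞) × ℝ`, with right-hand side `f`. The index `0` is the initial guess. -/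
structure Medium.IsSchwarzSequence (M : Medium) (k δ : ℝ) (f : Mode) (u₁ u₂ : ℕ → Mode) :
    Prop where
  initial₁ : ContDiffOn ℝ 1 (u₁ 0) (Iic δ)
  initial₂ : ContDiffOn ℝ 1 (u₂ 0) (Ici 0)
  solution₁ : ∀ n, M.IsSolution k (Iic δ) f (u₁ (n + 1))
  solution₂ : ∀ n, M.IsSolution k (Ici 0) f (u₂ (n + 1))
  radiation₁ : ∀ n, M.RadiatesLeft k (Iic δ) (u₁ (n + 1))
  radiation₂ : ∀ n, M.RadiatesRight k (Ici 0) (u₂ (n + 1))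
  transmission₁ : ∀ n,
    M.transmission k (Iic δ) 1 (u₁ (n + 1)) δ = M.transmission k (Ici 0) 1 (u₂ n) δ
  transmission₂ : ∀ n,
    M.transmission k (Ici 0) (-1) (u₂ (n + 1)) 0 = M.transmission k (Iic δ) (-1) (u₁ n) 0

/-- `u` solves the undecomposed problem on `Ω = ℝ²`, for the Fourier mode `k`. -/
structure Medium.IsGlobalSolution (M : Medium) (k : ℝ) (f u : Mode) : Prop where
  solution : M.IsSolution k univ f u
  radiationLeft : M.RadiatesLeft k univ u
  radiationRight : M.RadiatesRight k univ u

/-- The Schwarz algorithm with overlap `δ` converges for the Fourier mode `k`: it can be run from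
every initial guess, and there is a factor `r < 1`, independent of the data and of the initial
guess, such that the error in both subdomains is `O(rⁿ)`, uniformly in space. -/
def Medium.SchwarzConverges (M : Medium) (k δ : ℝ) : Prop :=
  (∀ f u g₁ g₂ : Mode, M.IsGlobalSolution k f u →
    ContDiffOn ℝ 1 g₁ (Iic δ) → ContDiffOn ℝ 1 g₂ (Ici 0) →
    ∃ u₁ u₂ : ℕ → Mode, u₁ 0 = g₁ ∧ u₂ 0 = g₂ ∧ M.IsSchwarzSequence k δ f u₁ u₂) ∧
  ∃ r : ℝ, 0 ≤ r ∧ r < 1 ∧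
    ∀ (f u : Mode) (u₁ u₂ : ℕ → Mode), M.IsGlobalSolution k f u →
      M.IsSchwarzSequence k δ f u₁ u₂ →
      ∃ C : ℝ, ∀ n : ℕ, 1 ≤ n →
        (∀ x ∈ Iic δ, ‖u₁ n x - u x‖ ≤ C * r ^ n) ∧
        (∀ x ∈ Ici (0 : ℝ), ‖u₂ n x - u x‖ ≤ C * r ^ n)

/-- `α` is a positive root of
`α Cₚ² (Cₚ cosh α + Cₛ) - (Cₚ³ + 3 Cₚ² Cₛ - 4 Cₛ³) sinh α = 0`. -/
def Medium.IsPositiveRoot (M : Medium) (α : ℝ) : Prop :=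
  0 < α ∧
    α * M.Cp ^ 2 * (M.Cp * Real.cosh α + M.Cs)
      - (M.Cp ^ 3 + 3 * M.Cp ^ 2 * M.Cs - 4 * M.Cs ^ 3) * Real.sinh α = 0

/-- The critical overlap `δ*`, as a function of the root `α`. -/
def Medium.criticalOverlap (M : Medium) (α : ℝ) : ℝ :=
  M.Cs * √(M.Cp ^ 2 - M.Cs ^ 2) * (M.Cp + 2 * M.Cs) ^ 2 / (M.Cp * M.omega * (M.Cs + M.Cp))
    * (Real.sinh α / (M.Cp * Real.cosh α + M.Cs))

end ElasticSchwarz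

end

/-!
The difference between an iterate and the global solution solves the homogeneous equation and
radiates. Its divergence and its curl therefore solve `p'' = λ₂² p` and `q'' = λ₁² q`, the radiation
condition leaves one exponential of each, and the displacement is recovered from them: the error in
either subdomain is a superposition of one pressure wave and one shear wave
(`Medium.IsSolution.exists_eq_wave`). If the amplitude of the shear wave is counted with opposite
signs in the two subdomains, then the transmission conditions become `P c' = G d`, `P d' = G c` with
the same two matrices on both sides, so that convergence follows as soon as `P` is invertible and
every `z` with `det (z P - G) = 0` satisfies `|z| < 1`
(`Medium.schwarzConverges_of_stable_pencil`).

In units in which `ω = Cₛ = 1`, with `c = Cₚ / Cₛ` and exponents `l₁`, `l₂`, this determinant is, up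
to a nonzero factor,
`(X + Y) z² - ((V - Z) e₂ + (V + Z) e₁) z + (Y - X) e₁ e₂`, `eᵢ = exp (-lᵢ d)`,
where `X`, `Z` are even and `Y`, `V` odd in `(l₁, l₂)`. The Schur–Cohn criterion
(`norm_lt_one_of_quadratic_eq_zero`) turns stability into a scalar inequality in each of three
regimes.

* For `k < 1/c` both waves propagate, all symbols are real, and `|Z| < |X|`, `|V| < |Y|` suffice.
* For `1/c < k < 1` only the pressure wave decays. The criterion is a trigonometric inequality in
  the phase `θ` of the shear wave. Either it holds for every phase by the Cauchy–Schwarz inequality,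
  or the phase is so small that `cos θ ≥ 1 - θ²/2` and `sin θ ≤ θ` reduce it to polynomial
  inequalities in `c` and `k²` (`mixed_schurCohn_pos`, `stableSymbol_of_mixed`). Any positive
  overlap is enough.
* For `k > 1` both waves decay and the criterion reads `Z² S² + v² T² < X² + y²` with `Y = i y`,
  `V = i v`, `S = sinh p / sinh q`, `T = cosh p / cosh q`, `p = (l₂ - l₁) d / 2`,
  `q = (l₁ + l₂) d / 2`. Both `S` and `T` decrease in `d`, so `d` may be replaced by the critical
  overlap `α / √(1 - 1/c²)`; there `p q = (α/2)²` for every `k`. The logarithms of `sinh x / x` and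
  `cosh x` have derivatives `r(x) / x` with `r` convex as a function of `log x`, and the
  Hermite–Hadamard inequality (`mul_log_le_sub_of_monotoneOn`) bounds `S` and `T` through the values
  of `r` at the geometric mean `b = α/2`, which are `b coth b - 1` and `b tanh b`. The equation for
  `α` is a linear relation between these two numbers, and it implies the rational inequality in `c`
  and `q/p` that remains (`bounds_of_overlap_equation`, `evanescent_bound`).

The equation for `α` has exactly one positive root because `a (c cosh a + 1) / sinh a` increases.
-/

namespace ElasticSchwarz

/-! ### Roots of quadratics in the unit disc -/

open scoped ComplexConjugate

/-- The Schur–Cohn criterion for a complex quadratic polynomial. -/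
theorem norm_lt_one_of_quadratic_eq_zero {a b c z : ℂ} (hca : ‖c‖ < ‖a‖)
    (h : ‖conj a * b - c * conj b‖ < ‖a‖ ^ 2 - ‖c‖ ^ 2)
    (hz : a * z ^ 2 + b * z + c = 0) : ‖z‖ < 1 := by
  have ha : a ≠ 0 := by
    rintro rfl
    simp only [norm_zero] at hca
    exact absurd hca (not_lt.mpr (norm_nonneg _))
  by_contra! hz1
  obtain ⟨w, hw⟩ : ∃ w, b = -a * (z + w) := ⟨-b / a - z, by field_simp; ring⟩
  have hc : c = a * (z * w) := by rw [hw] at hz; linear_combination hz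
  have hapos : 0 < ‖a‖ := norm_pos_iff.mpr ha
  have hzw : ‖z‖ * ‖w‖ < 1 := by
    rw [hc, norm_mul, norm_mul] at hca
    by_contra! h1
    nlinarith
  have key : conj a * b - c * conj b
      = (conj a * a) * (-(z * ((1 - ‖w‖ ^ 2 : ℝ) : ℂ)) - w * ((1 - ‖z‖ ^ 2 : ℝ) : ℂ)) := by
    rw [hc, hw]
    push_cast
    rw [← Complex.mul_conj' z, ← Complex.mul_conj' w]
    simp only [map_mul, map_neg, map_add]
    ring
  have hn : ‖conj a * b - c * conj b‖ ≥ ‖a‖ ^ 2 * (‖z‖ * (1 - ‖w‖ ^ 2) - ‖w‖ * (‖z‖ ^ 2 - 1)) := by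
    rw [key, norm_mul, norm_mul, Complex.norm_conj, ← sq]
    refine mul_le_mul_of_nonneg_left ?_ (by positivity)
    have h1 := norm_sub_norm_le (-(z * ((1 - ‖w‖ ^ 2 : ℝ) : ℂ))) (w * ((1 - ‖z‖ ^ 2 : ℝ) : ℂ))
    rw [norm_neg, norm_mul, norm_mul, Complex.norm_real, Complex.norm_real, Real.norm_eq_abs,
      Real.norm_eq_abs, abs_of_nonpos (a := 1 - ‖z‖ ^ 2) (by nlinarith)] at h1
    have h2 := mul_le_mul_of_nonneg_left (le_abs_self (1 - ‖w‖ ^ 2)) (norm_nonneg z)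
    linarith
  have hw1 : ‖w‖ < 1 := by
    by_contra! h1
    nlinarith
  have hcn : ‖c‖ = ‖a‖ * (‖z‖ * ‖w‖) := by rw [hc, norm_mul, norm_mul]
  have h3 : ‖a‖ ^ 2 * (‖z‖ * (1 - ‖w‖ ^ 2) - ‖w‖ * (‖z‖ ^ 2 - 1)) < ‖a‖ ^ 2 * (1 - (‖z‖ * ‖w‖) ^ 2) := by
    calc _ < ‖a‖ ^ 2 - ‖c‖ ^ 2 := lt_of_le_of_lt hn h
      _ = _ := by rw [hcn]; ring
  have h4 := lt_of_mul_lt_mul_left h3 (by positivity)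
  have h5 : 0 ≤ (1 - ‖z‖ * ‖w‖) * ((‖z‖ - 1) * (1 - ‖w‖)) :=
    mul_nonneg (by linarith) (mul_nonneg (by linarith) (by linarith))
  nlinarith

/-- Stability of the error propagation. The quadratic polynomial is `det (z P - G)` for the
matrices `P`, `G` of outgoing and incoming traces, up to a nonzero factor, and `X + Y` is `det P`;
the roots have to lie in the open unit disc. -/
def Stable (X Y Z V e₁ e₂ : ℂ) : Prop :=
  X + Y ≠ 0 ∧ ∀ z : ℂ,
    (X + Y) * z ^ 2 - ((V - Z) * e₂ + (V + Z) * e₁) * z + (Y - X) * (e₁ * e₂) = 0 → ‖z‖ < 1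

/-- Both waves propagate: all symbols are real and the exponentials are unimodular. -/
theorem stable_of_real {x y z v : ℝ} {e₁ e₂ : ℂ} (hx : x < 0) (hy : y < 0) (hz : |z| < -x)
    (hv : |v| < -y) (h₁ : ‖e₁‖ = 1) (h₂ : ‖e₂‖ = 1) : Stable x y z v e₁ e₂ := by
  have hxy : 0 < x * y := mul_pos_of_neg_of_neg hx hy
  refine ⟨by exact_mod_cast (by linarith : x + y ≠ 0), fun w hw => ?_⟩
  have hca : ‖((y : ℂ) - x) * (e₁ * e₂)‖ = |y - x| := by
    rw [norm_mul, norm_mul, h₁, h₂, ← Complex.ofReal_sub, Complex.norm_real, Real.norm_eq_abs]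
    ring
  have ha : ‖(x : ℂ) + y‖ = -(x + y) := by
    rw [← Complex.ofReal_add, Complex.norm_real, Real.norm_eq_abs, abs_of_neg (by linarith)]
  refine norm_lt_one_of_quadratic_eq_zero (a := x + y) (b := -((v - z) * e₂ + (v + z) * e₁))
    (c := (y - x) * (e₁ * e₂)) ?_ ?_ (by linear_combination hw)
  · rw [hca, ha, abs_lt]
    constructor <;> linarith
  · have hc1 : conj e₁ * e₁ = 1 := by rw [Complex.conj_mul', h₁]; simp
    have hc2 : conj e₂ * e₂ = 1 := by rw [Complex.conj_mul', h₂]; simp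
    have key : conj ((x : ℂ) + y) * (-((v - z) * e₂ + (v + z) * e₁))
        - (y - x) * (e₁ * e₂) * conj (-(((v : ℂ) - z) * e₂ + (v + z) * e₁))
        = ((-2 * (x * v + y * z) : ℝ) : ℂ) * e₁ + ((-2 * (x * v - y * z) : ℝ) : ℂ) * e₂ := by
      simp only [map_neg, map_add, map_mul, map_sub, Complex.conj_ofReal]
      push_cast
      linear_combination (y - x) * (v - z) * e₁ * hc2 + (y - x) * (v + z) * e₂ * hc1
    rw [key, hca, ha, sq_abs]
    refine (norm_add_le _ _).trans_lt ?_
    rw [norm_mul, norm_mul, h₁, h₂, Complex.norm_real, Complex.norm_real, Real.norm_eq_abs,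
      Real.norm_eq_abs, mul_one, mul_one, abs_mul, abs_mul]
    norm_num
    have h3 : |x * v| < x * y := by
      rw [abs_mul, abs_of_neg hx]; nlinarith
    have h4 : |y * z| < x * y := by
      rw [abs_mul, abs_of_neg hy]; nlinarith
    rw [abs_lt] at h3 h4
    rcases abs_cases (x * v + y * z) with h | h <;> rcases abs_cases (x * v - y * z) with h' | h' <;>
      rw [h.1, h'.1] <;> nlinarith

/-- Both waves decay: `X`, `Z` and the exponentials are real, `Y` and `V` are imaginary. -/
theorem stable_of_evanescent {x y z v e₁ e₂ : ℝ} (hxy : 0 < x ^ 2 + y ^ 2) (h₁ : 0 < e₁)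
    (h₂ : 0 < e₂) (h₁₁ : e₁ < 1) (h₂₁ : e₂ < 1)
    (h : z ^ 2 * ((e₁ - e₂) / (1 - e₁ * e₂)) ^ 2 + v ^ 2 * ((e₁ + e₂) / (1 + e₁ * e₂)) ^ 2
      < x ^ 2 + y ^ 2) :
    Stable x (y * Complex.I) z (v * Complex.I) e₁ e₂ := by
  have hq : e₁ * e₂ < 1 := by nlinarith
  have hq0 : 0 < e₁ * e₂ := mul_pos h₁ h₂
  have hns : ‖(x : ℂ) + y * Complex.I‖ ^ 2 = x ^ 2 + y ^ 2 := by
    rw [Complex.sq_norm, Complex.normSq_add_mul_I]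
  have hpos : 0 < ‖(x : ℂ) + y * Complex.I‖ := by
    by_contra! h0
    nlinarith [norm_nonneg ((x : ℂ) + y * Complex.I)]
  have hcn : ‖((y : ℂ) * Complex.I - x) * (e₁ * e₂)‖ = ‖(x : ℂ) + y * Complex.I‖ * (e₁ * e₂) := by
    have : (y : ℂ) * Complex.I - x = -conj ((x : ℂ) + y * Complex.I) := by
      simp only [map_add, map_mul, Complex.conj_ofReal, Complex.conj_I]
      ring
    rw [this, norm_mul, norm_neg, Complex.norm_conj, ← Complex.ofReal_mul, Complex.norm_real,
      Real.norm_eq_abs, abs_of_pos hq0]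
  refine ⟨norm_pos_iff.mp hpos, fun w hw => ?_⟩
  refine norm_lt_one_of_quadratic_eq_zero (a := x + y * Complex.I)
    (b := -((v * Complex.I - z) * e₂ + (v * Complex.I + z) * e₁))
    (c := (y * Complex.I - x) * (e₁ * e₂)) ?_ ?_ (by linear_combination hw)
  · rw [hcn]; nlinarith
  · have key : conj ((x : ℂ) + y * Complex.I) * (-((v * Complex.I - z) * e₂ + (v * Complex.I + z) * e₁))
        - (y * Complex.I - x) * (e₁ * e₂) *
          conj (-(((v : ℂ) * Complex.I - z) * e₂ + (v * Complex.I + z) * e₁))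
        = -(conj ((x : ℂ) + y * Complex.I) * (((z * ((e₁ - e₂) * (1 + e₁ * e₂)) : ℝ) : ℂ)
          + ((v * ((e₁ + e₂) * (1 - e₁ * e₂)) : ℝ) : ℂ) * Complex.I)) := by
      simp only [map_neg, map_add, map_mul, map_sub, Complex.conj_ofReal, Complex.conj_I]
      push_cast
      ring
    rw [key, hcn, norm_neg, norm_mul, Complex.norm_conj]
    have h3 : ‖(((z * ((e₁ - e₂) * (1 + e₁ * e₂)) : ℝ) : ℂ)
          + ((v * ((e₁ + e₂) * (1 - e₁ * e₂)) : ℝ) : ℂ) * Complex.I)‖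
        < ‖(x : ℂ) + y * Complex.I‖ * (1 - (e₁ * e₂) ^ 2) := by
      refine lt_of_pow_lt_pow_left₀ 2 (mul_nonneg hpos.le (by nlinarith)) ?_
      rw [Complex.sq_norm, Complex.normSq_add_mul_I, mul_pow z, mul_pow v,
        mul_pow ‖(x : ℂ) + y * Complex.I‖, hns]
      have h4 : 0 < 1 - e₁ * e₂ := by linarith
      have h5 : 0 < 1 + e₁ * e₂ := by linarith
      have h6 := mul_lt_mul_of_pos_right h (by positivity : 0 < ((1 - e₁ * e₂) * (1 + e₁ * e₂)) ^ 2)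
      calc _ = (z ^ 2 * ((e₁ - e₂) / (1 - e₁ * e₂)) ^ 2 + v ^ 2 * ((e₁ + e₂) / (1 + e₁ * e₂)) ^ 2)
            * ((1 - e₁ * e₂) * (1 + e₁ * e₂)) ^ 2 := by
            field_simp
        _ < _ := h6
        _ = _ := by ring
    nlinarith

/-- The shear wave propagates with phase `θ` over the overlap, the pressure wave decays by
`e^{-L}`. The hypothesis `hΦ` is the Schur–Cohn condition, divided by positive factors. -/
theorem stable_of_mixed {g h m n θ L : ℝ} (hg : 0 < g) (hh : 0 < h) (hm : 0 < m) (hn : 0 < n)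
    (hL : 0 < L)
    (hΦ : 0 < (g ^ 2 + m ^ 2 + h ^ 2 + n ^ 2) * (g * m + h * n) * Real.sinh L * Real.cosh L
      + 2 * (g * m + h * n) ^ 2 * Real.sinh L ^ 2
      + Real.cos θ * (2 * (g * h - m * n) * (g * h + m * n) * Real.cosh L
        - (m ^ 2 + h ^ 2 - g ^ 2 - n ^ 2) * (g * m - h * n) * Real.sinh L)
      + Real.sin θ * ((m ^ 2 + h ^ 2 - g ^ 2 - n ^ 2) * (g * h + m * n) * Real.sinh L
        + 2 * (g * h - m * n) * (g * m - h * n) * Real.cosh L)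
      - 2 * (g * h - m * n) ^ 2) :
    Stable (-g + h * Complex.I) (-m + n * Complex.I) (g + h * Complex.I) (-m - n * Complex.I)
      (Complex.exp (-(θ * Complex.I))) (Real.exp (-L)) := by
  set e := Complex.exp (-(θ * Complex.I)) with he
  set ρ := Real.exp (-L) with hρ
  have hρ0 : 0 < ρ := Real.exp_pos _
  have hρ1 : ρ < 1 := by rw [hρ, Real.exp_lt_one_iff]; linarith
  have he1 : ‖e‖ = 1 := by
    rw [he, show -(θ * Complex.I) = ((-θ : ℝ) : ℂ) * Complex.I by push_cast; ring,
      Complex.norm_exp_ofReal_mul_I]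
  have hee : e * conj e = 1 := by rw [Complex.mul_conj', he1]; simp
  have heθ : e = ((Real.cos θ : ℝ) : ℂ) - ((Real.sin θ : ℝ) : ℂ) * Complex.I := by
    rw [he, show -(θ * Complex.I) = (-θ : ℂ) * Complex.I by ring, Complex.exp_mul_I]
    push_cast
    rw [Complex.cos_neg, Complex.sin_neg]
    ring
  have hsh : 2 * ρ * Real.sinh L = 1 - ρ ^ 2 := by
    rw [Real.sinh_eq, hρ, Real.exp_neg]; field_simp
  have hch : 2 * ρ * Real.cosh L = 1 + ρ ^ 2 := by
    rw [Real.cosh_eq, hρ, Real.exp_neg]; field_simp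
  have hsh0 : 0 < Real.sinh L := Real.sinh_pos_iff.mpr hL
  have hch0 : 0 < Real.cosh L := Real.cosh_pos L
  have hcs : Real.cosh L ^ 2 = Real.sinh L ^ 2 + 1 := by rw [Real.cosh_sq]
  have hθ : Real.cos θ ^ 2 = 1 - Real.sin θ ^ 2 := by rw [Real.cos_sq']
  have ha2 : ‖(-g + h * Complex.I : ℂ) + (-m + n * Complex.I)‖ ^ 2 = (g + m) ^ 2 + (h + n) ^ 2 := by
    rw [show (-g + h * Complex.I : ℂ) + (-m + n * Complex.I)
      = ((-(g + m) : ℝ) : ℂ) + ((h + n : ℝ) : ℂ) * Complex.I by push_cast; ring, Complex.sq_norm,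
      Complex.normSq_add_mul_I]
    ring
  have hc2 : ‖((-m + n * Complex.I : ℂ) - (-g + h * Complex.I)) * (e * ρ)‖ ^ 2
      = ((g - m) ^ 2 + (n - h) ^ 2) * ρ ^ 2 := by
    rw [show (-m + n * Complex.I : ℂ) - (-g + h * Complex.I)
      = ((g - m : ℝ) : ℂ) + ((n - h : ℝ) : ℂ) * Complex.I by push_cast; ring, norm_mul, norm_mul, he1,
      mul_pow, Complex.sq_norm, Complex.normSq_add_mul_I, one_mul, Complex.norm_real,
      Real.norm_eq_abs, sq_abs]
  have hac : (g - m) ^ 2 + (n - h) ^ 2 < (g + m) ^ 2 + (h + n) ^ 2 := by nlinarith [mul_pos hg hm, mul_pos hh hn]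
  have hpos : 0 < ‖(-g + h * Complex.I : ℂ) + (-m + n * Complex.I)‖ := by
    refine lt_of_le_of_ne (norm_nonneg _) fun h0 => ?_
    rw [← h0] at ha2
    nlinarith
  refine ⟨norm_pos_iff.mp hpos, fun w hw => ?_⟩
  refine norm_lt_one_of_quadratic_eq_zero
    (a := (-g + h * Complex.I : ℂ) + (-m + n * Complex.I))
    (b := -(((-m - n * Complex.I) - (g + h * Complex.I)) * ρ
      + ((-m - n * Complex.I) + (g + h * Complex.I)) * e))
    (c := ((-m + n * Complex.I) - (-g + h * Complex.I)) * (e * ρ)) ?_ ?_ (by linear_combination hw)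
  · refine lt_of_pow_lt_pow_left₀ 2 hpos.le ?_
    rw [ha2, hc2]
    have h1 : ρ ^ 2 ≤ 1 := pow_le_one₀ hρ0.le hρ1.le
    exact lt_of_le_of_lt (mul_le_of_le_one_right (by positivity) h1) hac
  · rw [ha2, hc2]
    have key : conj ((-g + h * Complex.I : ℂ) + (-m + n * Complex.I)) *
          -(((-m - n * Complex.I) - (g + h * Complex.I)) * ρ
            + ((-m - n * Complex.I) + (g + h * Complex.I)) * e)
        - (((-m + n * Complex.I) - (-g + h * Complex.I)) * (e * ρ)) *
          conj (-(((-m - n * Complex.I) - (g + h * Complex.I)) * (ρ : ℂ)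
            + ((-m - n * Complex.I) + (g + h * Complex.I)) * e))
        = ((-(2 * ρ) : ℝ) : ℂ) * (e * (((m ^ 2 + h ^ 2 - g ^ 2 - n ^ 2) * Real.sinh L : ℝ)
            - (2 * (g * h - m * n) * Real.cosh L : ℝ) * Complex.I)
          + ((2 * (g * m - h * n) : ℝ) + (2 * (g * h + m * n) : ℝ) * Complex.I)) := by
      have hshC : 2 * (ρ : ℂ) * (Real.sinh L : ℝ) = 1 - ρ ^ 2 := by exact_mod_cast hsh
      have hchC : 2 * (ρ : ℂ) * (Real.cosh L : ℝ) = 1 + ρ ^ 2 := by exact_mod_cast hch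
      simp only [map_neg, map_add, map_mul, map_sub, Complex.conj_ofReal, Complex.conj_I]
      push_cast at hshC hchC ⊢
      linear_combination
        ((g - m) + (n - h) * Complex.I) ^ 2 * ρ * hee
        + e * (m ^ 2 + h ^ 2 - g ^ 2 - n ^ 2) * hshC
        - e * (2 * (g * h - m * n)) * Complex.I * hchC
        + (e * (h ^ 2 - n ^ 2) * (1 - ρ ^ 2) - 4 * h * n * ρ) * Complex.I_sq
    have hW : (e * (((m ^ 2 + h ^ 2 - g ^ 2 - n ^ 2) * Real.sinh L : ℝ)
            - (2 * (g * h - m * n) * Real.cosh L : ℝ) * Complex.I)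
          + ((2 * (g * m - h * n) : ℝ) + (2 * (g * h + m * n) : ℝ) * Complex.I))
        = (((m ^ 2 + h ^ 2 - g ^ 2 - n ^ 2) * Real.sinh L * Real.cos θ
            - 2 * (g * h - m * n) * Real.cosh L * Real.sin θ + 2 * (g * m - h * n) : ℝ) : ℂ)
          + ((2 * (g * h + m * n) - 2 * (g * h - m * n) * Real.cosh L * Real.cos θ
            - (m ^ 2 + h ^ 2 - g ^ 2 - n ^ 2) * Real.sinh L * Real.sin θ : ℝ) : ℂ) * Complex.I := by
      rw [heθ]
      push_cast
      linear_combination (Complex.sin θ * (2 * (g * h - m * n) * Complex.cosh L)) * Complex.I_sq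
    have hWlt : ‖(e * (((m ^ 2 + h ^ 2 - g ^ 2 - n ^ 2) * Real.sinh L : ℝ)
            - (2 * (g * h - m * n) * Real.cosh L : ℝ) * Complex.I)
          + ((2 * (g * m - h * n) : ℝ) + (2 * (g * h + m * n) : ℝ) * Complex.I))‖
        < (g ^ 2 + m ^ 2 + h ^ 2 + n ^ 2) * Real.sinh L + 2 * (g * m + h * n) * Real.cosh L := by
      refine lt_of_pow_lt_pow_left₀ 2 (by positivity) ?_
      rw [hW, Complex.sq_norm, Complex.normSq_add_mul_I, ← sub_pos]
      refine lt_of_lt_of_eq (mul_pos (by norm_num : (0 : ℝ) < 4) hΦ) ?_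
      generalize Real.sinh L = S at *
      generalize Real.cosh L = C at *
      generalize Real.cos θ = a at *
      generalize Real.sin θ = b at *
      linear_combination (-4 * ((g * m + h * n) ^ 2 - (g * h - m * n) ^ 2)) * hcs
        + ((m ^ 2 + h ^ 2 - g ^ 2 - n ^ 2) ^ 2 * S ^ 2 + 4 * (g * h - m * n) ^ 2 * C ^ 2) * hθ
    rw [key, norm_mul, Complex.norm_real, Real.norm_eq_abs, abs_neg, abs_of_pos (by positivity)]
    calc _ < 2 * ρ * ((g ^ 2 + m ^ 2 + h ^ 2 + n ^ 2) * Real.sinh L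
          + 2 * (g * m + h * n) * Real.cosh L) := by gcongr
      _ = _ := by
        linear_combination (g ^ 2 + m ^ 2 + h ^ 2 + n ^ 2) * hsh + 2 * (g * m + h * n) * hch

/-! ### The Schur–Cohn condition for a propagating shear wave and a decaying pressure wave -/

/-- The Schur–Cohn condition holds for every phase `(a, b) = (cos θ, sin θ)` if the terms
independent of the phase dominate; `S`, `C` stand for `sinh L`, `cosh L`. -/
theorem mixed_pos_of_dominated {g h m n S C a b : ℝ} (hg : 0 < g) (hh : 0 < h) (hm : 0 < m)
    (hn : 0 < n) (hS : 0 < S) (hC : 0 < C) (hcs : C ^ 2 = S ^ 2 + 1) (hab : a ^ 2 + b ^ 2 = 1)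
    (hw : 0 ≤ g * h - m * n) (hlt : g * h - m * n < (g * m + h * n) * S) :
    0 < (g ^ 2 + m ^ 2 + h ^ 2 + n ^ 2) * (g * m + h * n) * S * C
      + 2 * (g * m + h * n) ^ 2 * S ^ 2
      + a * (2 * (g * h - m * n) * (g * h + m * n) * C
        - (m ^ 2 + h ^ 2 - g ^ 2 - n ^ 2) * (g * m - h * n) * S)
      + b * ((m ^ 2 + h ^ 2 - g ^ 2 - n ^ 2) * (g * h + m * n) * S
        + 2 * (g * h - m * n) * (g * m - h * n) * C)
      - 2 * (g * h - m * n) ^ 2 := by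
  set A₁ := 2 * (g * h - m * n) * (g * h + m * n) * C
        - (m ^ 2 + h ^ 2 - g ^ 2 - n ^ 2) * (g * m - h * n) * S with hA₁
  set A₂ := (m ^ 2 + h ^ 2 - g ^ 2 - n ^ 2) * (g * h + m * n) * S
        + 2 * (g * h - m * n) * (g * m - h * n) * C with hA₂
  set D := ((g * m + h * n) * S) ^ 2 - (g * h - m * n) ^ 2 with hD
  have hD0 : 0 < D := by
    have := pow_lt_pow_left₀ hlt hw two_ne_zero
    rw [hD]; linarith
  have hsum : 0 < (g ^ 2 + m ^ 2 + h ^ 2 + n ^ 2) * (g * m + h * n) * S * C := by positivity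
  -- Cauchy–Schwarz for the terms with the phase
  have h1 : (a * A₁ + b * A₂) ^ 2 ≤ A₁ ^ 2 + A₂ ^ 2 := by
    have : (a * A₁ + b * A₂) ^ 2 + (a * A₂ - b * A₁) ^ 2 = A₁ ^ 2 + A₂ ^ 2 := by
      linear_combination (A₁ ^ 2 + A₂ ^ 2) * hab
    linarith [sq_nonneg (a * A₂ - b * A₁)]
  have h2 : A₁ ^ 2 + A₂ ^ 2 < ((g ^ 2 + m ^ 2 + h ^ 2 + n ^ 2) * (g * m + h * n) * S * C + 2 * D) ^ 2 := by
    have h3 : ((g ^ 2 + m ^ 2 + h ^ 2 + n ^ 2) * (g * m + h * n) * S * C + 2 * D) ^ 2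
        - (A₁ ^ 2 + A₂ ^ 2) = (g ^ 2 + m ^ 2 + h ^ 2 + n ^ 2) ^ 2 * S ^ 2 * D
          + 4 * ((g ^ 2 + m ^ 2 + h ^ 2 + n ^ 2) * (g * m + h * n) * S * C) * D + 4 * D ^ 2
          + 4 * ((g * m + h * n) ^ 2 + (g * h - m * n) ^ 2) * D := by
      rw [hA₁, hA₂, hD]
      linear_combination ((g ^ 2 + m ^ 2 + h ^ 2 + n ^ 2) ^ 2 * (g * m + h * n) ^ 2 * S ^ 2
        - 4 * (g * h - m * n) ^ 2 * ((g * m + h * n) ^ 2 + (g * h - m * n) ^ 2)) * hcs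
    have h4 : 0 < (g ^ 2 + m ^ 2 + h ^ 2 + n ^ 2) ^ 2 * S ^ 2 * D
          + 4 * ((g ^ 2 + m ^ 2 + h ^ 2 + n ^ 2) * (g * m + h * n) * S * C) * D + 4 * D ^ 2
          + 4 * ((g * m + h * n) ^ 2 + (g * h - m * n) ^ 2) * D := by positivity
    linarith
  have h5 := abs_lt_of_sq_lt_sq (h1.trans_lt h2) (by positivity)
  have h6 := (abs_lt.mp h5).1
  have h7 : 2 * (g * m + h * n) ^ 2 * S ^ 2 - 2 * (g * h - m * n) ^ 2 = 2 * D := by rw [hD]; ring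
  linarith

/-- A lower bound for the terms of the Schur–Cohn condition that are linear in `K` or `G`, when the
phase is small. -/
theorem mixed_traction_bound {P s l N K G Q Y S C a b : ℝ} (hP : 0 < P) (hs : 0 < s)
    (hl : 0 < l) (hN : 0 < N) (hPK : P ≤ K) (hKG : K + G = 2 * P) (hKG' : 0 < K - G) (hQ0 : 0 < Q)
    (hY0 : 0 < Y) (hYN : s ^ 2 * N ≤ Y) (hQN : s ^ 2 * N ≤ Q) (hS : 0 < S) (hC : 1 ≤ C)
    (ha0 : 0 ≤ a) (ha1 : a ≤ 1) (hb0' : 0 ≤ b) (hbl : b * l ≤ s * S) :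
    (if Y ≤ Q then (Q - Y) * P * S else 0) ≤
      (Q + Y) * K * C * S + (Q - Y) * G * a * S + 2 * s * (l * N) * C * G * b := by
  have hKpos : 0 < K := hP.trans_le hPK
  have hbN : 2 * s * (l * N) * C * b ≤ 2 * (s ^ 2 * N) * C * S := by
    have := mul_le_mul_of_nonneg_left hbl (by positivity : 0 ≤ 2 * s * N * C)
    nlinarith
  have hbN0 : 0 ≤ 2 * s * (l * N) * C * b := by positivity
  rcases le_or_gt 0 G with hG0 | hG0
  · have h1 : 0 ≤ 2 * s * (l * N) * C * G * b := by positivity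
    split_ifs with hv
    · have h2 : (Q - Y) * P * S ≤ (Q + Y) * K * C * S := by
        have : (Q - Y) * P ≤ (Q + Y) * K * C := by
          have h4 : (Q - Y) * P ≤ (Q + Y) * K := by nlinarith
          have h5 : (Q + Y) * K ≤ (Q + Y) * K * C := by
            have : 0 < (Q + Y) * K := by positivity
            nlinarith
          linarith
        exact mul_le_mul_of_nonneg_right this hS.le
      have h3 : 0 ≤ (Q - Y) * G * a * S := by
        have := sub_nonneg.mpr hv
        positivity
      linarith
    · push Not at hv
      have h2 : -((Q + Y) * K * C * S) ≤ (Q - Y) * G * a * S := by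
        have h3 : (Y - Q) * (G * a) ≤ (Q + Y) * (K * C) := by
          have h4 : G * a ≤ K * C := by nlinarith
          have h5 : 0 ≤ G * a := by positivity
          nlinarith
        nlinarith
      linarith
  · have h1 : 2 * s ^ 2 * N * C * S * G ≤ 2 * s * (l * N) * C * G * b := by nlinarith
    have hKGn : -G ≤ K := by linarith
    have hCS : 0 < C * S := by positivity
    split_ifs with hv
    · have h2 : (Q - Y) * P * S + 2 * (s ^ 2 * N) * (C * S) * (-G)
          ≤ (Q + Y) * K * C * S + (Q - Y) * G * a * S := by
        have h3 : 2 * (s ^ 2 * N) * (C * S) * (-G) ≤ 2 * Y * (C * S) * K := by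
          have : (s ^ 2 * N) * (-G) ≤ Y * K := by nlinarith
          nlinarith
        have h4 : (Q - Y) * P * S ≤ (Q - Y) * (K * C + G * a) * S := by
          refine mul_le_mul_of_nonneg_right (mul_le_mul_of_nonneg_left ?_ (by linarith)) hS.le
          nlinarith
        nlinarith
      linarith
    · push Not at hv
      have h2 : 2 * (s ^ 2 * N) * (C * S) * (-G) ≤ (Q + Y) * K * C * S := by
        have : 2 * (s ^ 2 * N) * (-G) ≤ (Q + Y) * K := by nlinarith
        nlinarith
      have h3 : 0 ≤ (Q - Y) * G * a * S := by
        have : 0 ≤ (Y - Q) * (-G) := mul_nonneg (by linarith) (by linarith)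
        have : 0 ≤ (Y - Q) * (-G) * (a * S) := by positivity
        nlinarith
      linarith

/-- The remaining terms of the Schur–Cohn condition for small phases. With `b ≤ s S / l` they become
a quadratic polynomial in `S = sinh (l d)` on the range `S ≤ l N / K`; `hfin` makes it positive at
the end of this range. -/
theorem mixed_quadratic_pos {P R c s l N K Q Y S b : ℝ} (hP : 0 < P) (hPR : 0 < P * R + c)
    (hc : 0 < c) (hs : 0 < s) (hl : 0 < l) (hN : 0 < N) (hKpos : 0 < K)
    (hYN : s ^ 2 * N ≤ Y) (hQN : s ^ 2 * N ≤ Q)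
    (hfin : 0 < N * (2 * K ^ 2 - (P * R + c) * Q) + 4 * c * K ^ 2 ∨
      (Y ≤ Q ∧ 0 < (Q - Y) * P * K
        + s * l * (N * (2 * K ^ 2 - (P * R + c) * Q) + 4 * c * K ^ 2)))
    (hS : 0 < S) (hge : K * S ≤ l * N) (hb0' : 0 ≤ b) (hbl : b * l ≤ s * S) :
    0 < (if Y ≤ Q then (Q - Y) * P * S else 0) + 2 * s * K ^ 2 * S ^ 2
      - (Q - Y) * (l * (P * R + c)) * b * S
      + (4 * s * c * l ^ 2 * N - s ^ 3 * N * (P * R + c) * S ^ 2) := by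
  have hBr : ∀ W, 0 ≤ W → (0 < W * P * K
      + s * l * (N * (2 * K ^ 2 - (P * R + c) * Q) + 4 * c * K ^ 2)) →
      0 < W * P * S + s * (2 * K ^ 2 - (P * R + c) * Q) * S ^ 2 + 4 * s * c * l ^ 2 * N := by
    intro W hW hx
    have hc0 : 0 < 4 * s * c * l ^ 2 * N := by positivity
    rcases le_or_gt 0 (2 * K ^ 2 - (P * R + c) * Q) with hB | hB
    · have : 0 ≤ W * P * S + s * (2 * K ^ 2 - (P * R + c) * Q) * S ^ 2 := by positivity
      linarith
    · have h1 : s * (2 * K ^ 2 - (P * R + c) * Q) * S * (l * N)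
          ≤ s * (2 * K ^ 2 - (P * R + c) * Q) * S * (K * S) :=
        mul_le_mul_of_nonpos_left hge
          (mul_nonpos_of_nonpos_of_nonneg (mul_nonpos_of_nonneg_of_nonpos hs.le hB.le) hS.le)
      have h2 : 4 * s * c * l * K * (K * S) ≤ 4 * s * c * l * K * (l * N) :=
        mul_le_mul_of_nonneg_left hge (by positivity)
      have h3 := mul_pos hS hx
      refine pos_of_mul_pos_left (b := K) ?_ hKpos.le
      linarith
  have h4 : (P * R + c) * (s ^ 2 * N) ≤ (P * R + c) * Q := mul_le_mul_of_nonneg_left hQN hPR.le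
  split_ifs with hv
  · have hx : 0 < (Q - Y) * P * K
        + s * l * (N * (2 * K ^ 2 - (P * R + c) * Q) + 4 * c * K ^ 2) := by
      rcases hfin with h | h
      · have h1 : 0 ≤ (Q - Y) * P * K := by
          have := sub_nonneg.mpr hv
          positivity
        have h2 := mul_pos (mul_pos hs hl) h
        linarith
      · exact h.2
    have h5 := hBr (Q - Y) (sub_nonneg.mpr hv) hx
    have h6 : (Q - Y) * (l * (P * R + c)) * b * S ≤ (Q - Y) * (P * R + c) * s * S ^ 2 := by
      have := mul_le_mul_of_nonneg_left hbl
        (mul_nonneg (mul_nonneg (sub_nonneg.mpr hv) hPR.le) hS.le)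
      linarith
    have h7 : (P * R + c) * (s ^ 2 * N) * (s * S ^ 2) ≤ (P * R + c) * Y * (s * S ^ 2) :=
      mul_le_mul_of_nonneg_right (mul_le_mul_of_nonneg_left hYN hPR.le) (by positivity)
    linarith
  · push Not at hv
    have hx : 0 < N * (2 * K ^ 2 - (P * R + c) * Q) + 4 * c * K ^ 2 := by
      rcases hfin with h | h
      · exact h
      · exact absurd h.1 (not_le.mpr hv)
    have h5 := hBr 0 le_rfl (by have := mul_pos (mul_pos hs hl) hx; linarith)
    have h6 : 0 ≤ (Y - Q) * (l * (P * R + c)) * b * S := by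
      have := sub_nonneg.mpr hv.le
      positivity
    have h7 := mul_le_mul_of_nonneg_right h4 (by positivity : 0 ≤ s * S ^ 2)
    linarith

/-- The Schur–Cohn condition, given polynomial inequalities between the wave numbers `s` (shear)
and `l` (pressure). Either `K sinh (l d) > l N`, and the condition holds for every phase, or `d`,
and with it the phase `s d`, is so small that the second order bounds for `cos` and `sin` suffice. -/
theorem mixed_schurCohn_pos {P R c s l d N K G Q Y : ℝ} (hP : 0 < P) (hR : 0 < R) (hc : 0 < c)
    (hs : 0 < s) (hl : 0 < l) (hd : 0 < d) (hN : 0 < N) (hNe : N = P * R - c)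
    (hK : K = P + c * l ^ 2 * R) (hG : G = P - c * l ^ 2 * R) (hQ : Q = P ^ 2 + c ^ 2 * l ^ 2)
    (hY : Y = s ^ 2 * (1 + l ^ 2 * R ^ 2)) (hYN : s ^ 2 * N ≤ Y) (hQN : s ^ 2 * N ≤ Q)
    (hθ : s ^ 2 * N ^ 2 ≤ 2 * K ^ 2)
    (hfin : 0 < N * (2 * K ^ 2 - (P * R + c) * Q) + 4 * c * K ^ 2 ∨
      (Y ≤ Q ∧ 0 < (Q - Y) * P * K
        + s * l * (N * (2 * K ^ 2 - (P * R + c) * Q) + 4 * c * K ^ 2)))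
    {S C a b : ℝ} (hS0 : l * d < S) (hC : 1 ≤ C) (hcs : C ^ 2 = S ^ 2 + 1)
    (hab : a ^ 2 + b ^ 2 = 1) (ha1 : a ≤ 1) (ha : 1 - (s * d) ^ 2 / 2 ≤ a)
    (hb : b ≤ s * d) (hb0 : (s * d) ^ 2 ≤ 2 → 0 ≤ b) :
    0 < (P ^ 2 + s ^ 2 + (s * l * R) ^ 2 + (c * l) ^ 2) * (P * s + s * l * R * (c * l)) * S * C
      + 2 * (P * s + s * l * R * (c * l)) ^ 2 * S ^ 2
      + a * (2 * (P * (s * l * R) - s * (c * l)) * (P * (s * l * R) + s * (c * l)) * C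
        - (s ^ 2 + (s * l * R) ^ 2 - P ^ 2 - (c * l) ^ 2) * (P * s - s * l * R * (c * l)) * S)
      + b * ((s ^ 2 + (s * l * R) ^ 2 - P ^ 2 - (c * l) ^ 2) * (P * (s * l * R) + s * (c * l)) * S
        + 2 * (P * (s * l * R) - s * (c * l)) * (P * s - s * l * R * (c * l)) * C)
      - 2 * (P * (s * l * R) - s * (c * l)) ^ 2 := by
  have hS : 0 < S := lt_trans (by positivity) hS0
  have hKpos : 0 < K := by rw [hK]; positivity
  have hKs : P * s + s * l * R * (c * l) = s * K := by rw [hK]; ring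
  have hws : P * (s * l * R) - s * (c * l) = s * (l * N) := by rw [hNe]; ring
  rcases lt_or_ge (l * N) (K * S) with hlt | hge
  · refine mixed_pos_of_dominated hP (by positivity) hs (by positivity) hS (by linarith) hcs hab ?_ ?_
    · rw [hws]; positivity
    · rw [hws, hKs, mul_assoc]; exact mul_lt_mul_of_pos_left hlt hs
  have hHs : P * (s * l * R) + s * (c * l) = s * (l * (P * R + c)) := by ring
  have hGs : P * s - s * l * R * (c * l) = s * G := by rw [hG]; ring
  have hus : s ^ 2 + (s * l * R) ^ 2 - P ^ 2 - (c * l) ^ 2 = Y - Q := by rw [hY, hQ]; ring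
  have hsum : P ^ 2 + s ^ 2 + (s * l * R) ^ 2 + (c * l) ^ 2 = Q + Y := by rw [hY, hQ]; ring
  rw [hws, hKs, hHs, hGs, hus, hsum]
  have hQ0 : 0 < Q := by rw [hQ]; positivity
  have hY0 : 0 < Y := by rw [hY]; positivity
  have hsd0 : 0 < s * d := by positivity
  have hθS : s * d * l ≤ s * S := by
    have := mul_le_mul_of_nonneg_left hS0.le hs.le
    linarith
  have hθ2 : (s * d) ^ 2 ≤ 2 := by
    have h1 : s * d * K ≤ s * N := by
      have h0 : l * (d * K) ≤ l * N := by
        have := mul_le_mul_of_nonneg_right hS0.le hKpos.le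
        linarith
      have := mul_le_mul_of_nonneg_left (le_of_mul_le_mul_left h0 hl) hs.le
      linarith
    have h2 : (s * d * K) ^ 2 ≤ (s * N) ^ 2 := pow_le_pow_left₀ (by positivity) h1 2
    have h3 : (s * d) ^ 2 * K ^ 2 ≤ 2 * K ^ 2 := by linarith
    exact le_of_mul_le_mul_right h3 (by positivity)
  have ha0 : 0 ≤ a := by linarith
  have hb0' := hb0 hθ2
  have hθS2 : (s * d) ^ 2 * l ^ 2 ≤ s ^ 2 * S ^ 2 := by
    have := pow_le_pow_left₀ (by positivity) hθS 2
    linarith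
  have hbl : b * l ≤ s * S := (mul_le_mul_of_nonneg_right hb hl.le).trans hθS
  have hKG : K + G = 2 * P := by rw [hK, hG]; ring
  have hKG' : K - G = 2 * (c * l ^ 2 * R) := by rw [hK, hG]; ring
  have hclR : 0 < c * l ^ 2 * R := by positivity
  -- the part of the expression that carries the factor `cos θ cosh L`
  have T3 : 4 * s * c * l ^ 2 * N - s ^ 3 * N * (P * R + c) * S ^ 2
      ≤ 2 * s * (l * N) * (C * (l * (P * R + c) * a) - l * N) := by
    have h1 : 1 - (s * d) ^ 2 / 2 ≤ C * a := ha.trans (le_mul_of_one_le_left ha0 hC)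
    have h2 : 0 < P * R + c := by positivity
    have h3 : 2 * s * (l * N) * (l * (P * R + c) * (1 - (s * d) ^ 2 / 2) - l * N)
        ≤ 2 * s * (l * N) * (C * (l * (P * R + c) * a) - l * N) := by
      refine mul_le_mul_of_nonneg_left ?_ (by positivity)
      have := mul_le_mul_of_nonneg_left h1 (by positivity : 0 ≤ l * (P * R + c))
      linarith
    refine le_trans ?_ h3
    have h4 := mul_le_mul_of_nonneg_left hθS2 (by positivity : 0 ≤ s * N * (P * R + c))
    have h5 : 2 * s * (l * N) * (l * (P * R + c) * (1 - (s * d) ^ 2 / 2) - l * N)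
        = 4 * s * c * l ^ 2 * N - s * N * (P * R + c) * ((s * d) ^ 2 * l ^ 2) := by
      rw [hNe]; ring
    rw [h5]
    linarith
  -- the terms with the traction coefficient `G`
  have T2 : (if Y ≤ Q then (Q - Y) * P * S else 0) ≤
      (Q + Y) * K * C * S + (Q - Y) * G * a * S + 2 * s * (l * N) * C * G * b := by
    exact mixed_traction_bound hP hs hl hN (by rw [hK]; linarith) hKG
      (by rw [hKG']; linarith) hQ0 hY0 hYN hQN hS hC ha0 ha1 hb0' hbl
  -- what remains is a quadratic polynomial in `S`
  have T4 : 0 < (if Y ≤ Q then (Q - Y) * P * S else 0) + 2 * s * K ^ 2 * S ^ 2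
      - (Q - Y) * (l * (P * R + c)) * b * S
      + (4 * s * c * l ^ 2 * N - s ^ 3 * N * (P * R + c) * S ^ 2) := by
    exact mixed_quadratic_pos hP (by positivity) hc hs hl hN hKpos hYN hQN hfin hS hge hb0' hbl
  have hfinal : (Q + Y) * (s * K) * S * C + 2 * (s * K) ^ 2 * S ^ 2
      + a * (2 * (s * (l * N)) * (s * (l * (P * R + c))) * C - (Y - Q) * (s * G) * S)
      + b * ((Y - Q) * (s * (l * (P * R + c))) * S + 2 * (s * (l * N)) * (s * G) * C)
      - 2 * (s * (l * N)) ^ 2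
      = s * (((Q + Y) * K * C * S + (Q - Y) * G * a * S + 2 * s * (l * N) * C * G * b)
        + 2 * s * K ^ 2 * S ^ 2 - (Q - Y) * (l * (P * R + c)) * b * S
        + 2 * s * (l * N) * (C * (l * (P * R + c) * a) - l * N)) := by ring
  rw [hfinal]
  exact mul_pos hs (by linarith)

/-! ### Polynomial inequalities for `1/c < k < 1` -/

theorem seven_fifths_lt {c : ℝ} (hc : 0 < c) (hc2 : 2 < c ^ 2) : 7 / 5 < c := by nlinarith

/-- Writing `κ` as a weighted mean of `1/c²` and `r` turns inequalities on the range
`1/c² < κ < r` into inequalities for polynomials in `y ≥ 0`, which have nonnegative coefficients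
once `c` is written as a lower bound plus a nonnegative number. -/
theorem exists_homogeneous_parameter {c κ r : ℝ} (hκ : 1 / c ^ 2 < κ) (hr : κ < r) :
    ∃ y : ℝ, 0 ≤ y ∧ κ * (1 + y) = 1 / c ^ 2 + r * y := by
  refine ⟨(κ - 1 / c ^ 2) / (r - κ), div_nonneg (by linarith) (by linarith), ?_⟩
  have : r - κ ≠ 0 := by linarith
  field_simp
  ring

/-- The inequality that makes the phase small when the Schur–Cohn condition does not hold for
all phases. -/
theorem mixed_angle_poly {c κ : ℝ} (hc : 7 / 5 ≤ c) (hκ : 1 / c ^ 2 < κ) (hκ1 : κ < 1) :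
    5 * (2 - κ) * (4 * κ + c - 2) ^ 2 ≤ 14 * (1 + c) * (4 * κ + c - 4 / c) := by
  obtain ⟨y, hy, h⟩ := exists_homogeneous_parameter hκ hκ1
  have hc0 : 0 < c := by linarith
  have hκe : κ = (1 + y * c ^ 2) / (c ^ 2 * (1 + y)) := by
    field_simp at h ⊢
    linarith
  have hpoly : ∀ e y : ℝ, 0 ≤ e → 0 ≤ y → 0 ≤
      14 * (1 + (7 / 5 + e)) * (4 * (1 + y * (7 / 5 + e) ^ 2) * (7 / 5 + e)
        + ((7 / 5 + e) ^ 2 - 4) * ((7 / 5 + e) ^ 2 * (1 + y))) * ((7 / 5 + e) ^ 2 * (1 + y)) ^ 2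
      - 5 * (7 / 5 + e) * (2 * ((7 / 5 + e) ^ 2 * (1 + y)) - (1 + y * (7 / 5 + e) ^ 2))
        * (4 * (1 + y * (7 / 5 + e) ^ 2) + (7 / 5 + e - 2) * ((7 / 5 + e) ^ 2 * (1 + y))) ^ 2 := by
    intro e y he hy
    ring_nf
    positivity
  have h1 := hpoly (c - 7 / 5) y (by linarith) hy
  rw [show 7 / 5 + (c - 7 / 5) = c by ring] at h1
  rw [← sub_nonneg]
  have h2 : 14 * (1 + c) * (4 * κ + c - 4 / c) - 5 * (2 - κ) * (4 * κ + c - 2) ^ 2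
      = (14 * (1 + c) * (4 * (1 + y * c ^ 2) * c + (c ^ 2 - 4) * (c ^ 2 * (1 + y)))
          * (c ^ 2 * (1 + y)) ^ 2
        - 5 * c * (2 * (c ^ 2 * (1 + y)) - (1 + y * c ^ 2))
          * (4 * (1 + y * c ^ 2) + (c - 2) * (c ^ 2 * (1 + y))) ^ 2)
        / (c * (c ^ 2 * (1 + y)) ^ 3) := by
    rw [hκe]; field_simp; ring
  rw [h2]
  positivity

/-- Reduction of the main polynomial inequality to one with nonnegative variables. -/
theorem mixed_discriminant_pos {a r : ℝ} (ha : 0 < a)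
    (hpoly : ∀ e y : ℝ, 0 ≤ e → 0 ≤ y → 0 <
      2 * (1 + (a + e)) ^ 2 * (4 * (1 + r * y * (a + e) ^ 2) * (a + e)
        + ((a + e) ^ 2 - 4) * ((a + e) ^ 2 * (1 + y))) ^ 2 * ((a + e) ^ 2 * (1 + y)) ^ 3
      - (a + e) ^ 2 * (4 * (1 + r * y * (a + e) ^ 2) + (a + e - 2) * ((a + e) ^ 2 * (1 + y))) ^ 2
        * ((1 + r * y * (a + e) ^ 2)
            * (4 * (1 + r * y * (a + e) ^ 2) + (a + e - 4) * ((a + e) ^ 2 * (1 + y))) ^ 2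
          + 2 * (4 * (1 + r * y * (a + e) ^ 2) + (a + e - 4) * ((a + e) ^ 2 * (1 + y)))
            * ((a + e) ^ 2 * (1 + y)) ^ 2
          + (a + e) ^ 2 * ((a + e) ^ 2 * (1 + y)) ^ 3))
    {c κ : ℝ} (hc : a ≤ c) (hκ : 1 / c ^ 2 < κ) (hκ1 : κ < r) :
    0 < 2 * (1 + c) ^ 2 * (4 * κ + c - 4 / c) ^ 2
      - (4 * κ + c - 2) ^ 2 * (κ * (4 * κ + c - 4) ^ 2 + 2 * (4 * κ + c - 4) + c ^ 2) := by
  obtain ⟨y, hy, h⟩ := exists_homogeneous_parameter hκ hκ1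
  have hc0 : 0 < c := by linarith
  have hκe : κ = (1 + r * y * c ^ 2) / (c ^ 2 * (1 + y)) := by
    field_simp at h ⊢
    linarith
  have h1 := hpoly (c - a) y (by linarith) hy
  rw [show a + (c - a) = c by ring] at h1
  set k := 1 + r * y * c ^ 2 with hk
  set m := c ^ 2 * (1 + y) with hm
  have hm0 : 0 < m := by positivity
  have h2 : 2 * (1 + c) ^ 2 * (4 * κ + c - 4 / c) ^ 2
      - (4 * κ + c - 2) ^ 2 * (κ * (4 * κ + c - 4) ^ 2 + 2 * (4 * κ + c - 4) + c ^ 2)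
      = (2 * (1 + c) ^ 2 * (4 * k * c + (c ^ 2 - 4) * m) ^ 2 * m ^ 3
      - c ^ 2 * (4 * k + (c - 2) * m) ^ 2
        * (k * (4 * k + (c - 4) * m) ^ 2 + 2 * (4 * k + (c - 4) * m) * m ^ 2 + c ^ 2 * m ^ 3))
        / (c ^ 2 * m ^ 5) := by
    rw [hκe]; field_simp; ring
  rw [h2]
  positivity

/-- The main polynomial inequality away from the cut-off frequency `κ = 1` of the shear wave. -/
theorem mixed_discriminant_pos_of_lt {c κ : ℝ} (hc : 7 / 5 ≤ c) (hκ : 1 / c ^ 2 < κ)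
    (hκ1 : κ < 97 / 100) :
    0 < 2 * (1 + c) ^ 2 * (4 * κ + c - 4 / c) ^ 2
      - (4 * κ + c - 2) ^ 2 * (κ * (4 * κ + c - 4) ^ 2 + 2 * (4 * κ + c - 4) + c ^ 2) := by
  refine mixed_discriminant_pos (a := 7 / 5) (by norm_num) (fun e y he hy => ?_) hc hκ hκ1
  ring_nf
  positivity

/-- The main polynomial inequality away from the least speed ratio `c = √2`. -/
theorem mixed_discriminant_pos_of_le {c κ : ℝ} (hc : 36 / 25 ≤ c) (hκ : 1 / c ^ 2 < κ)
    (hκ1 : κ < 1) :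
    0 < 2 * (1 + c) ^ 2 * (4 * κ + c - 4 / c) ^ 2
      - (4 * κ + c - 2) ^ 2 * (κ * (4 * κ + c - 4) ^ 2 + 2 * (4 * κ + c - 4) + c ^ 2) := by
  refine mixed_discriminant_pos (a := 36 / 25) (by norm_num) (fun e y he hy => ?_) hc hκ hκ1
  ring_nf
  positivity

theorem mixed_energy_bound {c κ : ℝ} (hc : 0 < c) (hc2 : 2 < c ^ 2) (hκ : 1 / c ^ 2 < κ) :
    0 ≤ (2 * κ - 1) * ((4 * κ + c - 3) ^ 2 + 1) + c ^ 2 - 2 := by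
  have h75 := seven_fifths_lt hc hc2
  rcases le_or_gt (1 / 2) κ with h | h
  · have : 0 ≤ (2 * κ - 1) * ((4 * κ + c - 3) ^ 2 + 1) :=
      mul_nonneg (by linarith) (by positivity)
    linarith
  · have hκc : 1 < κ * c ^ 2 := by rwa [div_lt_iff₀ (by positivity)] at hκ
    have h1 : (4 * κ + c - 3) ^ 2 ≤ (c - 1) ^ 2 := by
      refine sq_le_sq' ?_ (by linarith)
      nlinarith [sq_nonneg (κ - 1 / 2), sq_nonneg (c - 3 / 2), mul_pos hc hc]
    have h2 : (4 * κ + c - 3) ^ 2 + 1 ≤ c ^ 2 := by nlinarith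
    nlinarith

/-! ### The symbols of the transmission problem -/

/-- The part of the determinant of the matrix `P` of outgoing traces that is even in the exponents
`l₁` (shear) and `l₂` (pressure), in units in which `ω = Cₛ = 1` and `c = Cₚ / Cₛ`. -/
def symbolX (c k : ℝ) (l₁ l₂ : ℂ) : ℂ :=
  -(2 * (k : ℂ) ^ 2 - 1) ^ 2 + (2 * k) ^ 2 * (l₁ * l₂) + c * (l₁ * l₂ - k ^ 2)

/-- The part of the determinant of the matrix of outgoing traces that is odd in the exponents. -/
def symbolY (c : ℝ) (l₁ l₂ : ℂ) : ℂ := Complex.I * (l₁ + c * l₂)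

/-- The diagonal entries of `adjugate (P l) * P (-l)`, where `P l` is the matrix of traces of waves
with exponents `l = (l₁, l₂)`, have the common even part `-symbolZ`. -/
def symbolZ (c k : ℝ) (l₁ l₂ : ℂ) : ℂ :=
  (2 * (k : ℂ) ^ 2 - 1) ^ 2 + (2 * k) ^ 2 * (l₁ * l₂) + c * (l₁ * l₂ + k ^ 2)

/-- The odd parts of the diagonal entries of `adjugate (P l) * P (-l)` are `symbolV` and
`-symbolV`. -/
def symbolV (c : ℝ) (l₁ l₂ : ℂ) : ℂ := Complex.I * (l₁ - c * l₂)

/-- Stability of the error propagation for the tangential wave number `k`, exponents `l₁` (shear)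
and `l₂` (pressure), speed ratio `c` and overlap `d`, in units in which `ω = Cₛ = 1`. -/
def StableSymbol (c k d : ℝ) (l₁ l₂ : ℂ) : Prop :=
  Stable (symbolX c k l₁ l₂) (symbolY c l₁ l₂) (symbolZ c k l₁ l₂) (symbolV c l₁ l₂)
    (Complex.exp (-(l₁ * d))) (Complex.exp (-(l₂ * d)))

/-- Both waves propagate; any overlap is stable. -/
theorem stableSymbol_of_propagating {c k d s₁ s₂ : ℝ} (hc : 0 < c) (hs₁ : 0 < s₁) (hs₂ : 0 < s₂)
    (hk : k ^ 2 < 1 / 2) : StableSymbol c k d (Complex.I * s₁) (Complex.I * s₂) := by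
  have hx : symbolX c k (Complex.I * s₁) (Complex.I * s₂)
      = ((-(2 * k ^ 2 - 1) ^ 2 - (2 * k) ^ 2 * (s₁ * s₂) - c * (s₁ * s₂ + k ^ 2) : ℝ) : ℂ) := by
    rw [symbolX]; push_cast
    linear_combination (4 * (k : ℂ) ^ 2 + c) * (s₁ * s₂) * Complex.I_sq
  have hy : symbolY c (Complex.I * s₁) (Complex.I * s₂) = ((-(s₁ + c * s₂) : ℝ) : ℂ) := by
    rw [symbolY]; push_cast
    linear_combination ((s₁ : ℂ) + c * s₂) * Complex.I_sq
  have hz : symbolZ c k (Complex.I * s₁) (Complex.I * s₂)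
      = (((2 * k ^ 2 - 1) ^ 2 - (2 * k) ^ 2 * (s₁ * s₂) + c * (k ^ 2 - s₁ * s₂) : ℝ) : ℂ) := by
    rw [symbolZ]; push_cast
    linear_combination (4 * (k : ℂ) ^ 2 + c) * (s₁ * s₂) * Complex.I_sq
  have hv : symbolV c (Complex.I * s₁) (Complex.I * s₂) = ((c * s₂ - s₁ : ℝ) : ℂ) := by
    rw [symbolV]; push_cast
    linear_combination ((s₁ : ℂ) - c * s₂) * Complex.I_sq
  have hs : 0 < s₁ * s₂ := mul_pos hs₁ hs₂
  have hcs : 0 < c * s₂ := mul_pos hc hs₂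
  have hA : 0 < (2 * k ^ 2 - 1) ^ 2 := by
    have : 2 * k ^ 2 - 1 ≠ 0 := by linarith
    positivity
  have h1 : 0 ≤ (2 * k) ^ 2 * (s₁ * s₂) := by positivity
  have h2 : 0 < c * (s₁ * s₂) := by positivity
  have h3 : 0 ≤ c * k ^ 2 := by positivity
  have hexp : ∀ s : ℝ, ‖Complex.exp (-(Complex.I * s * d))‖ = 1 := by
    intro s
    rw [show -(Complex.I * s * d) = ((-(s * d) : ℝ) : ℂ) * Complex.I by push_cast; ring,
      Complex.norm_exp_ofReal_mul_I]
  rw [StableSymbol, hx, hy, hz, hv]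
  refine stable_of_real ?_ ?_ ?_ ?_ (hexp _) (hexp _)
  · linarith
  · linarith
  · rw [abs_lt]; constructor <;> linarith
  · rw [abs_lt]; constructor <;> linarith

set_option maxHeartbeats 1000000 in
/-- Near `κ = 1`, `c = √2` the main polynomial inequality fails, but the terms it neglects
compensate. -/
theorem mixed_corner_bound {c κ s l : ℝ} (hc : 7 / 5 ≤ c) (hc' : c ≤ 36 / 25) (hs : 0 < s)
    (hl : 0 < l) (hs2 : s ^ 2 = 1 - κ) (hl2 : l ^ 2 = κ - 1 / c ^ 2) (hκ : 97 / 100 ≤ κ)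
    (hκ1 : κ < 1) {P Q Y K : ℝ} (hP : P = (2 * κ - 1) ^ 2 + c * κ) (hQ : Q = P ^ 2 + c ^ 2 * l ^ 2)
    (hY : Y = s ^ 2 * (1 + l ^ 2 * (4 * κ + c) ^ 2)) (hK : K = κ * (1 + c) * (4 * κ + c - 4 / c)) :
    Y ≤ Q ∧ 0 < (Q - Y) * P * K + s * l * ((κ * (4 * κ + c - 2) ^ 2 + 2 * c) * κ ^ 2 *
      (2 * (1 + c) ^ 2 * (4 * κ + c - 4 / c) ^ 2 - (4 * κ + c - 2) ^ 2 *
        (κ * (4 * κ + c - 4) ^ 2 + 2 * (4 * κ + c - 4) + c ^ 2))) := by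
  have hcc : 4 / c ≤ 20 / 7 := by rw [div_le_div_iff₀ (by linarith) (by norm_num)]; linarith
  have hi1 : 1 / c ^ 2 ≤ 25 / 49 := by
    rw [div_le_div_iff₀ (by positivity) (by norm_num)]; nlinarith
  have hi2 : 12 / 25 ≤ 1 / c ^ 2 := by
    rw [div_le_div_iff₀ (by norm_num) (by positivity)]; nlinarith
  have hP1 : 22 / 10 ≤ P := by rw [hP]; nlinarith
  have hl1 : l ^ 2 ≤ 13 / 25 := by rw [hl2]; linarith
  have hl0 : 45 / 100 ≤ l ^ 2 := by rw [hl2]; linarith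
  have hs1 : s ^ 2 ≤ 3 / 100 := by rw [hs2]; linarith
  have hQ1 : 56 / 10 ≤ Q := by
    rw [hQ]
    have : (7 / 5) ^ 2 * (45 / 100) ≤ c ^ 2 * l ^ 2 := by gcongr
    nlinarith
  have hY1 : Y ≤ 6 / 10 := by
    rw [hY]
    have h1 : (4 * κ + c) ^ 2 ≤ (544 / 100) ^ 2 := by gcongr; linarith
    have h2 : s ^ 2 * (1 + l ^ 2 * (4 * κ + c) ^ 2) ≤ 3 / 100 * (1 + 13 / 25 * (544 / 100) ^ 2) := by
      gcongr
    linarith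
  have hk1 : 24 / 10 ≤ 4 * κ + c - 4 / c := by linarith
  have hK1 : 55 / 10 ≤ K := by
    rw [hK]
    have : 97 / 100 * (1 + 7 / 5) * (24 / 10) ≤ κ * (1 + c) * (4 * κ + c - 4 / c) := by
      gcongr
    linarith
  have hsl : s * l ≤ 126 / 1000 := by
    refine le_of_pow_le_pow_left₀ two_ne_zero (by norm_num) ?_
    rw [mul_pow]
    calc s ^ 2 * l ^ 2 ≤ 3 / 100 * (13 / 25) := by gcongr
      _ ≤ _ := by norm_num
  have hu : (4 * κ + c - 2) ^ 2 ≤ (344 / 100) ^ 2 := by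
    refine pow_le_pow_left₀ (by linarith) (by linarith) 2
  have hM1 : κ * (4 * κ + c - 2) ^ 2 + 2 * c ≤ 15 := by
    have := mul_le_mul hκ1.le hu (by positivity) (by norm_num)
    linarith
  have hM0 : 0 < κ * (4 * κ + c - 2) ^ 2 + 2 * c := by positivity
  have hz : (4 * κ + c - 4) ^ 2 ≤ (144 / 100) ^ 2 := by
    refine pow_le_pow_left₀ (by linarith) (by linarith) 2
  have hD : -18 ≤ 2 * (1 + c) ^ 2 * (4 * κ + c - 4 / c) ^ 2 - (4 * κ + c - 2) ^ 2 *
        (κ * (4 * κ + c - 4) ^ 2 + 2 * (4 * κ + c - 4) + c ^ 2) := by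
    have h1 : 2 * (1 + 7 / 5) ^ 2 * (24 / 10) ^ 2 ≤ 2 * (1 + c) ^ 2 * (4 * κ + c - 4 / c) ^ 2 := by
      gcongr
    have h2 : κ * (4 * κ + c - 4) ^ 2 + 2 * (4 * κ + c - 4) + c ^ 2
        ≤ (144 / 100) ^ 2 + 2 * (144 / 100) + (144 / 100) ^ 2 := by
      have h3 := mul_le_mul hκ1.le hz (by positivity) (by norm_num)
      have h4 : c ^ 2 ≤ (144 / 100) ^ 2 := pow_le_pow_left₀ (by linarith) (by linarith) 2
      linarith
    have hnn : 0 ≤ κ * (4 * κ + c - 4) ^ 2 + 2 * (4 * κ + c - 4) + c ^ 2 := by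
      have h3 : 0 ≤ κ * (4 * κ + c - 4) ^ 2 := mul_nonneg (by linarith) (sq_nonneg _)
      have h4 := sq_nonneg c
      linarith
    have h5 := mul_le_mul hu h2 hnn (by positivity)
    norm_num at h1 h5
    linarith
  refine ⟨by linarith, ?_⟩
  have hbig : (56 / 10 - 6 / 10) * (22 / 10) * (55 / 10) ≤ (Q - Y) * P * K := by
    have : 56 / 10 - 6 / 10 ≤ Q - Y := by linarith
    gcongr
  have hκ2 : κ ^ 2 ≤ 1 := pow_le_one₀ (by linarith) hκ1.le
  set D := 2 * (1 + c) ^ 2 * (4 * κ + c - 4 / c) ^ 2 - (4 * κ + c - 2) ^ 2 *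
        (κ * (4 * κ + c - 4) ^ 2 + 2 * (4 * κ + c - 4) + c ^ 2)
  set M := κ * (4 * κ + c - 2) ^ 2 + 2 * c
  have h6 : s * l * (M * κ ^ 2) * 18 ≤ 126 / 1000 * (15 * 1) * 18 := by gcongr
  have h7 := mul_le_mul_of_nonneg_left hD (by positivity : 0 ≤ s * l * (M * κ ^ 2))
  norm_num at hbig
  linarith

set_option maxHeartbeats 1000000 in
/-- The shear wave propagates and the pressure wave decays; any positive overlap is stable. -/
theorem stableSymbol_of_mixed {c k d s l : ℝ} (hc : 0 < c) (hc2 : 2 < c ^ 2) (hk : 0 < k)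
    (hd : 0 < d) (hs : 0 < s) (hl : 0 < l) (hs2 : s ^ 2 = 1 - k ^ 2) (hl2 : l ^ 2 = k ^ 2 - 1 / c ^ 2) :
    StableSymbol c k d (Complex.I * s) l := by
  have h75 := seven_fifths_lt hc hc2
  obtain ⟨κ, hκe⟩ : ∃ κ, κ = k ^ 2 := ⟨_, rfl⟩
  have hκ0 : 0 < κ := by rw [hκe]; positivity
  rw [← hκe] at hs2 hl2
  have hκ : 1 / c ^ 2 < κ := by nlinarith [pow_pos hl 2]
  have hκ1 : κ < 1 := by nlinarith [pow_pos hs 2]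
  obtain ⟨P, hP⟩ : ∃ P, P = (2 * κ - 1) ^ 2 + c * κ := ⟨_, rfl⟩
  obtain ⟨R, hR⟩ : ∃ R, R = 4 * κ + c := ⟨_, rfl⟩
  have hP0 : 0 < P := by rw [hP]; positivity
  have hR0 : 0 < R := by rw [hR]; positivity
  have hu : 0 < 4 * κ + c - 2 := by
    have h1 : 1 < κ * c ^ 2 := by rwa [div_lt_iff₀ (by positivity)] at hκ
    by_contra! h
    nlinarith [sq_nonneg (c - 4 / 3), sq_nonneg (κ - 1 / 4)]
  have hNe : κ * (4 * κ + c - 2) ^ 2 = P * R - c := by rw [hP, hR]; ring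
  have hN0 : 0 < κ * (4 * κ + c - 2) ^ 2 := by positivity
  have hKe : κ * (1 + c) * (4 * κ + c - 4 / c) = P + c * l ^ 2 * R := by
    rw [hP, hR, hl2]; field_simp; ring
  have hK0 : 0 < κ * (1 + c) * (4 * κ + c - 4 / c) := by rw [hKe]; positivity
  have hQe : P ^ 2 + c ^ 2 * l ^ 2
      = κ * (κ * (4 * κ + c - 4) ^ 2 + 2 * (4 * κ + c - 4) + c ^ 2) := by
    rw [hP, hl2]; field_simp; ring
  have hYN : s ^ 2 * (κ * (4 * κ + c - 2) ^ 2) ≤ s ^ 2 * (1 + l ^ 2 * R ^ 2) := by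
    refine mul_le_mul_of_nonneg_left ?_ (by positivity)
    have h1 : 1 + l ^ 2 * R ^ 2 - κ * (4 * κ + c - 2) ^ 2
        = 4 * κ * (1 + 1 / c) * (4 * (κ - 1 / c ^ 2) * (1 - 1 / c)
          + (c ^ 2 - 2) * ((c - 1) ^ 2 + 1) / c ^ 3) := by
      rw [hR, hl2]; field_simp; ring
    have h2 : 0 ≤ 1 - 1 / c := by
      rw [sub_nonneg, div_le_one hc]; linarith
    have h3 : 0 ≤ κ - 1 / c ^ 2 := by linarith
    have h4 : 0 ≤ c ^ 2 - 2 := by linarith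
    have : 0 ≤ 1 + l ^ 2 * R ^ 2 - κ * (4 * κ + c - 2) ^ 2 := by rw [h1]; positivity
    linarith
  have hQN : s ^ 2 * (κ * (4 * κ + c - 2) ^ 2) ≤ P ^ 2 + c ^ 2 * l ^ 2 := by
    have h1 := mul_nonneg hκ0.le (mixed_energy_bound hc hc2 hκ)
    rw [hQe, hs2]
    linarith
  have hθ : s ^ 2 * (κ * (4 * κ + c - 2) ^ 2) ^ 2
      ≤ 2 * (κ * (1 + c) * (4 * κ + c - 4 / c)) ^ 2 := by
    have h1 := mixed_angle_poly h75.le hκ hκ1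
    have hs1 : s ≤ (2 - κ) / 2 := by
      refine le_of_pow_le_pow_left₀ two_ne_zero (by linarith) ?_
      rw [hs2]; linarith [sq_nonneg κ]
    have h2 : s * (κ * (4 * κ + c - 2) ^ 2) ≤ 7 / 5 * (κ * (1 + c) * (4 * κ + c - 4 / c)) := by
      have h3 := mul_le_mul_of_nonneg_right hs1 hN0.le
      have h4 := mul_le_mul_of_nonneg_left h1 hκ0.le
      linarith
    have h5 := pow_le_pow_left₀ (by positivity) h2 2
    have h6 := sq_nonneg (κ * (1 + c) * (4 * κ + c - 4 / c))
    rw [mul_pow, mul_pow (7 / 5 : ℝ)] at h5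
    linarith
  have hxe : κ * (4 * κ + c - 2) ^ 2 * (2 * (κ * (1 + c) * (4 * κ + c - 4 / c)) ^ 2
        - (P * R + c) * (P ^ 2 + c ^ 2 * l ^ 2)) + 4 * c * (κ * (1 + c) * (4 * κ + c - 4 / c)) ^ 2
      = (κ * (4 * κ + c - 2) ^ 2 + 2 * c) * κ ^ 2 *
      (2 * (1 + c) ^ 2 * (4 * κ + c - 4 / c) ^ 2 - (4 * κ + c - 2) ^ 2 *
        (κ * (4 * κ + c - 4) ^ 2 + 2 * (4 * κ + c - 4) + c ^ 2)) := by
    rw [show P * R + c = κ * (4 * κ + c - 2) ^ 2 + 2 * c by rw [hNe]; ring, hQe]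
    ring
  have hfin := mixed_schurCohn_pos (P := P) (R := R) (c := c) (s := s) (l := l) (d := d)
    (S := Real.sinh (l * d)) (C := Real.cosh (l * d)) (a := Real.cos (s * d)) (b := Real.sin (s * d))
    hP0 hR0 hc hs hl hd hN0 hNe hKe rfl rfl rfl hYN hQN hθ ?_
    (Real.self_lt_sinh_iff.mpr (by positivity)) (Real.one_le_cosh _) (Real.cosh_sq _)
    (Real.cos_sq_add_sin_sq _) (Real.cos_le_one _) (Real.one_sub_sq_div_two_le_cos)
    (Real.sin_le (by positivity)) ?_
  · have hst := stable_of_mixed (g := P) (h := s * l * R) (m := s) (n := c * l) (θ := s * d)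
      (L := l * d) hP0 (by positivity) hs (by positivity) (by positivity) hfin
    rw [StableSymbol]
    convert hst using 1
    · rw [symbolX, hP, hR, hκe]; push_cast; ring
    · rw [symbolY]; push_cast; linear_combination (s : ℂ) * Complex.I_sq
    · rw [symbolZ, hP, hR, hκe]; push_cast; ring
    · rw [symbolV]; push_cast; linear_combination (s : ℂ) * Complex.I_sq
    · congr 1; push_cast; ring
    · rw [Complex.ofReal_exp]; push_cast; rfl
  · rw [hxe]
    have hpos : 0 < (κ * (4 * κ + c - 2) ^ 2 + 2 * c) * κ ^ 2 := by positivity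
    -- the thresholds only separate the corner `κ = 1`, `c = √2` from the rest of the range
    rcases lt_or_ge κ (97 / 100) with h | h
    · exact Or.inl (mul_pos hpos (mixed_discriminant_pos_of_lt h75.le hκ h))
    · rcases le_or_gt (36 / 25) c with h' | h'
      · exact Or.inl (mul_pos hpos (mixed_discriminant_pos_of_le h' hκ hκ1))
      · right
        refine mixed_corner_bound h75.le h'.le hs hl hs2 hl2 h hκ1 hP rfl ?_ rfl
        rw [hR]
  · intro h
    refine Real.sin_nonneg_of_nonneg_of_le_pi (by positivity) ?_
    have h3 : s * d ≤ 3 := le_of_pow_le_pow_left₀ two_ne_zero (by norm_num) (by linarith)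
    linarith [Real.pi_gt_three]

/-! ### Hyperbolic functions in a logarithmic variable -/

theorem nonneg_of_hasDerivAt {f f' : ℝ → ℝ} (hf : ∀ x, HasDerivAt f (f' x) x) (h0 : 0 ≤ f 0)
    (h' : ∀ x, 0 < x → 0 ≤ f' x) {x : ℝ} (hx : 0 ≤ x) : 0 ≤ f x := by
  have hm : MonotoneOn f (Ici 0) := by
    refine monotoneOn_of_deriv_nonneg (convex_Ici 0) (fun y _ => (hf y).continuousAt.continuousWithinAt)
      (fun y _ => (hf y).differentiableAt.differentiableWithinAt) fun y hy => ?_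
    rw [interior_Ici] at hy
    rw [(hf y).deriv]
    exact h' y hy
  exact h0.trans (hm self_mem_Ici hx hx)

theorem monotoneOn_of_hasDerivAt_Ioi {f f' : ℝ → ℝ} (hf : ∀ x, 0 < x → HasDerivAt f (f' x) x)
    (h' : ∀ x, 0 < x → 0 ≤ f' x) : MonotoneOn f (Ioi 0) := by
  refine monotoneOn_of_deriv_nonneg (convex_Ioi 0)
    (fun y hy => (hf y hy).continuousAt.continuousWithinAt)
    (fun y hy => (hf y (interior_subset hy)).differentiableAt.differentiableWithinAt) fun y hy => ?_
  rw [(hf y (interior_subset hy)).deriv]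
  exact h' y (interior_subset hy)

/-- A Hermite–Hadamard inequality in the variable `log x`: if `x r'(x)` increases, then `r` is
convex as a function of `log x`, so its integral `∫ r(x) dx / x = G q - G p` over an interval with
geometric centre `b` is at least the length `log (q / p)` times the value at `b`. -/
theorem mul_log_le_sub_of_monotoneOn {G r τ : ℝ → ℝ} (hG : ∀ x, 0 < x → HasDerivAt G (r x / x) x)
    (hr : ∀ x, 0 < x → HasDerivAt r (τ x / x) x) (hτ : MonotoneOn τ (Ioi 0)) {b p q : ℝ}
    (hb : 0 < b) (hp : 0 < p) (hpq : p ≤ q) (h : p * q = b ^ 2) :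
    r b * Real.log (q / p) ≤ G q - G p := by
  have hq : 0 < q := hp.trans_le hpq
  have hpos : ∀ s, 0 < b * Real.exp s := fun s => by positivity
  have he : ∀ s, HasDerivAt (fun s => b * Real.exp s) (b * Real.exp s) s := fun s =>
    (Real.hasDerivAt_exp s).const_mul b
  have he' : ∀ s, HasDerivAt (fun s => b * Real.exp (-s)) (-(b * Real.exp (-s))) s := fun s => by
    have := ((hasDerivAt_neg s).exp).const_mul b
    simpa using! this
  have hG1 : ∀ s, HasDerivAt (fun s => G (b * Real.exp s)) (r (b * Real.exp s)) s := fun s => by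
    have := (hG _ (hpos s)).comp s (he s)
    rwa [div_mul_cancel₀ _ (hpos s).ne'] at this
  have hG2 : ∀ s, HasDerivAt (fun s => G (b * Real.exp (-s))) (-r (b * Real.exp (-s))) s := fun s => by
    have := (hG _ (hpos (-s))).comp s (he' s)
    rwa [mul_neg, div_mul_cancel₀ _ (hpos (-s)).ne'] at this
  have hr1 : ∀ s, HasDerivAt (fun s => r (b * Real.exp s)) (τ (b * Real.exp s)) s := fun s => by
    have := (hr _ (hpos s)).comp s (he s)
    rwa [div_mul_cancel₀ _ (hpos s).ne'] at this
  have hr2 : ∀ s, HasDerivAt (fun s => r (b * Real.exp (-s))) (-τ (b * Real.exp (-s))) s := fun s => by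
    have := (hr _ (hpos (-s))).comp s (he' s)
    rwa [mul_neg, div_mul_cancel₀ _ (hpos (-s)).ne'] at this
  have hφ : ∀ s, 0 ≤ s → 0 ≤ r (b * Real.exp s) + r (b * Real.exp (-s)) - 2 * r b := by
    intro s hs
    refine nonneg_of_hasDerivAt
      (f := fun s => r (b * Real.exp s) + r (b * Real.exp (-s)) - 2 * r b)
      (f' := fun s => τ (b * Real.exp s) + -τ (b * Real.exp (-s)))
      (fun x => ((hr1 x).add (hr2 x)).sub_const _) (by simp; linarith) (fun x hx => ?_) hs
    have : τ (b * Real.exp (-x)) ≤ τ (b * Real.exp x) :=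
      hτ (hpos _) (hpos _) (by gcongr; linarith)
    linarith
  have hF : ∀ s, 0 ≤ s → 0 ≤ G (b * Real.exp s) - G (b * Real.exp (-s)) - s * (2 * r b) := by
    intro s hs
    refine nonneg_of_hasDerivAt
      (f := fun s => G (b * Real.exp s) - G (b * Real.exp (-s)) - s * (2 * r b))
      (f' := fun s => r (b * Real.exp s) - -r (b * Real.exp (-s)) - 1 * (2 * r b))
      (fun x => ((hG1 x).sub (hG2 x)).sub ((hasDerivAt_id x).mul_const _)) (by simp)
      (fun x hx => ?_) hs
    linarith [hφ x hx.le]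
  have hbq : b ≤ q := by nlinarith
  have h1 := hF (Real.log (q / b)) (Real.log_nonneg ((one_le_div hb).mpr hbq))
  have h2 : b * Real.exp (Real.log (q / b)) = q := by
    rw [Real.exp_log (by positivity)]; field_simp
  have h3 : b * Real.exp (-Real.log (q / b)) = p := by
    rw [Real.exp_neg, Real.exp_log (by positivity)]
    field_simp
    linarith
  have h4 : Real.log (q / p) = 2 * Real.log (q / b) := by
    rw [show q / p = (q / b) ^ 2 by field_simp; linarith, Real.log_pow]
    norm_num
  rw [h2, h3] at h1
  rw [h4]
  linarith

theorem sinh_le_self_mul_cosh {x : ℝ} (hx : 0 ≤ x) : Real.sinh x ≤ x * Real.cosh x := by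
  have := nonneg_of_hasDerivAt (f := fun x => x * Real.cosh x - Real.sinh x)
    (f' := fun x => 1 * Real.cosh x + x * Real.sinh x - Real.cosh x)
    (fun x => ((hasDerivAt_id x).mul (Real.hasDerivAt_cosh x)).sub (Real.hasDerivAt_sinh x))
    (by simp) (fun x hx => by
      have : 0 ≤ x * Real.sinh x := mul_nonneg hx.le (Real.sinh_nonneg_iff.mpr hx.le)
      linarith) hx
  linarith

theorem self_mul_cosh_le {x : ℝ} (hx : 0 ≤ x) :
    3 * (x * Real.cosh x - Real.sinh x) ≤ x ^ 2 * Real.sinh x := by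
  have := nonneg_of_hasDerivAt
    (f := fun x => x ^ 2 * Real.sinh x - 3 * (x * Real.cosh x - Real.sinh x))
    (f' := fun x => ((2 : ℕ) * x ^ (2 - 1)) * Real.sinh x + x ^ 2 * Real.cosh x
      - 3 * (1 * Real.cosh x + x * Real.sinh x - Real.cosh x))
    (fun x => ((hasDerivAt_pow 2 x).mul (Real.hasDerivAt_sinh x)).sub
      ((((hasDerivAt_id x).mul (Real.hasDerivAt_cosh x)).sub (Real.hasDerivAt_sinh x)).const_mul 3))
    (by simp) (fun x hx => by
      have := mul_le_mul_of_nonneg_left (sinh_le_self_mul_cosh hx.le) hx.le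
      norm_num
      linarith) hx
  linarith

theorem three_mul_sinh_le {y : ℝ} (hy : 0 ≤ y) :
    3 * Real.sinh y ≤ y * (2 + Real.cosh y) := by
  have h1 : ∀ x : ℝ, 0 ≤ x → 0 ≤ 2 - 2 * Real.cosh x + x * Real.sinh x := fun x hx =>
    nonneg_of_hasDerivAt (f := fun x => 2 - 2 * Real.cosh x + x * Real.sinh x)
      (f' := fun x => -(2 * Real.sinh x) + (1 * Real.sinh x + x * Real.cosh x))
      (fun x => (((Real.hasDerivAt_cosh x).const_mul 2).const_sub 2).add
        ((hasDerivAt_id x).mul (Real.hasDerivAt_sinh x)))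
      (by simp) (fun x hx => by linarith [sinh_le_self_mul_cosh hx.le]) hx
  have := nonneg_of_hasDerivAt
    (f := fun x => x * (2 + Real.cosh x) - 3 * Real.sinh x)
    (f' := fun x => 1 * (2 + Real.cosh x) + x * Real.sinh x - 3 * Real.cosh x)
    (fun x => ((hasDerivAt_id x).mul ((Real.hasDerivAt_cosh x).const_add 2)).sub
      ((Real.hasDerivAt_sinh x).const_mul 3))
    (by simp) (fun x hx => by linarith [h1 x hx.le]) hy
  linarith

theorem self_le_sinh_mul_cosh {x : ℝ} (hx : 0 ≤ x) : x ≤ Real.sinh x * Real.cosh x := by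
  have h1 := Real.self_le_sinh_iff.mpr hx
  have h2 := Real.one_le_cosh x
  nlinarith

theorem one_add_sq_div_two_le_cosh {x : ℝ} (hx : 0 ≤ x) : 1 + x ^ 2 / 2 ≤ Real.cosh x := by
  have := nonneg_of_hasDerivAt (f := fun x => Real.cosh x - (1 + x ^ 2 / 2))
    (f' := fun x => Real.sinh x - ((2 : ℕ) * x ^ (2 - 1)) / 2)
    (fun x => (Real.hasDerivAt_cosh x).sub (((hasDerivAt_pow 2 x).div_const 2).const_add 1))
    (by simp) (fun x hx => by
      have := Real.self_le_sinh_iff.mpr hx.le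
      norm_num
      linarith) hx
  linarith

/-- Here `r(x) = x tanh x`. -/
theorem log_cosh_sub_log_cosh {b p q : ℝ} (hb : 0 < b) (hp : 0 < p) (hpq : p ≤ q)
    (h : p * q = b ^ 2) :
    b * (Real.sinh b / Real.cosh b) * Real.log (q / p)
      ≤ Real.log (Real.cosh q) - Real.log (Real.cosh p) := by
  refine mul_log_le_sub_of_monotoneOn (G := fun x => Real.log (Real.cosh x))
    (r := fun x => x * (Real.sinh x / Real.cosh x))
    (τ := fun x => x * (Real.sinh x / Real.cosh x) + x ^ 2 / Real.cosh x ^ 2) ?_ ?_ ?_ hb hp hpq h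
  · intro x hx
    refine ((Real.hasDerivAt_cosh x).log (Real.cosh_pos x).ne').congr_deriv ?_
    field_simp
  · intro x hx
    have hc := Real.cosh_pos x
    refine ((hasDerivAt_id' x).mul
      ((Real.hasDerivAt_sinh x).div (Real.hasDerivAt_cosh x) hc.ne')).congr_deriv ?_
    have := Real.cosh_sq x
    simp only [Pi.div_apply]
    field_simp
    linear_combination x * this
  · refine monotoneOn_of_hasDerivAt_Ioi (f' := fun x => (Real.sinh x * (Real.cosh x ^ 2 - 2 * x ^ 2)
      + 3 * x * Real.cosh x) / Real.cosh x ^ 3) (fun x hx => ?_) (fun x hx => ?_)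
    · have hc := Real.cosh_pos x
      refine (((hasDerivAt_id' x).mul
        ((Real.hasDerivAt_sinh x).div (Real.hasDerivAt_cosh x) hc.ne')).add
        ((hasDerivAt_pow 2 x).div ((Real.hasDerivAt_cosh x).pow 2)
          (pow_ne_zero 2 hc.ne'))).congr_deriv ?_
      have := Real.cosh_sq x
      simp only [Nat.cast_ofNat, Nat.add_one_sub_one, pow_one, Pi.div_apply, Pi.pow_apply]
      field_simp
      linear_combination (x * Real.cosh x) * this
    · have hS := Real.sinh_nonneg_iff.mpr hx.le
      have hC := Real.cosh_pos x
      have h2 : 2 * x ^ 2 ≤ Real.cosh x ^ 2 := by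
        have h3 := one_add_sq_div_two_le_cosh hx.le
        nlinarith [sq_nonneg (1 - x ^ 2 / 2)]
      have h3 : 0 ≤ Real.sinh x * (Real.cosh x ^ 2 - 2 * x ^ 2) := mul_nonneg hS (by linarith)
      positivity

/-- Here `r(x) = x coth x - 1`. -/
theorem log_sinh_sub_log_sinh {b p q : ℝ} (hb : 0 < b) (hp : 0 < p) (hpq : p ≤ q)
    (h : p * q = b ^ 2) :
    (b * (Real.cosh b / Real.sinh b) - 1) * Real.log (q / p)
      ≤ Real.log (Real.sinh q / q) - Real.log (Real.sinh p / p) := by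
  refine mul_log_le_sub_of_monotoneOn (G := fun x => Real.log (Real.sinh x / x))
    (r := fun x => x * (Real.cosh x / Real.sinh x) - 1)
    (τ := fun x => x * (Real.cosh x / Real.sinh x) - x ^ 2 / Real.sinh x ^ 2) ?_ ?_ ?_ hb hp hpq h
  · intro x hx
    have hs := Real.sinh_pos_iff.mpr hx
    refine (((Real.hasDerivAt_sinh x).div (hasDerivAt_id' x) hx.ne').log
      (div_pos hs hx).ne').congr_deriv ?_
    simp only [Pi.div_apply]
    field_simp
  · intro x hx
    have hs := Real.sinh_pos_iff.mpr hx
    refine (((hasDerivAt_id' x).mul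
      ((Real.hasDerivAt_cosh x).div (Real.hasDerivAt_sinh x) hs.ne')).sub_const 1).congr_deriv ?_
    have := Real.cosh_sq x
    simp only [Pi.div_apply]
    field_simp
    linear_combination (-x) * this
  · refine monotoneOn_of_hasDerivAt_Ioi (f' := fun x => (Real.sinh x ^ 2 * Real.cosh x
      - 3 * x * Real.sinh x + 2 * x ^ 2 * Real.cosh x) / Real.sinh x ^ 3) (fun x hx => ?_) (fun x hx => ?_)
    · have hs := Real.sinh_pos_iff.mpr hx
      refine (((hasDerivAt_id' x).mul
        ((Real.hasDerivAt_cosh x).div (Real.hasDerivAt_sinh x) hs.ne')).sub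
        ((hasDerivAt_pow 2 x).div ((Real.hasDerivAt_sinh x).pow 2)
          (pow_ne_zero 2 hs.ne'))).congr_deriv ?_
      have := Real.cosh_sq x
      simp only [Nat.cast_ofNat, Nat.add_one_sub_one, pow_one, Pi.div_apply, Pi.pow_apply]
      field_simp
      linear_combination (-x * Real.sinh x) * this
    · have hS := Real.sinh_pos_iff.mpr hx
      have h1 := mul_le_mul_of_nonneg_left (sinh_le_self_mul_cosh hx.le) hx.le
      have h2 := mul_le_mul_of_nonneg_left (self_le_sinh_mul_cosh hx.le) hS.le
      have : 0 ≤ Real.sinh x ^ 2 * Real.cosh x - 3 * x * Real.sinh x + 2 * x ^ 2 * Real.cosh x := by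
        nlinarith [self_le_sinh_mul_cosh hx.le, sinh_le_self_mul_cosh hx.le]
      exact div_nonneg this (by positivity)

theorem self_lt_sinh_mul_cosh {x : ℝ} (hx : 0 < x) : x < Real.sinh x * Real.cosh x := by
  have h1 := Real.self_lt_sinh_iff.mpr hx
  have h2 := Real.one_le_cosh x
  nlinarith

theorem strictMonoOn_self_mul_coth :
    StrictMonoOn (fun x => x * (Real.cosh x / Real.sinh x)) (Ioi 0) := by
  have hd : ∀ x, 0 < x → HasDerivAt (fun x => x * (Real.cosh x / Real.sinh x))
      ((Real.sinh x * Real.cosh x - x) / Real.sinh x ^ 2) x := fun x hx => by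
    have hs := Real.sinh_pos_iff.mpr hx
    refine ((hasDerivAt_id' x).mul
      ((Real.hasDerivAt_cosh x).div (Real.hasDerivAt_sinh x) hs.ne')).congr_deriv ?_
    have := Real.cosh_sq x
    simp only [Pi.div_apply]
    field_simp
    linear_combination (-x) * this
  refine strictMonoOn_of_deriv_pos (convex_Ioi 0)
    (fun x hx => (hd x hx).continuousAt.continuousWithinAt) fun x hx => ?_
  rw [interior_Ioi] at hx
  rw [(hd x hx).deriv]
  have hs := Real.sinh_pos_iff.mpr hx
  exact div_pos (sub_pos.mpr (self_lt_sinh_mul_cosh hx)) (by positivity)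

theorem strictAntiOn_sinh_div_sinh {a e : ℝ} (ha : 0 < a) (hae : a < e) :
    StrictAntiOn (fun d => Real.sinh (a * d) / Real.sinh (e * d)) (Ioi 0) := by
  have he : 0 < e := ha.trans hae
  have hlin : ∀ m d : ℝ, HasDerivAt (fun d => m * d) m d := fun m d => by
    simpa using (hasDerivAt_id' d).const_mul m
  have hd : ∀ d, 0 < d → HasDerivAt (fun d => Real.sinh (a * d) / Real.sinh (e * d))
      ((Real.cosh (a * d) * a * Real.sinh (e * d) - Real.sinh (a * d) * (Real.cosh (e * d) * e))
        / Real.sinh (e * d) ^ 2) d := fun d hd =>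
    (hlin a d).sinh.div (hlin e d).sinh (Real.sinh_pos_iff.mpr (mul_pos he hd)).ne'
  refine strictAntiOn_of_deriv_neg (convex_Ioi 0)
    (fun x hx => (hd x hx).continuousAt.continuousWithinAt) fun d hd0 => ?_
  rw [interior_Ioi] at hd0
  rw [(hd d hd0).deriv]
  have hs1 := Real.sinh_pos_iff.mpr (mul_pos ha hd0)
  have hs2 := Real.sinh_pos_iff.mpr (mul_pos he hd0)
  have h := strictMonoOn_self_mul_coth (mul_pos ha hd0 : a * d ∈ Ioi 0) (mul_pos he hd0 : e * d ∈ Ioi 0)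
    (mul_lt_mul_of_pos_right hae hd0)
  dsimp only at h
  rw [← mul_div_assoc, ← mul_div_assoc, div_lt_div_iff₀ hs1 hs2] at h
  refine div_neg_of_neg_of_pos ?_ (by positivity)
  have hd0' : 0 < d := hd0
  nlinarith

theorem antitoneOn_cosh_div_cosh {a e : ℝ} (ha : 0 < a) (hae : a < e) :
    AntitoneOn (fun d => Real.cosh (a * d) / Real.cosh (e * d)) (Ioi 0) := by
  have he : 0 < e := ha.trans hae
  have hlin : ∀ m d : ℝ, HasDerivAt (fun d => m * d) m d := fun m d => by
    simpa using (hasDerivAt_id' d).const_mul m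
  have hd : ∀ d, HasDerivAt (fun d => Real.cosh (a * d) / Real.cosh (e * d))
      ((Real.sinh (a * d) * a * Real.cosh (e * d) - Real.cosh (a * d) * (Real.sinh (e * d) * e))
        / Real.cosh (e * d) ^ 2) d := fun d =>
    (hlin a d).cosh.div (hlin e d).cosh (Real.cosh_pos _).ne'
  refine antitoneOn_of_deriv_nonpos (convex_Ioi 0)
    (fun x _ => (hd x).continuousAt.continuousWithinAt)
    (fun x _ => (hd x).differentiableAt.differentiableWithinAt) fun d hd0 => ?_
  rw [interior_Ioi] at hd0
  have hd0' : 0 < d := hd0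
  rw [(hd d).deriv]
  refine div_nonpos_of_nonpos_of_nonneg ?_ (by positivity)
  have h1 : 0 ≤ Real.sinh (e * d - a * d) := Real.sinh_nonneg_iff.mpr (by nlinarith)
  rw [Real.sinh_sub] at h1
  have h2 : 0 ≤ Real.cosh (a * d) * Real.sinh (e * d) :=
    mul_nonneg (Real.cosh_pos _).le (Real.sinh_nonneg_iff.mpr (by positivity))
  nlinarith

/-! ### Quotients of hyperbolic functions at the critical overlap -/

/-- For `p q = b²` and `q = (1 + y) p`, the quotient `sinh p / sinh q` is below `p / q` by a factor
governed by `b coth b - 1`. -/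
theorem sinh_div_sinh_sq_le {b p q y : ℝ} (hb : 0 < b) (hp : 0 < p) (hy : 0 ≤ y)
    (hq : q = (1 + y) * p) (h : p * q = b ^ 2) :
    (Real.sinh p / Real.sinh q) ^ 2
        * (1 + 4 * (b * (Real.cosh b / Real.sinh b) - 1) * (y / (2 + y))) ≤ 1 / (1 + y) ^ 2 := by
  have hpq : p ≤ q := by nlinarith
  have hq0 : 0 < q := hp.trans_le hpq
  have hsp := Real.sinh_pos_iff.mpr hp
  have hsq := Real.sinh_pos_iff.mpr hq0
  have hsb := Real.sinh_pos_iff.mpr hb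
  have hk : 0 ≤ b * (Real.cosh b / Real.sinh b) - 1 := by
    rw [← mul_div_assoc, sub_nonneg, one_le_div hsb]
    exact sinh_le_self_mul_cosh hb.le
  set κ := b * (Real.cosh b / Real.sinh b) - 1 with hκ
  have hlog := log_sinh_sub_log_sinh hb hp hpq h
  rw [← hκ, show q / p = 1 + y by rw [hq]; field_simp, ← Real.log_div (by positivity) (by positivity)]
    at hlog
  have h2y : 2 * y / (y + 2) ≤ Real.log (1 + y) := Real.le_log_one_add_of_nonneg hy
  -- `exp x ≥ 1 + x` and `log (1 + y) ≥ 2 y / (2 + y)`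
  have hexp : 1 + 4 * κ * (y / (2 + y)) ≤ (Real.sinh q / q / (Real.sinh p / p)) ^ 2 := by
    have h1 := Real.add_one_le_exp (2 * Real.log (Real.sinh q / q / (Real.sinh p / p)))
    rw [mul_comm 2, Real.exp_mul, Real.exp_log (by positivity)] at h1
    norm_cast at h1
    have h3 := mul_le_mul_of_nonneg_left h2y hk
    have h4 : κ * (2 * y / (y + 2)) * 2 = 4 * κ * (y / (2 + y)) := by rw [add_comm y]; ring
    linarith
  calc _ ≤ (Real.sinh p / Real.sinh q) ^ 2 * (Real.sinh q / q / (Real.sinh p / p)) ^ 2 := by gcongr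
    _ = 1 / (1 + y) ^ 2 := by rw [hq]; field_simp

/-- For `p q = b²` and `q = (1 + y) p`, the quotient `cosh p / cosh q` is below `1` by an amount
governed by `b tanh b`. -/
theorem cosh_div_cosh_sq_le {b p q y : ℝ} (hb : 0 < b) (hp : 0 < p) (hy : 0 ≤ y)
    (hq : q = (1 + y) * p) (h : p * q = b ^ 2) (hb1 : b * (Real.sinh b / Real.cosh b) ≤ 1) :
    (Real.cosh p / Real.cosh q) ^ 2
      ≤ 1 - b * (Real.sinh b / Real.cosh b) * (1 - 1 / (1 + y) ^ 2) := by
  have hpq : p ≤ q := by nlinarith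
  have hcp := Real.cosh_pos p
  have hcq := Real.cosh_pos q
  have hk : 0 ≤ b * (Real.sinh b / Real.cosh b) :=
    mul_nonneg hb.le (div_nonneg (Real.sinh_nonneg_iff.mpr hb.le) (Real.cosh_pos b).le)
  have hlog := log_cosh_sub_log_cosh hb hp hpq h
  set κ := b * (Real.sinh b / Real.cosh b)
  rw [show q / p = 1 + y by rw [hq]; field_simp, ← Real.log_div hcq.ne' hcp.ne'] at hlog
  -- Bernoulli's inequality
  have h1 : (1 + (1 / (1 + y) ^ 2 - 1)) ^ κ ≤ 1 + κ * (1 / (1 + y) ^ 2 - 1) :=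
    rpow_one_add_le_one_add_mul_self (by linarith [show 0 ≤ 1 / (1 + y) ^ 2 by positivity]) hk hb1
  have h2 : (Real.cosh p / Real.cosh q) ^ 2 ≤ (1 + (1 / (1 + y) ^ 2 - 1)) ^ κ := by
    rw [Real.le_rpow_iff_log_le (by positivity) (by rw [add_sub_cancel]; positivity), add_sub_cancel,
      Real.log_pow, one_div, Real.log_inv, Real.log_pow, ← inv_div, Real.log_inv]
    push_cast
    linarith
  linarith

set_option maxHeartbeats 1000000 in
/-- The bounds on `b coth b - 1` and `b tanh b` at half the root `2 b` of the overlap equation. -/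
theorem bounds_of_overlap_equation {c b : ℝ} (hc : 0 < c) (hc2 : 2 < c ^ 2) (hb : 0 < b)
    (h : 2 * b * c ^ 2 * (c * Real.cosh (2 * b) + 1) = (c ^ 3 + 3 * c ^ 2 - 4) * Real.sinh (2 * b)) :
    ∃ k₂ k₃ : ℝ, k₂ = b * (Real.cosh b / Real.sinh b) - 1 ∧ k₃ = b * (Real.sinh b / Real.cosh b) ∧
      c ^ 2 * (c + 1) * k₂ + c ^ 2 * (c - 1) * k₃ = 2 * c ^ 2 - 4 ∧ 0 ≤ k₂ ∧ k₂ * c ≤ 1 ∧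
      4 * k₂ ≤ 1 ∧ 0 ≤ k₃ ∧ k₃ ≤ 1 := by
  have hS := Real.sinh_pos_iff.mpr hb
  have hC := Real.cosh_pos b
  have h75 := seven_fifths_lt hc hc2
  have hCS := Real.cosh_sq b
  have h1 := sinh_le_self_mul_cosh hb.le
  have h2 := self_mul_cosh_le hb.le
  have h3 := three_mul_sinh_le (y := 2 * b) (by linarith)
  rw [Real.sinh_two_mul, Real.cosh_two_mul] at h3 h
  set S := Real.sinh b
  set C := Real.cosh b
  obtain ⟨k₂, hk₂⟩ : ∃ k, k = b * (C / S) - 1 := ⟨_, rfl⟩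
  obtain ⟨k₃, hk₃⟩ : ∃ k, k = b * (S / C) := ⟨_, rfl⟩
  have hk₂' : k₂ * S = b * C - S := by rw [hk₂]; field_simp
  have hk₃' : k₃ * C = b * S := by rw [hk₃]; field_simp
  have e1 : c ^ 2 * (c + 1) * k₂ + c ^ 2 * (c - 1) * k₃ = 2 * c ^ 2 - 4 := by
    have : S * C * (c ^ 2 * (c + 1) * k₂ + c ^ 2 * (c - 1) * k₃ - (2 * c ^ 2 - 4)) = 0 := by
      linear_combination c ^ 2 * (c + 1) * C * hk₂' + c ^ 2 * (c - 1) * S * hk₃' + h / 2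
        + b * c ^ 2 * hCS
    rcases mul_eq_zero.mp this with h0 | h0
    · exact absurd h0 (by positivity)
    · linarith
  have k20 : 0 ≤ k₂ := by
    by_contra! h0
    nlinarith
  have k30 : 0 ≤ k₃ := by rw [hk₃]; positivity
  have hprod : k₃ * (1 + k₂) = b ^ 2 := by rw [hk₂, hk₃]; field_simp; ring
  have hle2 : 3 * k₂ ≤ b ^ 2 := by
    by_contra! h0
    nlinarith
  have hle3 : k₃ ≤ 3 * k₂ := by
    have : 0 ≤ (3 * k₂ - k₃) * (S * C) := by
      have : (3 * k₂ - k₃) * (S * C) = 3 * (b * C - S) * C - b * S * S := by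
        linear_combination 3 * C * hk₂' - S * hk₃'
      rw [this]
      nlinarith
    have := nonneg_of_mul_nonneg_left this (by positivity)
    linarith
  -- a first bound, which improves `k₃ ≥ 3 k₂ / (1 + k₂)` to `k₃ ≥ 2 k₂`
  have hk2 : k₂ < 1 / 2 := by
    by_contra! h0
    have hk31 : 1 ≤ k₃ := by
      by_contra! h4
      nlinarith
    nlinarith [mul_nonneg (by positivity : 0 ≤ c ^ 2 * (c + 1)) (sub_nonneg.mpr h0),
      mul_nonneg (mul_nonneg (sq_nonneg c) (by linarith : 0 ≤ c - 1)) (sub_nonneg.mpr hk31),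
      mul_nonneg hc.le (sq_nonneg (c - 7 / 4))]
  have hk32 : 2 * k₂ ≤ k₃ := by nlinarith
  have hmain : c ^ 2 * (3 * c - 1) * k₂ ≤ 2 * c ^ 2 - 4 := by
    nlinarith [mul_nonneg (mul_nonneg (sq_nonneg c) (by linarith : 0 ≤ c - 1)) (sub_nonneg.mpr hk32)]
  refine ⟨k₂, k₃, hk₂, hk₃, e1, k20, ?_, ?_, k30, ?_⟩
  · by_contra! h0
    have : c * (3 * c - 1) < c * (3 * c - 1) * (k₂ * c) :=
      lt_mul_of_one_lt_right (by nlinarith) h0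
    nlinarith
  · by_contra! h0
    have : c ^ 2 * (3 * c - 1) < c ^ 2 * (3 * c - 1) * (4 * k₂) :=
      lt_mul_of_one_lt_right (mul_pos (by positivity) (by linarith)) h0
    nlinarith [mul_nonneg hc.le (sq_nonneg (c - 2)), sq_nonneg (c - 2)]
  · by_contra! h0
    have h4 : 1 / 3 < k₂ := by linarith
    have h5 := mul_pos (by positivity : 0 < c ^ 2 * (c + 1)) (sub_pos.mpr h4)
    have h6 := mul_pos (mul_pos (by positivity : 0 < c ^ 2) (by linarith : 0 < c - 1)) (sub_pos.mpr h0)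
    have h7 : 0 < (c + 1) * (c ^ 2 - 3 * c + 3) :=
      mul_pos (by linarith) (by nlinarith [sq_nonneg (c - 3 / 2)])
    linarith

/-! ### Two decaying waves -/

/-- The polynomial inequality that decides the evanescent case; all coefficients are nonnegative
in the variables `y` and `c - 7/5`. -/
theorem evanescent_polynomial_le {c y : ℝ} (hc : 0 < c) (hc2 : 2 < c ^ 2) (hy : 0 ≤ y) :
    c ^ 5 * (2 + y) * (2 * c + (c - 1) * y) * ((2 * c + (c - 1) * y) * c - 2 * y * (c - 2) ^ 2)
      ≤ 2 * (2 * c ^ 4 + (c - 1) * (c + 3) * c ^ 2 * y + (c - 1) ^ 2 * (c + 1) * y ^ 2) ^ 2 := by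
  have h75 := seven_fifths_lt hc hc2
  obtain ⟨e, he, rfl⟩ : ∃ e : ℝ, 0 ≤ e ∧ c = 7 / 5 + e := ⟨c - 7 / 5, by linarith, by ring⟩
  rw [← sub_nonneg]
  ring_nf
  positivity

/-- Stability of two decaying waves from bounds on `S` and `T` that hold at the critical overlap.
Here `κ = k²`, `L = l₁ l₂` and `1 + y = (l₂ + l₁) / (l₂ - l₁)`; the coefficient of `T²` is
`(l₁ - c l₂)²`, and `(l₁ + c l₂)²` exceeds it by `4 c L`. -/
theorem evanescent_bound {c y k₂ k₃ κ L S T X Z : ℝ} (hc : 0 < c) (hc2 : 2 < c ^ 2) (hy : 0 < y)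
    (hκ : κ = 1 + y ^ 2 * (c ^ 2 - 1) / (4 * c ^ 2 * (1 + y)))
    (hL : L = y * (2 + y) * (c ^ 2 - 1) / (4 * c ^ 2 * (1 + y)))
    (hX : X = -(2 * κ - 1) ^ 2 + 4 * κ * L + c * (L - κ))
    (hZ : Z = (2 * κ - 1) ^ 2 + 4 * κ * L + c * (L + κ))
    (hk : c ^ 2 * (c + 1) * k₂ + c ^ 2 * (c - 1) * k₃ = 2 * c ^ 2 - 4) (hk₂ : 0 ≤ k₂)
    (hk₂c : k₂ * c ≤ 1) (hk₂' : 4 * k₂ ≤ 1)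
    (hS : S ^ 2 * (1 + 4 * k₂ * (y / (2 + y))) < 1 / (1 + y) ^ 2)
    (hT : T ^ 2 ≤ 1 - k₃ * (1 - 1 / (1 + y) ^ 2)) :
    Z ^ 2 * S ^ 2 + (c ^ 2 - 1) * (2 * c + (c - 1) * y) ^ 2 / (4 * c ^ 2 * (1 + y)) * T ^ 2
      < X ^ 2 + ((c ^ 2 - 1) * (2 * c + (c - 1) * y) ^ 2 / (4 * c ^ 2 * (1 + y)) + 4 * c * L) := by
  have h75 := seven_fifths_lt hc hc2
  have hc1 : 0 < c - 1 := by linarith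
  have hc21 : 0 < c ^ 2 - 1 := by linarith
  have hpoly := evanescent_polynomial_le hc hc2 hy.le
  set U := 2 * c + (c - 1) * y with hU
  set N := 2 * c ^ 4 + (c - 1) * (c + 3) * c ^ 2 * y + (c - 1) ^ 2 * (c + 1) * y ^ 2 with hN
  have hUpos : 0 < U := by positivity
  have hNpos : 0 < N := by positivity
  have hZN : (c + 1) * N / (2 * c ^ 4) ≤ Z := by
    have : Z - (c + 1) * N / (2 * c ^ 4) = (c + 1) / c *
        ((c - 1) * y / (2 * c ^ 3) + (c - 1) ^ 2 * (c + 1) / (2 * c ^ 3) * (y / (1 + y))) := by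
      rw [hZ, hκ, hL, hN]
      field_simp
      ring
    have h0 : 0 ≤ (c + 1) / c *
        ((c - 1) * y / (2 * c ^ 3) + (c - 1) ^ 2 * (c + 1) / (2 * c ^ 3) * (y / (1 + y))) := by
      positivity
    linarith
  have hZpos : 0 < Z := lt_of_lt_of_le (by positivity) hZN
  -- the coefficient of `U²` is minus the value that `hk` gives to `k₃` for `k₂ = 0`,
  -- so that adding `k₃ U²` leaves a multiple of `k₂ U²`
  have hJ : X ^ 2 - Z ^ 2 / (1 + y) ^ 2 + 4 * c * L = L / (1 + y) ^ 2 *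
      ((-(2 * c ^ 2 - 4) * U ^ 2 + 2 * y * U * (c - 2) ^ 2 * (c + 1)) / (c ^ 2 * (c - 1))) := by
    rw [hX, hZ, hκ, hL, hU]
    field_simp
    ring
  have hS' : S ^ 2 < 1 / (1 + y) ^ 2 * (1 - 2 * k₂ * y / (1 + y)) := by
    have h1 : 1 ≤ (1 + 4 * k₂ * (y / (2 + y))) * (1 - 2 * k₂ * y / (1 + y)) := by
      have : (1 + 4 * k₂ * (y / (2 + y))) * (1 - 2 * k₂ * y / (1 + y)) - 1
          = 2 * k₂ * y ^ 2 * (1 - 4 * k₂) / ((2 + y) * (1 + y)) := by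
        field_simp
        ring
      have h0 : 0 ≤ 2 * k₂ * y ^ 2 * (1 - 4 * k₂) / ((2 + y) * (1 + y)) :=
        div_nonneg (mul_nonneg (by positivity) (by linarith)) (by positivity)
      linarith
    have h2 : 0 < 1 - 2 * k₂ * y / (1 + y) := by
      rw [sub_pos, div_lt_one (by linarith)]
      nlinarith
    calc S ^ 2 ≤ S ^ 2 * ((1 + 4 * k₂ * (y / (2 + y))) * (1 - 2 * k₂ * y / (1 + y))) :=
          le_mul_of_one_le_right (sq_nonneg S) h1
      _ = S ^ 2 * (1 + 4 * k₂ * (y / (2 + y))) * (1 - 2 * k₂ * y / (1 + y)) := by ring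
      _ < _ := mul_lt_mul_of_pos_right hS h2
  have hmain : 0 ≤ (2 + y) * (2 * y * U * (c - 2) ^ 2 * c ^ 4 - k₂ * c ^ 6 * U ^ 2)
      + 2 * k₂ * N ^ 2 := by
    have h1 := mul_le_mul_of_nonneg_left hpoly hk₂
    have h2 : 0 ≤ (2 + y) * (2 * y * U * (c - 2) ^ 2 * c ^ 4) * (1 - k₂ * c) :=
      mul_nonneg (by positivity) (by linarith)
    linarith
  have hmain' : 0 ≤ (2 + y) * (c + 1) ^ 2 / (4 * c ^ 2)
      * (2 * y * U * (c - 2) ^ 2 / c ^ 2 - k₂ * U ^ 2) + 2 * k₂ * Z ^ 2 := by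
    have h1 : ((c + 1) * N / (2 * c ^ 4)) ^ 2 ≤ Z ^ 2 := by gcongr
    have h2 := mul_le_mul_of_nonneg_left h1 (by positivity : 0 ≤ 2 * k₂)
    have h3 : (2 + y) * (c + 1) ^ 2 / (4 * c ^ 2) * (2 * y * U * (c - 2) ^ 2 / c ^ 2 - k₂ * U ^ 2)
        + 2 * k₂ * ((c + 1) * N / (2 * c ^ 4)) ^ 2
        = (c + 1) ^ 2 / (4 * c ^ 8) * ((2 + y) *
          (2 * y * U * (c - 2) ^ 2 * c ^ 4 - k₂ * c ^ 6 * U ^ 2) + 2 * k₂ * N ^ 2) := by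
      field_simp
      ring
    have h4 : 0 ≤ (c + 1) ^ 2 / (4 * c ^ 8) * ((2 + y) *
          (2 * y * U * (c - 2) ^ 2 * c ^ 4 - k₂ * c ^ 6 * U ^ 2) + 2 * k₂ * N ^ 2) :=
      mul_nonneg (by positivity) hmain
    linarith
  have hfin : X ^ 2 - Z ^ 2 / (1 + y) ^ 2 + 4 * c * L
      + Z ^ 2 * (1 / (1 + y) ^ 2 * (2 * k₂ * y / (1 + y)))
      + (c ^ 2 - 1) * U ^ 2 / (4 * c ^ 2 * (1 + y)) * (k₃ * (1 - 1 / (1 + y) ^ 2))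
      = y / (1 + y) ^ 3 * ((2 + y) * (c + 1) ^ 2 / (4 * c ^ 2)
      * (2 * y * U * (c - 2) ^ 2 / c ^ 2 - k₂ * U ^ 2) + 2 * k₂ * Z ^ 2) := by
    have hk3 : k₃ = (2 * c ^ 2 - 4 - c ^ 2 * (c + 1) * k₂) / (c ^ 2 * (c - 1)) := by
      field_simp
      linarith
    rw [hJ, hk3, hL]
    field_simp
    ring
  have hfin0 : 0 ≤ y / (1 + y) ^ 3 * ((2 + y) * (c + 1) ^ 2 / (4 * c ^ 2)
      * (2 * y * U * (c - 2) ^ 2 / c ^ 2 - k₂ * U ^ 2) + 2 * k₂ * Z ^ 2) :=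
    mul_nonneg (by positivity) hmain'
  have h1 := mul_lt_mul_of_pos_left hS' (by positivity : 0 < Z ^ 2)
  have h2 := mul_le_mul_of_nonneg_left hT
    (by positivity : 0 ≤ (c ^ 2 - 1) * U ^ 2 / (4 * c ^ 2 * (1 + y)))
  have h3 : Z ^ 2 * (1 / (1 + y) ^ 2 * (1 - 2 * k₂ * y / (1 + y)))
      = Z ^ 2 / (1 + y) ^ 2 - Z ^ 2 * (1 / (1 + y) ^ 2 * (2 * k₂ * y / (1 + y))) := by ring
  rw [h3] at h1
  linarith

theorem exp_neg_sub_div {a b : ℝ} :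
    (Real.exp (-a) - Real.exp (-b)) / (1 - Real.exp (-a) * Real.exp (-b))
      = Real.sinh ((b - a) / 2) / Real.sinh ((a + b) / 2) := by
  have h := Real.exp_pos (-(a + b) / 2)
  rw [Real.sinh_eq, Real.sinh_eq, div_div_div_cancel_right₀ two_ne_zero,
    ← mul_div_mul_left (Real.exp ((b - a) / 2) - _) _ h.ne', mul_sub, mul_sub, ← Real.exp_add,
    ← Real.exp_add, ← Real.exp_add, ← Real.exp_add, ← Real.exp_add, ← Real.exp_zero]
  congr 3 <;> ring_nf

theorem exp_neg_add_div {a b : ℝ} :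
    (Real.exp (-a) + Real.exp (-b)) / (1 + Real.exp (-a) * Real.exp (-b))
      = Real.cosh ((b - a) / 2) / Real.cosh ((a + b) / 2) := by
  have h := Real.exp_pos (-(a + b) / 2)
  rw [Real.cosh_eq, Real.cosh_eq, div_div_div_cancel_right₀ two_ne_zero,
    ← mul_div_mul_left (Real.exp ((b - a) / 2) + _) _ h.ne', mul_add, mul_add, ← Real.exp_add,
    ← Real.exp_add, ← Real.exp_add, ← Real.exp_add, ← Real.exp_add, ← Real.exp_zero]
  congr 3 <;> ring_nf

/-- For two decaying waves, stability is a bound on the quotients of hyperbolic functions that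
express the exponentials. -/
theorem stableSymbol_of_hyperbolic_bound {c k d l₁ l₂ : ℝ} (hc : 0 < c) (hd : 0 < d)
    (hl₁ : 0 < l₁) (hl₂ : 0 < l₂)
    (h : ((2 * k ^ 2 - 1) ^ 2 + 4 * k ^ 2 * (l₁ * l₂) + c * (l₁ * l₂ + k ^ 2)) ^ 2
        * (Real.sinh ((l₂ - l₁) / 2 * d) / Real.sinh ((l₁ + l₂) / 2 * d)) ^ 2
        + (l₁ - c * l₂) ^ 2
          * (Real.cosh ((l₂ - l₁) / 2 * d) / Real.cosh ((l₁ + l₂) / 2 * d)) ^ 2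
      < (-(2 * k ^ 2 - 1) ^ 2 + 4 * k ^ 2 * (l₁ * l₂) + c * (l₁ * l₂ - k ^ 2)) ^ 2
        + (l₁ + c * l₂) ^ 2) : StableSymbol c k d l₁ l₂ := by
  have h1 : Real.exp (-(l₁ * d)) < 1 := by
    rw [Real.exp_lt_one_iff]
    have := mul_pos hl₁ hd
    linarith
  have h2 : Real.exp (-(l₂ * d)) < 1 := by
    rw [Real.exp_lt_one_iff]
    have := mul_pos hl₂ hd
    linarith
  have hpos : 0 < l₁ + c * l₂ := by positivity
  rw [show (l₂ - l₁) / 2 * d = (l₂ * d - l₁ * d) / 2 by ring,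
    show (l₁ + l₂) / 2 * d = (l₁ * d + l₂ * d) / 2 by ring, ← exp_neg_sub_div,
    ← exp_neg_add_div] at h
  have key := stable_of_evanescent (by positivity) (Real.exp_pos _) (Real.exp_pos _) h1 h2 h
  have hX : symbolX c k l₁ l₂ = ((-(2 * k ^ 2 - 1) ^ 2 + 4 * k ^ 2 * (l₁ * l₂)
      + c * (l₁ * l₂ - k ^ 2) : ℝ) : ℂ) := by
    unfold symbolX
    push_cast
    ring
  have hY : symbolY c l₁ l₂ = ((l₁ + c * l₂ : ℝ) : ℂ) * Complex.I := by
    unfold symbolY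
    push_cast
    ring
  have hZ : symbolZ c k l₁ l₂ = (((2 * k ^ 2 - 1) ^ 2 + 4 * k ^ 2 * (l₁ * l₂)
      + c * (l₁ * l₂ + k ^ 2) : ℝ) : ℂ) := by
    unfold symbolZ
    push_cast
    ring
  have hV : symbolV c l₁ l₂ = ((l₁ - c * l₂ : ℝ) : ℂ) * Complex.I := by
    unfold symbolV
    push_cast
    ring
  have hE₁ : Complex.exp (-(l₁ * d)) = ((Real.exp (-(l₁ * d)) : ℝ) : ℂ) := by push_cast; rfl
  have hE₂ : Complex.exp (-(l₂ * d)) = ((Real.exp (-(l₂ * d)) : ℝ) : ℂ) := by push_cast; rfl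
  unfold StableSymbol
  rw [hX, hY, hZ, hV, hE₁, hE₂]
  exact key

/-- The wave numbers in terms of the ratio `1 + y = (l₂ + l₁) / (l₂ - l₁)`; note that
`l₂² - l₁² = 1 - 1/c²` does not depend on `k`. -/
theorem evanescent_parametrization {c k l₁ l₂ y : ℝ} (hc : 0 < c) (hy : 0 < y)
    (hsum : l₁ + l₂ = (1 + y) * (l₂ - l₁)) (h₁ : l₁ ^ 2 = k ^ 2 - 1)
    (h₂ : l₂ ^ 2 = k ^ 2 - 1 / c ^ 2) :
    k ^ 2 = 1 + y ^ 2 * (c ^ 2 - 1) / (4 * c ^ 2 * (1 + y)) ∧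
    l₁ * l₂ = y * (2 + y) * (c ^ 2 - 1) / (4 * c ^ 2 * (1 + y)) ∧
    (l₁ - c * l₂) ^ 2
      = (c ^ 2 - 1) * (2 * c + (c - 1) * y) ^ 2 / (4 * c ^ 2 * (1 + y)) ∧
    (l₁ + c * l₂) ^ 2
      = (c ^ 2 - 1) * (2 * c + (c - 1) * y) ^ 2 / (4 * c ^ 2 * (1 + y)) + 4 * c * (l₁ * l₂) := by
  obtain ⟨h, hh⟩ : ∃ h, h = l₂ - l₁ := ⟨_, rfl⟩
  have hl₁' : l₁ = y / 2 * h := by rw [hh]; linarith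
  have hl₂' : l₂ = (2 + y) / 2 * h := by rw [hh]; linarith
  have hprod : (1 + y) * h ^ 2 = 1 - 1 / c ^ 2 := by
    rw [hl₁'] at h₁
    rw [hl₂'] at h₂
    linear_combination h₂ - h₁
  have hH : h ^ 2 = (c ^ 2 - 1) / (c ^ 2 * (1 + y)) := by
    rw [eq_div_iff (by positivity)]
    have : c ^ 2 * (1 - 1 / c ^ 2) = c ^ 2 - 1 := by field_simp
    linear_combination c ^ 2 * hprod + this
  have hV : (l₁ - c * l₂) ^ 2
      = (c ^ 2 - 1) * (2 * c + (c - 1) * y) ^ 2 / (4 * c ^ 2 * (1 + y)) := by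
    have : (l₁ - c * l₂) ^ 2 = (2 * c + (c - 1) * y) ^ 2 / 4 * h ^ 2 := by
      rw [hl₁', hl₂']
      ring
    rw [this, hH]
    field_simp
  refine ⟨?_, ?_, hV, by rw [← hV]; ring⟩
  · have : k ^ 2 = 1 + y ^ 2 / 4 * h ^ 2 := by
      rw [hl₁'] at h₁
      linear_combination -h₁
    rw [this, hH]
    field_simp
  · have : l₁ * l₂ = y * (2 + y) / 4 * h ^ 2 := by
      rw [hl₁', hl₂']
      ring
    rw [this, hH]
    field_simp

set_option maxHeartbeats 1000000 in
/-- Both waves decay, and the overlap exceeds the critical one, `α / √(1 - 1/c²)`. -/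
theorem stableSymbol_of_evanescent {c k d α l₁ l₂ : ℝ} (hc : 0 < c) (hc2 : 2 < c ^ 2)
    (hl₁ : 0 < l₁) (hl₂ : 0 < l₂) (h₁ : l₁ ^ 2 = k ^ 2 - 1) (h₂ : l₂ ^ 2 = k ^ 2 - 1 / c ^ 2)
    (hα : 0 < α)
    (hroot : α * c ^ 2 * (c * Real.cosh α + 1) = (c ^ 3 + 3 * c ^ 2 - 4) * Real.sinh α)
    (hd : α < √(1 - 1 / c ^ 2) * d) : StableSymbol c k d l₁ l₂ := by
  have hc1 : 1 / c ^ 2 < 1 / 2 := one_div_lt_one_div_of_lt two_pos hc2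
  set m := √(1 - 1 / c ^ 2) with hm
  have hmpos : 0 < m := Real.sqrt_pos.mpr (by linarith)
  have hm2 : m ^ 2 = 1 - 1 / c ^ 2 := Real.sq_sqrt (by linarith)
  have hd0 : 0 < α / m := by positivity
  -- `d` is compared with the critical overlap `α / m`, where the product of the arguments of the
  -- hyperbolic functions is `(α / 2)²` for every `k`
  have hdd : α / m < d := by rwa [div_lt_iff₀' hmpos]
  have hdpos : 0 < d := hd0.trans hdd
  have hl : l₁ < l₂ := by nlinarith
  have hh : 0 < l₂ - l₁ := sub_pos.mpr hl
  obtain ⟨y, hy⟩ : ∃ y, y = 2 * l₁ / (l₂ - l₁) := ⟨_, rfl⟩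
  have hy0 : 0 < y := by rw [hy]; positivity
  have hsum : l₁ + l₂ = (1 + y) * (l₂ - l₁) := by rw [hy]; field_simp; ring
  have hprod : (l₂ - l₁) * (l₁ + l₂) = m ^ 2 := by rw [hm2]; linear_combination h₂ - h₁
  have hb : 0 < α / 2 := by positivity
  obtain ⟨k₂, k₃, hk₂, hk₃, hk, hk₂0, hk₂c, hk₂4, hk₃0, hk₃1⟩ :=
    bounds_of_overlap_equation (b := α / 2) hc hc2 hb (by
      rw [mul_div_cancel₀ _ (two_ne_zero)]; exact hroot)
  have hp : 0 < (l₂ - l₁) / 2 * (α / m) := by positivity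
  have hpq : (l₂ - l₁) / 2 * (α / m) * ((l₁ + l₂) / 2 * (α / m)) = (α / 2) ^ 2 := by
    have : (l₂ - l₁) / 2 * (α / m) * ((l₁ + l₂) / 2 * (α / m))
        = (l₂ - l₁) * (l₁ + l₂) * (α / m) ^ 2 / 4 := by ring
    rw [this, hprod]
    field_simp
    norm_num
  have hq : (l₁ + l₂) / 2 * (α / m) = (1 + y) * ((l₂ - l₁) / 2 * (α / m)) := by
    rw [hsum]; ring
  have hS0 := sinh_div_sinh_sq_le hb hp hy0.le hq hpq
  rw [← hk₂] at hS0
  have hT0 := cosh_div_cosh_sq_le hb hp hy0.le hq hpq (by rw [← hk₃]; exact hk₃1)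
  rw [← hk₃] at hT0
  have hae : (l₂ - l₁) / 2 < (l₁ + l₂) / 2 := by linarith
  have hSlt := strictAntiOn_sinh_div_sinh (half_pos hh) hae (mem_Ioi.mpr hd0) (mem_Ioi.mpr hdpos) hdd
  have hTle := antitoneOn_cosh_div_cosh (half_pos hh) hae (mem_Ioi.mpr hd0) (mem_Ioi.mpr hdpos) hdd.le
  dsimp only at hSlt hTle
  have hSpos : 0 < Real.sinh ((l₂ - l₁) / 2 * d) / Real.sinh ((l₁ + l₂) / 2 * d) :=
    div_pos (Real.sinh_pos_iff.mpr (by positivity)) (Real.sinh_pos_iff.mpr (by positivity))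
  have hTpos : 0 < Real.cosh ((l₂ - l₁) / 2 * d) / Real.cosh ((l₁ + l₂) / 2 * d) :=
    div_pos (Real.cosh_pos _) (Real.cosh_pos _)
  set S := Real.sinh ((l₂ - l₁) / 2 * d) / Real.sinh ((l₁ + l₂) / 2 * d) with hS
  set T := Real.cosh ((l₂ - l₁) / 2 * d) / Real.cosh ((l₁ + l₂) / 2 * d) with hT
  have hSS : S ^ 2 * (1 + 4 * k₂ * (y / (2 + y))) < 1 / (1 + y) ^ 2 :=
    (mul_lt_mul_of_pos_right (pow_lt_pow_left₀ hSlt hSpos.le two_ne_zero) (by positivity)).trans_le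
      hS0
  have hTT : T ^ 2 ≤ 1 - k₃ * (1 - 1 / (1 + y) ^ 2) :=
    (pow_le_pow_left₀ hTpos.le hTle 2).trans hT0
  obtain ⟨hκ, hL, hV, hY⟩ := evanescent_parametrization hc hy0 hsum h₁ h₂
  have hbound := evanescent_bound hc hc2 hy0 hκ hL rfl rfl hk hk₂0 hk₂c hk₂4 hSS hTT
  rw [← hY, ← hV] at hbound
  exact stableSymbol_of_hyperbolic_bound hc hdpos hl₁ hl₂ hbound

/-! ### The overlap equation and the physical parameters -/

theorem strictMonoOn_overlap_quotient {c : ℝ} (hc : 1 < c) :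
    StrictMonoOn (fun a => a * (c * Real.cosh a + 1) / Real.sinh a) (Ioi 0) := by
  have hd : ∀ a, 0 < a → HasDerivAt (fun a => a * (c * Real.cosh a + 1) / Real.sinh a)
      (((1 * (c * Real.cosh a + 1) + a * (c * Real.sinh a)) * Real.sinh a
        - a * (c * Real.cosh a + 1) * Real.cosh a) / Real.sinh a ^ 2) a := fun a ha =>
    ((hasDerivAt_id' a).mul (((Real.hasDerivAt_cosh a).const_mul c).add_const 1)).div
      (Real.hasDerivAt_sinh a) (Real.sinh_pos_iff.mpr ha).ne'
  refine strictMonoOn_of_deriv_pos (convex_Ioi 0)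
    (fun a ha => (hd a ha).continuousAt.continuousWithinAt) fun a ha => ?_
  rw [interior_Ioi] at ha
  rw [(hd a ha).deriv]
  have hs := Real.sinh_pos_iff.mpr ha
  refine div_pos ?_ (by positivity)
  have h1 := mul_pos (sub_pos.mpr hc) (sub_pos.mpr (self_lt_sinh_mul_cosh ha))
  have h2 := mul_pos (by positivity : 0 < 1 + Real.cosh a)
    (sub_pos.mpr (Real.self_lt_sinh_iff.mpr ha))
  have h3 := Real.cosh_sq a
  have : (1 * (c * Real.cosh a + 1) + a * (c * Real.sinh a)) * Real.sinh a
      - a * (c * Real.cosh a + 1) * Real.cosh a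
      = (c - 1) * (Real.sinh a * Real.cosh a - a) + (1 + Real.cosh a) * (Real.sinh a - a) := by
    linear_combination (-a * c) * h3
  rw [this]
  positivity

theorem existsUnique_overlap_root {c : ℝ} (hc : 0 < c) (hc2 : 2 < c ^ 2) :
    ∃! α : ℝ, 0 < α ∧
      α * c ^ 2 * (c * Real.cosh α + 1) = (c ^ 3 + 3 * c ^ 2 - 4) * Real.sinh α := by
  have h75 := seven_fifths_lt hc hc2
  have hc1 : 1 < c := by linarith
  set t := c ^ 3 + 3 * c ^ 2 - 4 with ht
  have hcub : 0 < c ^ 3 := by positivity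
  have htpos : 0 < t := by linarith
  refine existsUnique_of_exists_of_unique ?_ ?_
  · -- near `0` the left side is the smaller one, since `c² (c + 1) < t` and `a ≤ sinh a`
    obtain ⟨a, ha, ha0⟩ : ∃ a : ℝ, c ^ 2 * (c * Real.cosh a + 1) < t ∧ 0 < a := by
      have hcont : Continuous fun a : ℝ => c ^ 2 * (c * Real.cosh a + 1) := by fun_prop
      have hlt : c ^ 2 * (c * Real.cosh 0 + 1) < t := by rw [Real.cosh_zero, ht]; linarith
      have h1 : ∀ᶠ a in 𝓝[>] (0 : ℝ), c ^ 2 * (c * Real.cosh a + 1) < t :=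
        (hcont.tendsto 0).mono_left nhdsWithin_le_nhds (gt_mem_nhds hlt)
      exact (h1.and self_mem_nhdsWithin).exists
    set F : ℝ → ℝ := fun a => a * c ^ 2 * (c * Real.cosh a + 1) - t * Real.sinh a with hF
    have hFc : Continuous F := by fun_prop
    have hFa : F a ≤ 0 := by
      have h1 := mul_le_mul_of_nonneg_left (Real.self_le_sinh_iff.mpr ha0.le) htpos.le
      have h2 := mul_le_mul_of_nonneg_left ha.le ha0.le
      simp only [hF]
      linarith
    set e := max a (t / c ^ 3) with he
    have he0 : 0 < e := lt_max_of_lt_left ha0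
    have hFe : 0 ≤ F e := by
      have h1 : t ≤ e * c ^ 3 := by
        rw [← div_le_iff₀ hcub]
        exact le_max_right _ _
      have h2 := mul_le_mul_of_nonneg_right h1 (Real.cosh_pos e).le
      have h3 := mul_le_mul_of_nonneg_left (Real.sinh_lt_cosh e).le htpos.le
      have h4 : 0 < e * c ^ 2 := by positivity
      simp only [hF]
      linarith
    obtain ⟨α, hα, hα0⟩ := intermediate_value_Icc (le_max_left a (t / c ^ 3)) hFc.continuousOn
      ⟨hFa, hFe⟩
    exact ⟨α, ha0.trans_le hα.1, sub_eq_zero.mp hα0⟩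
  · rintro α β ⟨hα, hα'⟩ ⟨hβ, hβ'⟩
    have hq : ∀ a : ℝ, 0 < a → a * c ^ 2 * (c * Real.cosh a + 1) = t * Real.sinh a →
        a * (c * Real.cosh a + 1) / Real.sinh a = t / c ^ 2 := fun a ha h => by
      rw [div_eq_div_iff (Real.sinh_pos_iff.mpr ha).ne' (by positivity)]
      linarith
    exact (strictMonoOn_overlap_quotient hc1).injOn hα hβ ((hq α hα hα').trans (hq β hβ hβ').symm)

theorem Medium.Cs_pos {M : Medium} (hM : M.IsPhysical) : 0 < M.Cs :=
  Real.sqrt_pos.mpr (div_pos hM.mu_pos hM.rho_pos)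

theorem Medium.Cp_pos {M : Medium} (hM : M.IsPhysical) : 0 < M.Cp :=
  Real.sqrt_pos.mpr (div_pos (by linarith [hM.lam_pos, hM.mu_pos]) hM.rho_pos)

theorem Medium.rho_mul_Cs_sq {M : Medium} (hM : M.IsPhysical) : M.rho * M.Cs ^ 2 = M.mu := by
  have := hM.rho_pos
  rw [Medium.Cs, Real.sq_sqrt (div_pos hM.mu_pos hM.rho_pos).le]
  field_simp

theorem Medium.rho_mul_Cp_sq {M : Medium} (hM : M.IsPhysical) :
    M.rho * M.Cp ^ 2 = M.lam + 2 * M.mu := by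
  have := hM.rho_pos
  rw [Medium.Cp, Real.sq_sqrt (div_pos (by linarith [hM.lam_pos, hM.mu_pos]) hM.rho_pos).le]
  field_simp

/-- The ratio of the wave speeds exceeds `√2`. -/
theorem Medium.two_lt_speed_ratio_sq {M : Medium} (hM : M.IsPhysical) :
    2 < (M.Cp / M.Cs) ^ 2 := by
  have h1 := M.rho_mul_Cs_sq hM
  have h2 := M.rho_mul_Cp_sq hM
  have := M.Cs_pos hM
  rw [div_pow, lt_div_iff₀ (by positivity)]
  refine lt_of_mul_lt_mul_left ?_ hM.rho_pos.le
  linarith [hM.lam_pos]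

theorem Medium.isPositiveRoot_iff {M : Medium} (hM : M.IsPhysical) {α : ℝ} :
    M.IsPositiveRoot α ↔ 0 < α ∧ α * (M.Cp / M.Cs) ^ 2 * (M.Cp / M.Cs * Real.cosh α + 1)
      = ((M.Cp / M.Cs) ^ 3 + 3 * (M.Cp / M.Cs) ^ 2 - 4) * Real.sinh α := by
  have := M.Cs_pos hM
  refine and_congr_right fun _ => ?_
  rw [sub_eq_zero]
  have h1 : α * (M.Cp / M.Cs) ^ 2 * (M.Cp / M.Cs * Real.cosh α + 1)
      = α * M.Cp ^ 2 * (M.Cp * Real.cosh α + M.Cs) / M.Cs ^ 3 := by field_simp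
  have h2 : ((M.Cp / M.Cs) ^ 3 + 3 * (M.Cp / M.Cs) ^ 2 - 4) * Real.sinh α
      = (M.Cp ^ 3 + 3 * M.Cp ^ 2 * M.Cs - 4 * M.Cs ^ 3) * Real.sinh α / M.Cs ^ 3 := by field_simp
  rw [h1, h2, div_left_inj' (by positivity)]

/-- At a root `α`, the critical overlap is `α / √(1 - 1/c²)`, measured in units of `Cₛ / ω`. -/
theorem Medium.sqrt_mul_criticalOverlap {M : Medium} (hM : M.IsPhysical) {α : ℝ}
    (hα : M.IsPositiveRoot α) :
    √(1 - 1 / (M.Cp / M.Cs) ^ 2) * (M.criticalOverlap α * M.omega / M.Cs) = α := by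
  have hs := M.Cs_pos hM
  have hp := M.Cp_pos hM
  have hw := hM.omega_pos
  have hC := Real.cosh_pos α
  have h2 := M.two_lt_speed_ratio_sq hM
  have hsp : 0 ≤ M.Cp ^ 2 - M.Cs ^ 2 := by
    rw [div_pow, lt_div_iff₀ (by positivity)] at h2
    nlinarith
  have hsq : √(1 - 1 / (M.Cp / M.Cs) ^ 2) = √(M.Cp ^ 2 - M.Cs ^ 2) / M.Cp := by
    nth_rewrite 3 [← Real.sqrt_sq hp.le]
    rw [← Real.sqrt_div hsp]
    congr 1
    field_simp
  obtain ⟨_, hroot⟩ := hα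
  rw [hsq, Medium.criticalOverlap]
  have h3 := Real.mul_self_sqrt hsp
  set R := √(M.Cp ^ 2 - M.Cs ^ 2)
  have h4 : M.Cp ^ 3 + 3 * M.Cp ^ 2 * M.Cs - 4 * M.Cs ^ 3
      = (M.Cp - M.Cs) * (M.Cp + 2 * M.Cs) ^ 2 := by ring
  rw [h4] at hroot
  field_simp
  linear_combination (-1 : ℝ) * hroot * (M.Cs + M.Cp) + (M.Cp + 2 * M.Cs) ^ 2 * Real.sinh α * h3

/-! ### Geometric decay of matrix powers -/

section PowerDecay

attribute [local instance] Matrix.linftyOpNormedRing Matrix.linftyOpNormedAlgebra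

/-- Powers of a complex matrix whose eigenvalues lie in the open unit disc decay geometrically. -/
theorem exists_geometric_decay {K : Matrix (Fin 2) (Fin 2) ℂ}
    (hK : ∀ z : ℂ, (Matrix.scalar (Fin 2) z - K).det = 0 → ‖z‖ < 1) :
    ∃ C r : ℝ, 0 < r ∧ r < 1 ∧ ∀ (n : ℕ) (v : Fin 2 → ℂ), ‖(K ^ n).mulVec v‖ ≤ C * r ^ n * ‖v‖ := by
  have hspec : spectralRadius ℂ K < ((1 : NNReal) : ENNReal) := by
    refine spectrum.spectralRadius_lt_of_forall_lt_of_nonempty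
      (spectrum.nonempty_of_isAlgClosed_of_finiteDimensional ℂ K) fun z hz => ?_
    have : ‖z‖ < 1 := by
      refine hK z ?_
      by_contra h
      refine hz ?_
      rw [spectrum.mem_resolventSet_iff, Matrix.isUnit_iff_isUnit_det]
      exact isUnit_iff_ne_zero.mpr h
    exact_mod_cast this
  obtain ⟨r, hr, hr1⟩ := ENNReal.lt_iff_exists_nnreal_btwn.mp hspec
  have hr1' : r < 1 := by exact_mod_cast hr1
  have hr0 : 0 < r := by
    have : (0 : ENNReal) < r := lt_of_le_of_lt zero_le hr
    exact_mod_cast this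
  -- Gelfand's formula
  have hev := (spectrum.pow_nnnorm_pow_one_div_tendsto_nhds_spectralRadius K).eventually
    (gt_mem_nhds hr)
  obtain ⟨N, hN⟩ := eventually_atTop.mp hev
  have hbig : ∀ n, N + 1 ≤ n → ‖K ^ n‖ ≤ (r : ℝ) ^ n := fun n hn => by
    have hn0 : (n : ℝ) ≠ 0 := by
      have : 0 < n := by omega
      positivity
    have h1 := (hN n (by omega)).le
    have h2 := ENNReal.rpow_le_rpow h1 (Nat.cast_nonneg n : (0 : ℝ) ≤ n)
    rw [← ENNReal.rpow_mul, one_div_mul_cancel hn0, ENNReal.rpow_one, ENNReal.rpow_natCast] at h2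
    exact_mod_cast h2
  refine ⟨1 + ∑ i ∈ Finset.range (N + 1), ‖K ^ i‖ / (r : ℝ) ^ i, r, by exact_mod_cast hr0,
    by exact_mod_cast hr1', fun n v => ?_⟩
  have hsum : 0 ≤ ∑ i ∈ Finset.range (N + 1), ‖K ^ i‖ / (r : ℝ) ^ i :=
    Finset.sum_nonneg fun i _ => by positivity
  have hrn : 0 < (r : ℝ) ^ n := by positivity
  have hle : ‖K ^ n‖ ≤ (1 + ∑ i ∈ Finset.range (N + 1), ‖K ^ i‖ / (r : ℝ) ^ i) * (r : ℝ) ^ n := by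
    rcases lt_or_ge n (N + 1) with h | h
    · have := Finset.single_le_sum (f := fun i => ‖K ^ i‖ / (r : ℝ) ^ i)
        (fun i _ => by positivity) (Finset.mem_range.mpr h)
      rw [← div_le_iff₀ hrn]
      linarith
    · refine (hbig n h).trans (le_mul_of_one_le_left hrn.le (by linarith))
  exact (Matrix.linfty_opNorm_mulVec _ _).trans (mul_le_mul_of_nonneg_right hle (norm_nonneg v))

end PowerDecay

/-! ### Radiating solutions of `p'' = l² p` -/

/-- A solution of `w' = -l w` does not decay in a direction `F` in which `e^{l x}` is bounded,
unless it vanishes. -/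
theorem eq_zero_of_tendsto_of_hasDerivWithinAt {D : Set ℝ} (hD : Convex ℝ D) {F : Filter ℝ} [F.NeBot]
    {x₀ : ℝ} {l : ℂ} (hF : ∀ᶠ x in F, x ∈ D ∧ l.re * (x - x₀) ≤ 0) {w : ℝ → ℂ}
    (hw : ∀ x ∈ D, HasDerivWithinAt w (-l * w x) D x) (hlim : Tendsto w F (𝓝 0)) (hx₀ : x₀ ∈ D) :
    ∀ x ∈ D, w x = 0 := by
  have hconst : ∀ x ∈ D, Complex.exp (l * (x - x₀)) * w x = w x₀ := by
    intro x hx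
    have hd : ∀ y ∈ D, HasDerivWithinAt (fun y : ℝ => Complex.exp (l * (y - x₀)) * w y) 0 D y := by
      intro y hy
      have h1 : HasDerivWithinAt (fun y : ℝ => Complex.exp (l * (y - x₀)))
          (Complex.exp (l * (y - x₀)) * (l * 1)) D y :=
        ((((hasDerivAt_id y).ofReal_comp.sub_const (x₀ : ℂ)).const_mul l).cexp).hasDerivWithinAt
      convert! h1.mul (hw y hy) using 1
      ring
    have := hD.norm_image_sub_le_of_norm_hasDerivWithin_le (C := 0) hd (fun y _ => by simp) hx₀ hx
    have h2 : Complex.exp (l * (x - x₀)) * w x - Complex.exp (l * (x₀ - x₀)) * w x₀ = 0 := by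
      simpa using this
    simpa [sub_eq_zero] using h2
  have h0 : w x₀ = 0 := by
    have hle : ∀ᶠ x in F, ‖w x₀‖ ≤ ‖w x‖ := by
      filter_upwards [hF] with x hx
      rw [← hconst x hx.1, norm_mul, Complex.norm_exp]
      refine mul_le_of_le_one_left (norm_nonneg _) ?_
      rw [Real.exp_le_one_iff]
      simpa using hx.2
    have := ge_of_tendsto (by simpa using hlim.norm) hle
    exact norm_le_zero_iff.mp this
  intro x hx
  have := hconst x hx
  rw [h0] at this
  exact (mul_eq_zero.mp this).resolve_left (Complex.exp_ne_zero _)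

/-- A radiating solution of `p'' = l² p` on a half line is a multiple of `e^{l (x - x₀)}`. -/
theorem eq_exp_of_radiating {D : Set ℝ} (hD : Convex ℝ D) {F : Filter ℝ} [F.NeBot]
    {x₀ : ℝ} {l : ℂ} (hF : ∀ᶠ x in F, x ∈ D ∧ l.re * (x - x₀) ≤ 0) {p p' : ℝ → ℂ}
    (hp : ∀ x ∈ D, HasDerivWithinAt p (p' x) D x)
    (hp' : ∀ x ∈ D, HasDerivWithinAt p' (l ^ 2 * p x) D x)
    (hlim : Tendsto (fun x => p' x - l * p x) F (𝓝 0)) (hx₀ : x₀ ∈ D) :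
    ∀ x ∈ D, p x = p x₀ * Complex.exp (l * (x - x₀)) ∧ p' x = l * p x := by
  have hw := eq_zero_of_tendsto_of_hasDerivWithinAt hD hF (w := fun x => p' x - l * p x)
    (fun x hx => by
      refine ((hp' x hx).sub ((hp x hx).const_mul l)).congr_deriv ?_
      ring) hlim hx₀
  have hpp : ∀ x ∈ D, p' x = l * p x := fun x hx => sub_eq_zero.mp (hw x hx)
  intro x hx
  refine ⟨?_, hpp x hx⟩
  have hd : ∀ y ∈ D, HasDerivWithinAt (fun y : ℝ => Complex.exp (-(l * (y - x₀))) * p y) 0 D y := by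
    intro y hy
    have h1 : HasDerivWithinAt (fun y : ℝ => Complex.exp (-(l * (y - x₀))))
        (Complex.exp (-(l * (y - x₀))) * (-(l * 1))) D y :=
      ((((hasDerivAt_id y).ofReal_comp.sub_const (x₀ : ℂ)).const_mul l).neg.cexp).hasDerivWithinAt
    convert! h1.mul (hp y hy) using 1
    rw [hpp y hy]
    ring
  have := hD.norm_image_sub_le_of_norm_hasDerivWithin_le (C := 0) hd (fun y _ => by simp) hx₀ hx
  have h2 : Complex.exp (-(l * (x - x₀))) * p x - Complex.exp (-(l * (x₀ - x₀))) * p x₀ = 0 := by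
    simpa using this
  rw [sub_self, mul_zero, neg_zero, Complex.exp_zero, one_mul, sub_eq_zero] at h2
  rw [← h2, mul_right_comm, ← Complex.exp_add]
  simp

/-! ### Linearity and restriction of the differential operators -/

theorem dx_eq {D : Set ℝ} {u : Mode} {v : Fin 2 → ℂ} {x : ℝ} (hD : UniqueDiffOn ℝ D) (hx : x ∈ D)
    (h : HasDerivWithinAt u v D x) : dx D u x = v := h.derivWithin (hD x hx)

theorem hasDerivWithinAt_dx {D : Set ℝ} {u : Mode} (hu : ContDiffOn ℝ 1 u D) {x : ℝ} (hx : x ∈ D) :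
    HasDerivWithinAt u (dx D u x) D x :=
  ((hu.differentiableOn (by norm_num)) x hx).hasDerivWithinAt

theorem hasDerivWithinAt_dx_dx {D : Set ℝ} (hD : UniqueDiffOn ℝ D) {u : Mode}
    (hu : ContDiffOn ℝ 2 u D) {x : ℝ} (hx : x ∈ D) :
    HasDerivWithinAt (dx D u) (dx D (dx D u) x) D x :=
  hasDerivWithinAt_dx (hu.derivWithin hD (by norm_num)) hx

theorem hasDerivWithinAt_divergence {D : Set ℝ} (hD : UniqueDiffOn ℝ D) {u : Mode}
    (hu : ContDiffOn ℝ 2 u D) (k : ℝ) {x : ℝ} (hx : x ∈ D) :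
    HasDerivWithinAt (divergence k D u) (dx D (dx D u) x 0 + Complex.I * k * dx D u x 1) D x :=
  (hasDerivWithinAt_pi.mp (hasDerivWithinAt_dx_dx hD hu hx) 0).add
    ((hasDerivWithinAt_pi.mp (hasDerivWithinAt_dx (hu.of_le (by norm_num)) hx) 1).const_mul _)

theorem hasDerivWithinAt_scalarCurl {D : Set ℝ} (hD : UniqueDiffOn ℝ D) {u : Mode}
    (hu : ContDiffOn ℝ 2 u D) (k : ℝ) {x : ℝ} (hx : x ∈ D) :
    HasDerivWithinAt (scalarCurl k D u) (dx D (dx D u) x 1 - Complex.I * k * dx D u x 0) D x :=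
  (hasDerivWithinAt_pi.mp (hasDerivWithinAt_dx_dx hD hu hx) 1).sub
    ((hasDerivWithinAt_pi.mp (hasDerivWithinAt_dx (hu.of_le (by norm_num)) hx) 0).const_mul _)

theorem derivWithin_divergence {D : Set ℝ} (hD : UniqueDiffOn ℝ D) {u : Mode}
    (hu : ContDiffOn ℝ 2 u D) (k : ℝ) {x : ℝ} (hx : x ∈ D) :
    derivWithin (divergence k D u) D x = dx D (dx D u) x 0 + Complex.I * k * dx D u x 1 :=
  (hasDerivWithinAt_divergence hD hu k hx).derivWithin (hD x hx)

theorem derivWithin_scalarCurl {D : Set ℝ} (hD : UniqueDiffOn ℝ D) {u : Mode}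
    (hu : ContDiffOn ℝ 2 u D) (k : ℝ) {x : ℝ} (hx : x ∈ D) :
    derivWithin (scalarCurl k D u) D x = dx D (dx D u) x 1 - Complex.I * k * dx D u x 0 :=
  (hasDerivWithinAt_scalarCurl hD hu k hx).derivWithin (hD x hx)

theorem Medium.elasticOp_apply (M : Medium) {D : Set ℝ} (hD : UniqueDiffOn ℝ D) {u : Mode}
    (hu : ContDiffOn ℝ 2 u D) (k : ℝ) {x : ℝ} (hx : x ∈ D) :
    M.elasticOp k D u x =
      ![(M.lam + 2 * M.mu) * dx D (dx D u) x 0 - M.mu * k ^ 2 * u x 0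
          + (M.lam + M.mu) * (Complex.I * k * dx D u x 1),
        M.mu * dx D (dx D u) x 1 - (M.lam + 2 * M.mu) * k ^ 2 * u x 1
          + (M.lam + M.mu) * (Complex.I * k * dx D u x 0)] := by
  rw [Medium.elasticOp, gradient, derivWithin_divergence hD hu k hx]
  refine funext (Fin.forall_fin_two.mpr ⟨?_, ?_⟩)
  · simp only [laplacian, Pi.add_apply, Pi.smul_apply, Pi.sub_apply, smul_eq_mul,
      Matrix.cons_val_zero]
    push_cast
    ring
  · simp only [laplacian, divergence, Pi.add_apply, Pi.smul_apply, Pi.sub_apply, smul_eq_mul,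
      Matrix.cons_val_one, Matrix.cons_val_fin_one]
    push_cast
    linear_combination (M.lam + M.mu) * k ^ 2 * u x 1 * Complex.I_sq

theorem Medium.transmission_apply (M : Medium) (k ν : ℝ) (D : Set ℝ) (u : Mode) (x : ℝ) :
    M.transmission k D ν u x =
      ![(M.lam + 2 * M.mu) * ν * dx D u x 0 + M.lam * ν * (Complex.I * k * u x 1)
          + Complex.I * M.rho * M.omega * M.Cp * u x 0,
        M.mu * ν * (dx D u x 1 + Complex.I * k * u x 0)
          + Complex.I * M.rho * M.omega * M.Cs * u x 1] := by
  refine funext (Fin.forall_fin_two.mpr ⟨?_, ?_⟩)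
  · simp only [Medium.transmission, Medium.traction, Medium.taylorSymbol, divergence, scalarCurl,
      Pi.add_apply, Pi.smul_apply, smul_eq_mul, Matrix.cons_val_zero, Matrix.mulVec, dotProduct,
      Fin.sum_univ_two, Matrix.of_apply, Matrix.cons_val_one, Matrix.cons_val_fin_one]
    push_cast
    ring
  · simp only [Medium.transmission, Medium.traction, Medium.taylorSymbol, divergence, scalarCurl,
      Pi.add_apply, Pi.smul_apply, smul_eq_mul, Matrix.cons_val_zero, Matrix.mulVec, dotProduct,
      Fin.sum_univ_two, Matrix.of_apply, Matrix.cons_val_one, Matrix.cons_val_fin_one]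
    push_cast
    ring

theorem dx_add_smul {D : Set ℝ} (hD : UniqueDiffOn ℝ D) {u w : Mode} (hu : ContDiffOn ℝ 1 u D)
    (hw : ContDiffOn ℝ 1 w D) (t : ℂ) {x : ℝ} (hx : x ∈ D) :
    dx D (u + t • w) x = dx D u x + t • dx D w x :=
  dx_eq hD hx ((hasDerivWithinAt_dx hu hx).add ((hasDerivWithinAt_dx hw hx).const_smul t))

theorem dx_dx_add_smul {D : Set ℝ} (hD : UniqueDiffOn ℝ D) {u w : Mode} (hu : ContDiffOn ℝ 2 u D)
    (hw : ContDiffOn ℝ 2 w D) (t : ℂ) {x : ℝ} (hx : x ∈ D) :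
    dx D (dx D (u + t • w)) x = dx D (dx D u) x + t • dx D (dx D w) x :=
  dx_eq hD hx (((hasDerivWithinAt_dx_dx hD hu hx).add
    ((hasDerivWithinAt_dx_dx hD hw hx).const_smul t)).congr
    (fun _ hy => dx_add_smul hD (hu.of_le (by norm_num)) (hw.of_le (by norm_num)) t hy)
    (dx_add_smul hD (hu.of_le (by norm_num)) (hw.of_le (by norm_num)) t hx))

theorem Medium.IsSolution.add_smul {M : Medium} {k : ℝ} {D : Set ℝ} {f g u w : Mode}
    (hD : UniqueDiffOn ℝ D) (hu : M.IsSolution k D f u) (hw : M.IsSolution k D g w) (t : ℂ) :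
    M.IsSolution k D (f + t • g) (u + t • w) := by
  have h2 : ContDiffOn ℝ 2 (u + t • w) D := hu.contDiffOn.add (hw.contDiffOn.const_smul t)
  refine ⟨h2, fun x hx => ?_⟩
  have e1 := hu.equation x hx
  have e2 := hw.equation x hx
  rw [M.elasticOp_apply hD hu.contDiffOn k hx] at e1
  rw [M.elasticOp_apply hD hw.contDiffOn k hx] at e2
  rw [M.elasticOp_apply hD h2 k hx, dx_dx_add_smul hD hu.contDiffOn hw.contDiffOn t hx,
    dx_add_smul hD (hu.contDiffOn.of_le (by norm_num)) (hw.contDiffOn.of_le (by norm_num)) t hx,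
    Pi.add_apply f, ← e1, Pi.smul_apply, ← e2]
  refine funext (Fin.forall_fin_two.mpr ⟨?_, ?_⟩) <;>
  · simp only [Pi.neg_apply, Pi.add_apply, Pi.smul_apply, smul_eq_mul, Matrix.cons_val_zero,
      Matrix.cons_val_one, Matrix.cons_val_fin_one]
    ring

/-- The radiation condition in the direction `F` that admits the waves `e^{l₂ x}` in the divergence
and `e^{l₁ x}` in the curl. It covers both directions, with `l₁ = ± λ₁` and `l₂ = ± λ₂`. -/
def RadiatesAlong (l₁ l₂ : ℂ) (k : ℝ) (D : Set ℝ) (F : Filter ℝ) (u : Mode) : Prop :=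
  Tendsto (fun x => derivWithin (divergence k D u) D x - l₂ * divergence k D u x) F (𝓝 0) ∧
  Tendsto (fun x => derivWithin (scalarCurl k D u) D x - l₁ * scalarCurl k D u x) F (𝓝 0)

theorem Medium.radiatesLeft_iff {M : Medium} {k : ℝ} {D : Set ℝ} {u : Mode} :
    M.RadiatesLeft k D u ↔ RadiatesAlong (M.rootS k) (M.rootP k) k D atBot u := Iff.rfl

theorem Medium.radiatesRight_iff {M : Medium} {k : ℝ} {D : Set ℝ} {u : Mode} :
    M.RadiatesRight k D u ↔ RadiatesAlong (-M.rootS k) (-M.rootP k) k D atTop u := by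
  simp only [Medium.RadiatesRight, RadiatesAlong, neg_mul, sub_neg_eq_add]

theorem RadiatesAlong.add_smul {l₁ l₂ : ℂ} {k : ℝ} {D : Set ℝ} {F : Filter ℝ} {u w : Mode}
    (hD : UniqueDiffOn ℝ D) (hF : ∀ᶠ x in F, x ∈ D) (hu : ContDiffOn ℝ 2 u D)
    (hw : ContDiffOn ℝ 2 w D) (hru : RadiatesAlong l₁ l₂ k D F u)
    (hrw : RadiatesAlong l₁ l₂ k D F w) (t : ℂ) : RadiatesAlong l₁ l₂ k D F (u + t • w) := by
  have h2 : ContDiffOn ℝ 2 (u + t • w) D := hu.add (hw.const_smul t)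
  refine ⟨?_, ?_⟩
  · have := hru.1.add (hrw.1.const_mul t)
    rw [mul_zero, add_zero] at this
    refine this.congr' ?_
    filter_upwards [hF] with x hx
    rw [derivWithin_divergence hD hu k hx, derivWithin_divergence hD hw k hx,
      derivWithin_divergence hD h2 k hx, dx_dx_add_smul hD hu hw t hx, divergence, divergence,
      divergence, dx_add_smul hD (hu.of_le (by norm_num)) (hw.of_le (by norm_num)) t hx]
    simp
    ring
  · have := hru.2.add (hrw.2.const_mul t)
    rw [mul_zero, add_zero] at this
    refine this.congr' ?_
    filter_upwards [hF] with x hx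
    rw [derivWithin_scalarCurl hD hu k hx, derivWithin_scalarCurl hD hw k hx,
      derivWithin_scalarCurl hD h2 k hx, dx_dx_add_smul hD hu hw t hx, scalarCurl, scalarCurl,
      scalarCurl, dx_add_smul hD (hu.of_le (by norm_num)) (hw.of_le (by norm_num)) t hx]
    simp
    ring

theorem dx_of_univ {D : Set ℝ} (hD : UniqueDiffOn ℝ D) {u : Mode} (hu : ContDiffOn ℝ 1 u univ)
    {x : ℝ} (hx : x ∈ D) : dx D u x = dx univ u x :=
  dx_eq hD hx ((hasDerivWithinAt_dx hu (mem_univ x)).mono (subset_univ D))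

theorem dx_dx_of_univ {D : Set ℝ} (hD : UniqueDiffOn ℝ D) {u : Mode} (hu : ContDiffOn ℝ 2 u univ)
    {x : ℝ} (hx : x ∈ D) : dx D (dx D u) x = dx univ (dx univ u) x :=
  dx_eq hD hx (((hasDerivWithinAt_dx_dx uniqueDiffOn_univ hu (mem_univ x)).mono (subset_univ D)).congr
    (fun _ hy => dx_of_univ hD (hu.of_le (by norm_num)) hy) (dx_of_univ hD (hu.of_le (by norm_num)) hx))

theorem Medium.IsSolution.of_univ {M : Medium} {k : ℝ} {D : Set ℝ} {f u : Mode}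
    (hD : UniqueDiffOn ℝ D) (hu : M.IsSolution k univ f u) : M.IsSolution k D f u := by
  have h2 := hu.contDiffOn.mono (subset_univ D)
  refine ⟨h2, fun x hx => ?_⟩
  rw [← hu.equation x (mem_univ x), M.elasticOp_apply hD h2 k hx,
    M.elasticOp_apply uniqueDiffOn_univ hu.contDiffOn k (mem_univ x), dx_dx_of_univ hD hu.contDiffOn hx,
    dx_of_univ hD (hu.contDiffOn.of_le (by norm_num)) hx]

theorem RadiatesAlong.of_univ {l₁ l₂ : ℂ} {k : ℝ} {D : Set ℝ} {F : Filter ℝ} {u : Mode}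
    (hD : UniqueDiffOn ℝ D) (hF : ∀ᶠ x in F, x ∈ D) (hu : ContDiffOn ℝ 2 u univ)
    (hr : RadiatesAlong l₁ l₂ k univ F u) : RadiatesAlong l₁ l₂ k D F u := by
  have h2 := hu.mono (subset_univ D)
  refine ⟨hr.1.congr' ?_, hr.2.congr' ?_⟩
  · filter_upwards [hF] with x hx
    rw [derivWithin_divergence hD h2 k hx,
      derivWithin_divergence uniqueDiffOn_univ hu k (mem_univ x), divergence, divergence,
      dx_dx_of_univ hD hu hx, dx_of_univ hD (hu.of_le (by norm_num)) hx]
  · filter_upwards [hF] with x hx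
    rw [derivWithin_scalarCurl hD h2 k hx,
      derivWithin_scalarCurl uniqueDiffOn_univ hu k (mem_univ x), scalarCurl, scalarCurl,
      dx_dx_of_univ hD hu hx, dx_of_univ hD (hu.of_le (by norm_num)) hx]

theorem Medium.transmission_add_smul {M : Medium} {k ν : ℝ} {D : Set ℝ} (hD : UniqueDiffOn ℝ D)
    {u w : Mode} (hu : ContDiffOn ℝ 1 u D) (hw : ContDiffOn ℝ 1 w D) (t : ℂ) {x : ℝ} (hx : x ∈ D) :
    M.transmission k D ν (u + t • w) x
      = M.transmission k D ν u x + t • M.transmission k D ν w x := by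
  rw [Medium.transmission_apply, Medium.transmission_apply, Medium.transmission_apply,
    dx_add_smul hD hu hw t hx]
  refine funext (Fin.forall_fin_two.mpr ⟨?_, ?_⟩) <;>
  · simp only [Pi.add_apply, Pi.smul_apply, smul_eq_mul, Matrix.cons_val_zero,
      Matrix.cons_val_one, Matrix.cons_val_fin_one]
    ring

theorem Medium.transmission_of_univ {M : Medium} {k ν : ℝ} {D : Set ℝ} (hD : UniqueDiffOn ℝ D)
    {u : Mode} (hu : ContDiffOn ℝ 1 u univ) {x : ℝ} (hx : x ∈ D) :
    M.transmission k D ν u x = M.transmission k univ ν u x := by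
  simp only [Medium.transmission, Medium.traction, divergence, scalarCurl, dx_of_univ hD hu hx]

theorem Medium.transmission_congr {M : Medium} {k ν : ℝ} {D : Set ℝ} {u w : Mode}
    (h : ∀ x ∈ D, u x = w x) {x : ℝ} (hx : x ∈ D) :
    M.transmission k D ν u x = M.transmission k D ν w x := by
  have : dx D u x = dx D w x := derivWithin_congr h (h x hx)
  simp only [Medium.transmission, Medium.traction, divergence, scalarCurl, this, h x hx]

/-! ### Plane waves -/

/-- The superposition of a pressure wave with amplitude `c 0` and a shear wave with amplitude `c 1`,
proportional to `e^{l₂ (x - x₀)}` and `e^{l₁ (x - x₀)}`. -/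
noncomputable def wave (k : ℝ) (l₁ l₂ : ℂ) (x₀ : ℝ) (c : Fin 2 → ℂ) : Mode := fun x =>
  ![c 0 * Complex.exp (l₂ * (x - x₀)) * l₂ + c 1 * Complex.exp (l₁ * (x - x₀)) * (Complex.I * k),
    c 0 * Complex.exp (l₂ * (x - x₀)) * (Complex.I * k) - c 1 * Complex.exp (l₁ * (x - x₀)) * l₁]

theorem contDiff_wave (k : ℝ) (l₁ l₂ : ℂ) (x₀ : ℝ) (c : Fin 2 → ℂ) {n : WithTop ℕ∞} :
    ContDiff ℝ n (wave k l₁ l₂ x₀ c) := by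
  have hE : ∀ l : ℂ, ContDiff ℝ n fun x : ℝ => Complex.exp (l * (x - x₀)) := fun l =>
    (contDiff_const.mul (Complex.ofRealCLM.contDiff.sub contDiff_const)).cexp
  refine contDiff_pi.mpr (Fin.forall_fin_two.mpr ⟨?_, ?_⟩)
  · exact ((contDiff_const.mul (hE l₂)).mul contDiff_const).add
      ((contDiff_const.mul (hE l₁)).mul contDiff_const)
  · exact ((contDiff_const.mul (hE l₂)).mul contDiff_const).sub
      ((contDiff_const.mul (hE l₁)).mul contDiff_const)

theorem hasDerivAt_wave (k : ℝ) (l₁ l₂ : ℂ) (x₀ : ℝ) (c : Fin 2 → ℂ) (x : ℝ) :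
    HasDerivAt (wave k l₁ l₂ x₀ c) (wave k l₁ l₂ x₀ ![l₂ * c 0, l₁ * c 1] x) x := by
  have hE : ∀ l : ℂ, HasDerivAt (fun x : ℝ => Complex.exp (l * (x - x₀)))
      (Complex.exp (l * (x - x₀)) * (l * 1)) x := fun l =>
    (((hasDerivAt_id x).ofReal_comp.sub_const (x₀ : ℂ)).const_mul l).cexp
  refine hasDerivAt_pi.mpr (Fin.forall_fin_two.mpr ⟨?_, ?_⟩)
  · refine ((((hE l₂).const_mul (c 0)).mul_const l₂).add
      (((hE l₁).const_mul (c 1)).mul_const (Complex.I * k))).congr_deriv ?_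
    simp only [wave, Matrix.cons_val_zero, Matrix.cons_val_one, Matrix.cons_val_fin_one]
    ring
  · refine ((((hE l₂).const_mul (c 0)).mul_const (Complex.I * k)).sub
      (((hE l₁).const_mul (c 1)).mul_const l₁)).congr_deriv ?_
    simp only [wave, Matrix.cons_val_zero, Matrix.cons_val_one, Matrix.cons_val_fin_one]
    ring

theorem dx_wave {D : Set ℝ} (hD : UniqueDiffOn ℝ D) (k : ℝ) (l₁ l₂ : ℂ) (x₀ : ℝ) (c : Fin 2 → ℂ)
    {x : ℝ} (hx : x ∈ D) :
    dx D (wave k l₁ l₂ x₀ c) x = wave k l₁ l₂ x₀ ![l₂ * c 0, l₁ * c 1] x :=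
  dx_eq hD hx (hasDerivAt_wave k l₁ l₂ x₀ c x).hasDerivWithinAt

theorem dx_dx_wave {D : Set ℝ} (hD : UniqueDiffOn ℝ D) (k : ℝ) (l₁ l₂ : ℂ) (x₀ : ℝ)
    (c : Fin 2 → ℂ) {x : ℝ} (hx : x ∈ D) :
    dx D (dx D (wave k l₁ l₂ x₀ c)) x = wave k l₁ l₂ x₀ ![l₂ * (l₂ * c 0), l₁ * (l₁ * c 1)] x :=
  dx_eq hD hx ((hasDerivAt_wave k l₁ l₂ x₀ ![l₂ * c 0, l₁ * c 1] x).hasDerivWithinAt.congr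
    (fun _ hy => dx_wave hD k l₁ l₂ x₀ c hy) (dx_wave hD k l₁ l₂ x₀ c hx))

/-- The dispersion relations satisfied by the exponents of shear waves (`l₁`) and pressure
waves (`l₂`). -/
structure Medium.IsDispersive (M : Medium) (k : ℝ) (l₁ l₂ : ℂ) : Prop where
  shear : M.mu * l₁ ^ 2 = M.mu * k ^ 2 - M.rho * M.omega ^ 2
  pressure : (M.lam + 2 * M.mu) * l₂ ^ 2 = (M.lam + 2 * M.mu) * k ^ 2 - M.rho * M.omega ^ 2

theorem Medium.isSolution_wave {M : Medium} {k : ℝ} {l₁ l₂ : ℂ} (h : M.IsDispersive k l₁ l₂)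
    {D : Set ℝ} (hD : UniqueDiffOn ℝ D) (x₀ : ℝ) (c : Fin 2 → ℂ) :
    M.IsSolution k D 0 (wave k l₁ l₂ x₀ c) := by
  refine ⟨(contDiff_wave k l₁ l₂ x₀ c).contDiffOn, fun x hx => ?_⟩
  rw [M.elasticOp_apply hD (contDiff_wave k l₁ l₂ x₀ c).contDiffOn k hx, dx_dx_wave hD k l₁ l₂ x₀ c hx,
    dx_wave hD k l₁ l₂ x₀ c hx]
  refine funext (Fin.forall_fin_two.mpr ⟨?_, ?_⟩)
  · simp only [wave, Pi.neg_apply, Pi.add_apply, Pi.smul_apply, smul_eq_mul, Matrix.cons_val_zero,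
      Matrix.cons_val_one, Matrix.cons_val_fin_one, Pi.zero_apply]
    push_cast
    generalize Complex.exp (l₂ * (x - x₀)) = E₂
    generalize Complex.exp (l₁ * (x - x₀)) = E₁
    linear_combination (-(c 0 * E₂ * l₂)) * h.pressure + (-(c 1 * E₁ * Complex.I * k)) * h.shear
      - (M.lam + M.mu) * k ^ 2 * l₂ * c 0 * E₂ * Complex.I_sq
  · simp only [wave, Pi.neg_apply, Pi.add_apply, Pi.smul_apply, smul_eq_mul, Matrix.cons_val_zero,
      Matrix.cons_val_one, Matrix.cons_val_fin_one, Pi.zero_apply]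
    push_cast
    generalize Complex.exp (l₂ * (x - x₀)) = E₂
    generalize Complex.exp (l₁ * (x - x₀)) = E₁
    linear_combination (-(c 0 * E₂ * Complex.I * k)) * h.pressure + (c 1 * E₁ * l₁) * h.shear
      - (M.lam + M.mu) * k ^ 2 * l₁ * c 1 * E₁ * Complex.I_sq

theorem radiatesAlong_wave {k : ℝ} {l₁ l₂ : ℂ} {D : Set ℝ} (hD : UniqueDiffOn ℝ D) {F : Filter ℝ}
    (hF : ∀ᶠ x in F, x ∈ D) (x₀ : ℝ) (c : Fin 2 → ℂ) :
    RadiatesAlong l₁ l₂ k D F (wave k l₁ l₂ x₀ c) := by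
  have hc := (contDiff_wave k l₁ l₂ x₀ c (n := 2)).contDiffOn (s := D)
  refine ⟨tendsto_const_nhds.congr' ?_, tendsto_const_nhds.congr' ?_⟩
  · filter_upwards [hF] with x hx
    rw [derivWithin_divergence hD hc k hx, divergence, dx_dx_wave hD k l₁ l₂ x₀ c hx,
      dx_wave hD k l₁ l₂ x₀ c hx]
    simp only [wave, Matrix.cons_val_zero, Matrix.cons_val_one, Matrix.cons_val_fin_one]
    ring
  · filter_upwards [hF] with x hx
    rw [derivWithin_scalarCurl hD hc k hx, scalarCurl, dx_dx_wave hD k l₁ l₂ x₀ c hx,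
      dx_wave hD k l₁ l₂ x₀ c hx]
    simp only [wave, Matrix.cons_val_zero, Matrix.cons_val_one, Matrix.cons_val_fin_one]
    ring

/-- Radiating solutions of the homogeneous equation on a half line are superpositions of a pressure
wave and a shear wave: the divergence and the curl solve scalar equations, and the displacement is
recovered from them. -/
theorem Medium.IsSolution.exists_eq_wave {M : Medium} (hM : M.IsPhysical) {k : ℝ} {l₁ l₂ : ℂ}
    (h : M.IsDispersive k l₁ l₂) {D : Set ℝ} (hD : UniqueDiffOn ℝ D) (hconv : Convex ℝ D)
    {F : Filter ℝ} [F.NeBot] {x₀ : ℝ} (hx₀ : x₀ ∈ D) (hF : ∀ᶠ x in F, x ∈ D)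
    (h₁ : ∀ x ∈ D, l₁.re * (x - x₀) ≤ 0) (h₂ : ∀ x ∈ D, l₂.re * (x - x₀) ≤ 0) {u : Mode}
    (hu : M.IsSolution k D 0 u) (hr : RadiatesAlong l₁ l₂ k D F u) :
    ∃ c : Fin 2 → ℂ, ∀ x ∈ D, u x = wave k l₁ l₂ x₀ c x := by
  have hmu : (M.mu : ℂ) ≠ 0 := by exact_mod_cast hM.mu_pos.ne'
  have hlm : (M.lam + 2 * M.mu : ℂ) ≠ 0 := by
    exact_mod_cast (by linarith [hM.lam_pos, hM.mu_pos] : 0 < M.lam + 2 * M.mu).ne'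
  have hrw : (M.rho * M.omega ^ 2 : ℂ) ≠ 0 := by
    exact_mod_cast (mul_pos hM.rho_pos (pow_pos hM.omega_pos 2)).ne'
  set p := divergence k D u with hp
  set q := scalarCurl k D u with hq
  set p' : ℝ → ℂ := fun x => dx D (dx D u) x 0 + Complex.I * k * dx D u x 1 with hp'
  set q' : ℝ → ℂ := fun x => dx D (dx D u) x 1 - Complex.I * k * dx D u x 0 with hq'
  have hdp : ∀ x ∈ D, HasDerivWithinAt p (p' x) D x := fun x hx =>
    hasDerivWithinAt_divergence hD hu.contDiffOn k hx
  have hdq : ∀ x ∈ D, HasDerivWithinAt q (q' x) D x := fun x hx =>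
    hasDerivWithinAt_scalarCurl hD hu.contDiffOn k hx
  have heq0 : ∀ x ∈ D, (M.lam + 2 * M.mu) * p' x - M.mu * (Complex.I * k) * q x
      = -(M.rho * M.omega ^ 2) * u x 0 := by
    intro x hx
    have := congrFun (hu.equation x hx) 0
    rw [M.elasticOp_apply hD hu.contDiffOn k hx] at this
    simp only [Pi.neg_apply, Pi.add_apply, Pi.smul_apply, smul_eq_mul, Matrix.cons_val_zero,
      Pi.zero_apply] at this
    push_cast at this
    simp only [hp', hq, scalarCurl]
    linear_combination -this + M.mu * k ^ 2 * u x 0 * Complex.I_sq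
  have heq1 : ∀ x ∈ D, (M.lam + 2 * M.mu) * (Complex.I * k) * p x + M.mu * q' x
      = -(M.rho * M.omega ^ 2) * u x 1 := by
    intro x hx
    have := congrFun (hu.equation x hx) 1
    rw [M.elasticOp_apply hD hu.contDiffOn k hx] at this
    simp only [Pi.neg_apply, Pi.add_apply, Pi.smul_apply, smul_eq_mul, Matrix.cons_val_one,
      Matrix.cons_val_fin_one, Pi.zero_apply] at this
    push_cast at this
    simp only [hp, hq', divergence]
    linear_combination -this + (M.lam + 2 * M.mu) * k ^ 2 * u x 1 * Complex.I_sq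
  have hu1 : ∀ x ∈ D, ∀ i, HasDerivWithinAt (fun x => u x i) (dx D u x i) D x := fun x hx i =>
    hasDerivWithinAt_pi.mp (hasDerivWithinAt_dx (hu.contDiffOn.of_le (by norm_num)) hx) i
  have hp'eq : ∀ x ∈ D, p' x = (M.mu * (Complex.I * k) * q x - (M.rho * M.omega ^ 2) * u x 0)
      / (M.lam + 2 * M.mu) := by
    intro x hx
    rw [eq_div_iff hlm]
    linear_combination heq0 x hx
  have hq'eq : ∀ x ∈ D, q' x = (-((M.lam + 2 * M.mu) * (Complex.I * k) * p x)
      - (M.rho * M.omega ^ 2) * u x 1) / M.mu := by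
    intro x hx
    rw [eq_div_iff hmu]
    linear_combination heq1 x hx
  have hdp' : ∀ x ∈ D, HasDerivWithinAt p' (l₂ ^ 2 * p x) D x := by
    intro x hx
    refine (((((hdq x hx).const_mul _).sub ((hu1 x hx 0).const_mul _)).div_const _).congr
      hp'eq (hp'eq x hx)).congr_deriv ?_
    rw [div_eq_iff hlm]
    have h5 : p x = dx D u x 0 + Complex.I * k * u x 1 := rfl
    linear_combination (Complex.I * k) * heq1 x hx - p x * h.pressure
      - (M.lam + 2 * M.mu) * k ^ 2 * p x * Complex.I_sq - (-(M.rho * M.omega ^ 2)) * h5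
  have hdq' : ∀ x ∈ D, HasDerivWithinAt q' (l₁ ^ 2 * q x) D x := by
    intro x hx
    refine (((((hdp x hx).const_mul _).neg.sub ((hu1 x hx 1).const_mul _)).div_const _).congr
      hq'eq (hq'eq x hx)).congr_deriv ?_
    rw [div_eq_iff hmu]
    have h5 : q x = dx D u x 1 - Complex.I * k * u x 0 := rfl
    linear_combination (-(Complex.I * k)) * heq0 x hx - q x * h.shear
      - M.mu * k ^ 2 * q x * Complex.I_sq - (-(M.rho * M.omega ^ 2)) * h5
  have hlimp : Tendsto (fun x => p' x - l₂ * p x) F (𝓝 0) := hr.1.congr' (by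
    filter_upwards [hF] with x hx
    rw [derivWithin_divergence hD hu.contDiffOn k hx])
  have hlimq : Tendsto (fun x => q' x - l₁ * q x) F (𝓝 0) := hr.2.congr' (by
    filter_upwards [hF] with x hx
    rw [derivWithin_scalarCurl hD hu.contDiffOn k hx])
  have hP := eq_exp_of_radiating hconv (hF.mono fun x hx => ⟨hx, h₂ x hx⟩) hdp hdp' hlimp hx₀
  have hQ := eq_exp_of_radiating hconv (hF.mono fun x hx => ⟨hx, h₁ x hx⟩) hdq hdq' hlimq hx₀
  refine ⟨![-((M.lam + 2 * M.mu) * p x₀) / (M.rho * M.omega ^ 2),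
    M.mu * q x₀ / (M.rho * M.omega ^ 2)], fun x hx => ?_⟩
  obtain ⟨hP1, hP2⟩ := hP x hx
  obtain ⟨hQ1, hQ2⟩ := hQ x hx
  have e0 := heq0 x hx
  have e1 := heq1 x hx
  rw [hP2, hP1, hQ1] at e0
  rw [hQ2, hP1, hQ1] at e1
  refine funext (Fin.forall_fin_two.mpr ⟨?_, ?_⟩)
  · refine mul_left_cancel₀ hrw ?_
    simp only [wave, Matrix.cons_val_zero, Matrix.cons_val_one, Matrix.cons_val_fin_one]
    generalize Complex.exp (l₂ * (x - x₀)) = E₂ at e0 e1 ⊢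
    generalize Complex.exp (l₁ * (x - x₀)) = E₁ at e0 e1 ⊢
    generalize (M.rho * M.omega ^ 2 : ℂ) = w at hrw e0 e1 ⊢
    field_simp
    linear_combination e0
  · refine mul_left_cancel₀ hrw ?_
    simp only [wave, Matrix.cons_val_zero, Matrix.cons_val_one, Matrix.cons_val_fin_one]
    generalize Complex.exp (l₂ * (x - x₀)) = E₂ at e0 e1 ⊢
    generalize Complex.exp (l₁ * (x - x₀)) = E₁ at e0 e1 ⊢
    generalize (M.rho * M.omega ^ 2 : ℂ) = w at hrw e0 e1 ⊢
    field_simp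
    linear_combination e1

theorem exists_norm_wave_le (k : ℝ) (l₁ l₂ : ℂ) (x₀ : ℝ) : ∃ B : ℝ, 0 ≤ B ∧
    ∀ (c : Fin 2 → ℂ) (x : ℝ), l₁.re * (x - x₀) ≤ 0 → l₂.re * (x - x₀) ≤ 0 →
      ‖wave k l₁ l₂ x₀ c x‖ ≤ B * ‖c‖ := by
  refine ⟨‖l₁‖ + ‖l₂‖ + ‖Complex.I * (k : ℂ)‖, by positivity, fun c x h₁ h₂ => ?_⟩
  have hE : ∀ l : ℂ, l.re * (x - x₀) ≤ 0 → ‖Complex.exp (l * (x - x₀))‖ ≤ 1 := fun l hl => by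
    rw [Complex.norm_exp, Real.exp_le_one_iff]
    simpa using hl
  have hterm : ∀ (i : Fin 2) (l a : ℂ), l.re * (x - x₀) ≤ 0 →
      ‖c i * Complex.exp (l * (x - x₀)) * a‖ ≤ ‖a‖ * ‖c‖ := fun i l a hl => by
    rw [norm_mul, norm_mul]
    have h3 : ‖c i‖ * ‖Complex.exp (l * (x - x₀))‖ ≤ ‖c‖ :=
      (mul_le_of_le_one_right (norm_nonneg _) (hE l hl)).trans (norm_le_pi_norm c i)
    rw [mul_comm]
    exact mul_le_mul_of_nonneg_left h3 (norm_nonneg a)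
  have hc := norm_nonneg c
  rw [pi_norm_le_iff_of_nonneg (by positivity)]
  refine Fin.forall_fin_two.mpr ⟨?_, ?_⟩
  · refine (norm_add_le _ _).trans ?_
    have := mul_nonneg (norm_nonneg l₁) hc
    linarith [hterm 0 l₂ l₂ h₂, hterm 1 l₁ (Complex.I * k) h₁]
  · refine (norm_sub_le _ _).trans ?_
    have := mul_nonneg (norm_nonneg l₂) hc
    linarith [hterm 0 l₂ (Complex.I * k) h₂, hterm 1 l₁ l₁ h₁]

/-! ### Traces of waves -/

/-- The symbol of the transmission operator with normal `(ν, 0)` on the waves with exponents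
`l₁`, `l₂`. -/
noncomputable def Medium.boundaryMatrix (M : Medium) (k ν : ℝ) (l₁ l₂ : ℂ) :
    Matrix (Fin 2) (Fin 2) ℂ :=
  !![ν * (2 * M.mu * k ^ 2 - M.rho * M.omega ^ 2) + Complex.I * M.rho * M.omega * M.Cp * l₂,
      2 * ν * M.mu * (Complex.I * k) * l₁ - M.rho * M.omega * M.Cp * k;
    2 * ν * M.mu * (Complex.I * k) * l₂ - M.rho * M.omega * M.Cs * k,
      -(ν * (2 * M.mu * k ^ 2 - M.rho * M.omega ^ 2)) - Complex.I * M.rho * M.omega * M.Cs * l₁]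

theorem Medium.transmission_wave {M : Medium} {k : ℝ} {l₁ l₂ : ℂ} (h : M.IsDispersive k l₁ l₂)
    (ν : ℝ) {D : Set ℝ} (hD : UniqueDiffOn ℝ D) (x₀ : ℝ) (c : Fin 2 → ℂ) {x : ℝ} (hx : x ∈ D) :
    M.transmission k D ν (wave k l₁ l₂ x₀ c) x = (M.boundaryMatrix k ν l₁ l₂).mulVec
      ![c 0 * Complex.exp (l₂ * (x - x₀)), c 1 * Complex.exp (l₁ * (x - x₀))] := by
  rw [M.transmission_apply, dx_wave hD k l₁ l₂ x₀ c hx]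
  refine funext (Fin.forall_fin_two.mpr ⟨?_, ?_⟩)
  · simp only [wave, Medium.boundaryMatrix, Matrix.mulVec, dotProduct, Fin.sum_univ_two,
      Matrix.of_apply, Matrix.cons_val_zero, Matrix.cons_val_one, Matrix.cons_val_fin_one]
    generalize Complex.exp (l₂ * (x - x₀)) = E₂
    generalize Complex.exp (l₁ * (x - x₀)) = E₁
    linear_combination ν * c 0 * E₂ * h.pressure + (M.lam * ν * k ^ 2 * c 0 * E₂
      + M.rho * M.omega * M.Cp * k * c 1 * E₁) * Complex.I_sq
  · simp only [wave, Medium.boundaryMatrix, Matrix.mulVec, dotProduct, Fin.sum_univ_two,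
      Matrix.of_apply, Matrix.cons_val_zero, Matrix.cons_val_one, Matrix.cons_val_fin_one]
    generalize Complex.exp (l₂ * (x - x₀)) = E₂
    generalize Complex.exp (l₁ * (x - x₀)) = E₁
    linear_combination (-(ν * c 1 * E₁)) * h.shear + (M.mu * ν * k ^ 2 * c 1 * E₁
      + M.rho * M.omega * M.Cs * k * c 0 * E₂) * Complex.I_sq

/-- Traces of waves coming from the neighbouring subdomain. The amplitude of the shear wave is
counted with opposite signs in the two subdomains. -/
noncomputable def Medium.couplingMatrix (M : Medium) (k δ : ℝ) (l₁ l₂ : ℂ) :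
    Matrix (Fin 2) (Fin 2) ℂ :=
  M.boundaryMatrix k 1 (-l₁) (-l₂)
    * !![Complex.exp (-(l₂ * δ)), 0; 0, -Complex.exp (-(l₁ * δ))]

theorem Medium.transmission_left_wave {M : Medium} {k δ : ℝ} {l₁ l₂ : ℂ}
    (h : M.IsDispersive k l₁ l₂) (c : Fin 2 → ℂ) :
    M.transmission k (Iic δ) 1 (wave k l₁ l₂ δ c) δ = (M.boundaryMatrix k 1 l₁ l₂).mulVec c := by
  rw [Medium.transmission_wave h 1 (uniqueDiffOn_Iic δ) δ c self_mem_Iic]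
  congr 1
  refine funext (Fin.forall_fin_two.mpr ⟨?_, ?_⟩) <;> simp

theorem Medium.IsDispersive.neg {M : Medium} {k : ℝ} {l₁ l₂ : ℂ} (h : M.IsDispersive k l₁ l₂) :
    M.IsDispersive k (-l₁) (-l₂) :=
  ⟨by rw [neg_sq]; exact h.shear, by rw [neg_sq]; exact h.pressure⟩

theorem Medium.transmission_right_wave_far {M : Medium} {k δ : ℝ} {l₁ l₂ : ℂ}
    (h : M.IsDispersive k l₁ l₂) (hδ : 0 ≤ δ) (c : Fin 2 → ℂ) :
    M.transmission k (Ici 0) 1 (wave k (-l₁) (-l₂) 0 ![c 0, -c 1]) δ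
      = (M.couplingMatrix k δ l₁ l₂).mulVec c := by
  rw [Medium.transmission_wave h.neg 1 (uniqueDiffOn_Ici 0) 0 _ (mem_Ici.mpr hδ),
    Medium.couplingMatrix, ← Matrix.mulVec_mulVec]
  congr 1
  refine funext (Fin.forall_fin_two.mpr ⟨?_, ?_⟩) <;>
  simp [Matrix.mulVec, dotProduct, Fin.sum_univ_two, mul_comm]

/-- Reflecting the subdomain changes the signs of the first trace and of the shear amplitude. -/
theorem Medium.boundaryMatrix_neg_mulVec (M : Medium) (k : ℝ) (l₁ l₂ : ℂ) (c : Fin 2 → ℂ) :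
    (M.boundaryMatrix k (-1) (-l₁) (-l₂)).mulVec ![c 0, -c 1]
      = ![-(M.boundaryMatrix k 1 l₁ l₂).mulVec c 0, (M.boundaryMatrix k 1 l₁ l₂).mulVec c 1] := by
  refine funext (Fin.forall_fin_two.mpr ⟨?_, ?_⟩) <;>
  · simp only [Medium.boundaryMatrix, Matrix.mulVec, dotProduct, Fin.sum_univ_two,
      Matrix.of_apply, Matrix.cons_val_zero, Matrix.cons_val_one, Matrix.cons_val_fin_one]
    push_cast
    ring

theorem Medium.transmission_right_wave {M : Medium} {k : ℝ} {l₁ l₂ : ℂ}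
    (h : M.IsDispersive k l₁ l₂) (c : Fin 2 → ℂ) :
    M.transmission k (Ici 0) (-1) (wave k (-l₁) (-l₂) 0 ![c 0, -c 1]) 0
      = ![-(M.boundaryMatrix k 1 l₁ l₂).mulVec c 0, (M.boundaryMatrix k 1 l₁ l₂).mulVec c 1] := by
  rw [Medium.transmission_wave h.neg (-1) (uniqueDiffOn_Ici 0) 0 _ self_mem_Ici,
    ← M.boundaryMatrix_neg_mulVec]
  congr 1
  refine funext (Fin.forall_fin_two.mpr ⟨?_, ?_⟩) <;> simp

theorem Medium.transmission_left_wave_far {M : Medium} {k δ : ℝ} {l₁ l₂ : ℂ}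
    (h : M.IsDispersive k l₁ l₂) (hδ : 0 ≤ δ) (c : Fin 2 → ℂ) :
    M.transmission k (Iic δ) (-1) (wave k l₁ l₂ δ c) 0
      = ![-(M.couplingMatrix k δ l₁ l₂).mulVec c 0, (M.couplingMatrix k δ l₁ l₂).mulVec c 1] := by
  rw [Medium.transmission_wave h (-1) (uniqueDiffOn_Iic δ) δ _ (mem_Iic.mpr hδ),
    Medium.couplingMatrix, ← Matrix.mulVec_mulVec, ← M.boundaryMatrix_neg_mulVec, neg_neg, neg_neg]
  congr 1
  refine funext (Fin.forall_fin_two.mpr ⟨?_, ?_⟩) <;>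
  simp [Matrix.mulVec, dotProduct, Fin.sum_univ_two, mul_comm]

/-- Both sequences run through powers of `K` applied to `c 0` and `d 0` alternately. -/
theorem norm_le_of_alternating_recursion {K : Matrix (Fin 2) (Fin 2) ℂ} {C r : ℝ}
    (hK : ∀ (n : ℕ) (v : Fin 2 → ℂ), ‖(K ^ n).mulVec v‖ ≤ C * r ^ n * ‖v‖) {c d : ℕ → Fin 2 → ℂ}
    (hc : ∀ n, c (n + 1) = K.mulVec (d n)) (hd : ∀ n, d (n + 1) = K.mulVec (c n))
    (hC : 0 ≤ C) (hr : 0 ≤ r) (n : ℕ) :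
    ‖c n‖ ≤ C * r ^ n * (‖c 0‖ + ‖d 0‖) ∧ ‖d n‖ ≤ C * r ^ n * (‖c 0‖ + ‖d 0‖) := by
  have hrec : ∀ n, (c n = (K ^ n).mulVec (c 0) ∧ d n = (K ^ n).mulVec (d 0)) ∨
      (c n = (K ^ n).mulVec (d 0) ∧ d n = (K ^ n).mulVec (c 0)) := by
    intro n
    induction n with
    | zero => left; simp
    | succ n ih =>
      rw [hc, hd, pow_succ', ← Matrix.mulVec_mulVec, ← Matrix.mulVec_mulVec]
      rcases ih with ⟨h1, h2⟩ | ⟨h1, h2⟩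
      · right
        rw [h1, h2]
        exact ⟨rfl, rfl⟩
      · left
        rw [h1, h2]
        exact ⟨rfl, rfl⟩
  have hb1 : ‖(K ^ n).mulVec (c 0)‖ ≤ C * r ^ n * (‖c 0‖ + ‖d 0‖) :=
    (hK n _).trans (mul_le_mul_of_nonneg_left (by linarith [norm_nonneg (d 0)]) (by positivity))
  have hb2 : ‖(K ^ n).mulVec (d 0)‖ ≤ C * r ^ n * (‖c 0‖ + ‖d 0‖) :=
    (hK n _).trans (mul_le_mul_of_nonneg_left (by linarith [norm_nonneg (c 0)]) (by positivity))
  rcases hrec n with ⟨h1, h2⟩ | ⟨h1, h2⟩ <;> rw [h1, h2]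
  · exact ⟨hb1, hb2⟩
  · exact ⟨hb2, hb1⟩

theorem exists_decay_of_stable_pencil {P G : Matrix (Fin 2) (Fin 2) ℂ} (hP : P.det ≠ 0)
    (h : ∀ z : ℂ, (z • P - G).det = 0 → ‖z‖ < 1) :
    ∃ C r : ℝ, 0 ≤ C ∧ 0 < r ∧ r < 1 ∧ ∀ (n : ℕ) (v : Fin 2 → ℂ),
      ‖((P⁻¹ * G) ^ n).mulVec v‖ ≤ C * r ^ n * ‖v‖ := by
  obtain ⟨C, r, hr0, hr1, hCr⟩ := exists_geometric_decay (K := P⁻¹ * G) fun z hz => h z (by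
    have h1 : z • P - G = P * (Matrix.scalar (Fin 2) z - P⁻¹ * G) := by
      rw [mul_sub, ← mul_assoc, Matrix.mul_nonsing_inv P (isUnit_iff_ne_zero.mpr hP), one_mul,
        Matrix.scalar_apply, ← Matrix.smul_one_eq_diagonal, Matrix.mul_smul, mul_one]
    rw [h1, Matrix.det_mul, hz, mul_zero])
  refine ⟨|C|, r, abs_nonneg C, hr0, hr1, fun n v => (hCr n v).trans ?_⟩
  gcongr
  exact le_abs_self C

/-! ### Convergence from stability -/

theorem principalSqrt_sq (a : ℝ) : principalSqrt a ^ 2 = a := by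
  have h1 : ((√a : ℂ)) * (√(-a) : ℂ) = 0 := by
    rw [← Complex.ofReal_mul, ← Complex.ofReal_zero]
    congr 1
    rcases le_total 0 a with h | h
    · rw [Real.sqrt_eq_zero_of_nonpos (by linarith : -a ≤ 0), mul_zero]
    · rw [Real.sqrt_eq_zero_of_nonpos h, zero_mul]
  have h2 : ((√a : ℂ)) ^ 2 - (√(-a) : ℂ) ^ 2 = a := by
    rw [← Complex.ofReal_pow, ← Complex.ofReal_pow, ← Complex.ofReal_sub]
    congr 1
    rcases le_total 0 a with h | h
    · rw [Real.sqrt_eq_zero_of_nonpos (by linarith : -a ≤ 0), Real.sq_sqrt h]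
      ring
    · rw [Real.sqrt_eq_zero_of_nonpos h, Real.sq_sqrt (by linarith : 0 ≤ -a)]
      ring
  rw [principalSqrt]
  linear_combination h2 + 2 * Complex.I * h1 + (√(-a) : ℂ) ^ 2 * Complex.I_sq

theorem principalSqrt_re_nonneg (a : ℝ) : 0 ≤ (principalSqrt a).re := by
  simp [principalSqrt]

theorem Medium.isDispersive_root {M : Medium} (hM : M.IsPhysical) (k : ℝ) :
    M.IsDispersive k (M.rootS k) (M.rootP k) := by
  have hs := (M.Cs_pos hM).ne'
  have hp := (M.Cp_pos hM).ne'
  constructor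
  · rw [Medium.rootS, principalSqrt_sq]
    have : M.mu * (k ^ 2 - M.omega ^ 2 / M.Cs ^ 2) = M.mu * k ^ 2 - M.rho * M.omega ^ 2 := by
      rw [← M.rho_mul_Cs_sq hM]
      field_simp
    exact_mod_cast this
  · rw [Medium.rootP, principalSqrt_sq]
    have : (M.lam + 2 * M.mu) * (k ^ 2 - M.omega ^ 2 / M.Cp ^ 2)
        = (M.lam + 2 * M.mu) * k ^ 2 - M.rho * M.omega ^ 2 := by
      rw [← M.rho_mul_Cp_sq hM]
      field_simp
    exact_mod_cast this

/-- A mode with a stable pencil of traces is one for which the algorithm converges. -/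
theorem Medium.schwarzConverges_of_stable_pencil {M : Medium} (hM : M.IsPhysical) {k δ : ℝ}
    (hδ : 0 ≤ δ) (hP : (M.boundaryMatrix k 1 (M.rootS k) (M.rootP k)).det ≠ 0)
    (hz : ∀ z : ℂ, (z • M.boundaryMatrix k 1 (M.rootS k) (M.rootP k)
      - M.couplingMatrix k δ (M.rootS k) (M.rootP k)).det = 0 → ‖z‖ < 1) :
    M.SchwarzConverges k δ := by
  have hdisp := M.isDispersive_root hM k
  have hre₁ : 0 ≤ (M.rootS k).re := principalSqrt_re_nonneg _
  have hre₂ : 0 ≤ (M.rootP k).re := principalSqrt_re_nonneg _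
  set l₁ := M.rootS k with hl₁
  set l₂ := M.rootP k with hl₂
  set P := M.boundaryMatrix k 1 l₁ l₂ with hPdef
  set G := M.couplingMatrix k δ l₁ l₂ with hGdef
  have hUL := uniqueDiffOn_Iic δ
  have hUR := uniqueDiffOn_Ici (0 : ℝ)
  have hFL : ∀ᶠ x in atBot, x ∈ Iic δ := eventually_le_atBot δ
  have hFR : ∀ᶠ x in atTop, x ∈ Ici (0 : ℝ) := eventually_ge_atTop 0
  have h12 : (1 : WithTop ℕ∞) ≤ 2 := by norm_num
  have hPinv : P * P⁻¹ = 1 := Matrix.mul_nonsing_inv P (isUnit_iff_ne_zero.mpr hP)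
  have hPinv' : P⁻¹ * P = 1 := Matrix.nonsing_inv_mul P (isUnit_iff_ne_zero.mpr hP)
  have hsolve : ∀ b, P.mulVec (P⁻¹.mulVec b) = b := fun b => by
    rw [Matrix.mulVec_mulVec, hPinv, Matrix.one_mulVec]
  refine ⟨fun f u g₁ g₂ hu hg₁ hg₂ => ?_, ?_⟩
  · have huL : M.IsSolution k (Iic δ) f u := hu.solution.of_univ hUL
    have huR : M.IsSolution k (Ici 0) f u := hu.solution.of_univ hUR
    have hstep : ∀ p : Mode × Mode, ∃ q : Mode × Mode,
        M.IsSolution k (Iic δ) f q.1 ∧ M.IsSolution k (Ici 0) f q.2 ∧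
        M.RadiatesLeft k (Iic δ) q.1 ∧ M.RadiatesRight k (Ici 0) q.2 ∧
        M.transmission k (Iic δ) 1 q.1 δ = M.transmission k (Ici 0) 1 p.2 δ ∧
        M.transmission k (Ici 0) (-1) q.2 0 = M.transmission k (Iic δ) (-1) p.1 0 := by
      intro p
      obtain ⟨b, hb⟩ : ∃ b, b = M.transmission k (Ici 0) 1 p.2 δ - M.transmission k (Iic δ) 1 u δ :=
        ⟨_, rfl⟩
      obtain ⟨b', hb'⟩ : ∃ b', b' = M.transmission k (Iic δ) (-1) p.1 0
        - M.transmission k (Ici 0) (-1) u 0 := ⟨_, rfl⟩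
      obtain ⟨c, hc⟩ : ∃ c, P.mulVec c = b := ⟨_, hsolve b⟩
      obtain ⟨d, hd⟩ : ∃ d, P.mulVec d = ![-b' 0, b' 1] := ⟨_, hsolve _⟩
      have hwL := Medium.isSolution_wave hdisp hUL δ c
      have hwR := Medium.isSolution_wave hdisp.neg hUR 0 ![d 0, -d 1]
      refine ⟨(u + (1 : ℂ) • wave k l₁ l₂ δ c, u + (1 : ℂ) • wave k (-l₁) (-l₂) 0 ![d 0, -d 1]),
        ?_, ?_, ?_, ?_, ?_, ?_⟩
      · simpa only [smul_zero, add_zero] using huL.add_smul hUL hwL 1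
      · simpa only [smul_zero, add_zero] using huR.add_smul hUR hwR 1
      · rw [Medium.radiatesLeft_iff]
        exact RadiatesAlong.add_smul hUL hFL huL.contDiffOn hwL.contDiffOn
          (RadiatesAlong.of_univ hUL hFL hu.solution.contDiffOn
            (Medium.radiatesLeft_iff.mp hu.radiationLeft)) (radiatesAlong_wave hUL hFL δ c) 1
      · rw [Medium.radiatesRight_iff]
        exact RadiatesAlong.add_smul hUR hFR huR.contDiffOn hwR.contDiffOn
          (RadiatesAlong.of_univ hUR hFR hu.solution.contDiffOn
            (Medium.radiatesRight_iff.mp hu.radiationRight)) (radiatesAlong_wave hUR hFR 0 _) 1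
      · rw [Medium.transmission_add_smul hUL (huL.contDiffOn.of_le h12) (hwL.contDiffOn.of_le h12) 1
          self_mem_Iic, Medium.transmission_left_wave hdisp c, ← hPdef, hc, hb, one_smul,
          add_sub_cancel]
      · rw [Medium.transmission_add_smul hUR (huR.contDiffOn.of_le h12) (hwR.contDiffOn.of_le h12) 1
          self_mem_Ici, Medium.transmission_right_wave hdisp d, ← hPdef, hd, one_smul]
        refine funext (Fin.forall_fin_two.mpr ⟨?_, ?_⟩) <;> simp [hb']
    choose step hs using hstep
    set seq : ℕ → Mode × Mode := fun n => step^[n] (g₁, g₂) with hseq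
    have hsucc : ∀ n, seq (n + 1) = step (seq n) := fun n => Function.iterate_succ_apply' step n _
    refine ⟨fun n => (seq n).1, fun n => (seq n).2, rfl, rfl, ⟨hg₁, hg₂, ?_, ?_, ?_, ?_, ?_, ?_⟩⟩ <;>
    intro n <;> simp only [hsucc]
    · exact (hs (seq n)).1
    · exact (hs (seq n)).2.1
    · exact (hs (seq n)).2.2.1
    · exact (hs (seq n)).2.2.2.1
    · exact (hs (seq n)).2.2.2.2.1
    · exact (hs (seq n)).2.2.2.2.2
  · obtain ⟨C, r, hC, hr0, hr1, hCr⟩ := exists_decay_of_stable_pencil hP hz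
    obtain ⟨B₁, hB₁, hwave₁⟩ := exists_norm_wave_le k l₁ l₂ δ
    obtain ⟨B₂, hB₂, hwave₂⟩ := exists_norm_wave_le k (-l₁) (-l₂) 0
    have hreL : ∀ l : ℂ, 0 ≤ l.re → ∀ x ∈ Iic δ, l.re * (x - δ) ≤ 0 := fun l hl x hx =>
      mul_nonpos_of_nonneg_of_nonpos hl (sub_nonpos.mpr hx)
    have hreR : ∀ l : ℂ, 0 ≤ l.re → ∀ x ∈ Ici (0 : ℝ), (-l).re * (x - 0) ≤ 0 := fun l hl x hx =>
      mul_nonpos_of_nonpos_of_nonneg (by simpa using hl) (by simpa using hx)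
    refine ⟨r, hr0.le, hr1, fun f u u₁ u₂ hu hseq => ?_⟩
    have huL : M.IsSolution k (Iic δ) f u := hu.solution.of_univ hUL
    have huR : M.IsSolution k (Ici 0) f u := hu.solution.of_univ hUR
    -- the errors are superpositions of plane waves
    have hL : ∀ n, ∃ c : Fin 2 → ℂ, ∀ x ∈ Iic δ,
        u₁ (n + 1) x = (u + (1 : ℂ) • wave k l₁ l₂ δ c) x := by
      intro n
      have hs := (hseq.solution₁ n).add_smul hUL huL (-1)
      have hr := RadiatesAlong.add_smul hUL hFL (hseq.solution₁ n).contDiffOn huL.contDiffOn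
          (Medium.radiatesLeft_iff.mp (hseq.radiation₁ n))
          (RadiatesAlong.of_univ hUL hFL hu.solution.contDiffOn
            (Medium.radiatesLeft_iff.mp hu.radiationLeft)) (-1)
      rw [show f + (-1 : ℂ) • f = 0 by simp] at hs
      obtain ⟨c, hc⟩ := hs.exists_eq_wave hM hdisp hUL (convex_Iic δ) self_mem_Iic hFL
        (hreL l₁ hre₁) (hreL l₂ hre₂) hr
      refine ⟨c, fun x hx => ?_⟩
      rw [Pi.add_apply, Pi.smul_apply, ← hc x hx]
      simp
    have hR : ∀ n, ∃ d : Fin 2 → ℂ, ∀ x ∈ Ici (0 : ℝ),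
        u₂ (n + 1) x = (u + (1 : ℂ) • wave k (-l₁) (-l₂) 0 ![d 0, -d 1]) x := by
      intro n
      have hs := (hseq.solution₂ n).add_smul hUR huR (-1)
      have hr := RadiatesAlong.add_smul hUR hFR (hseq.solution₂ n).contDiffOn huR.contDiffOn
          (Medium.radiatesRight_iff.mp (hseq.radiation₂ n))
          (RadiatesAlong.of_univ hUR hFR hu.solution.contDiffOn
            (Medium.radiatesRight_iff.mp hu.radiationRight)) (-1)
      rw [show f + (-1 : ℂ) • f = 0 by simp] at hs
      obtain ⟨c, hc⟩ := hs.exists_eq_wave hM hdisp.neg hUR (convex_Ici 0) self_mem_Ici hFR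
        (hreR l₁ hre₁) (hreR l₂ hre₂) hr
      refine ⟨![c 0, -c 1], fun x hx => ?_⟩
      have hcc : ![(![c 0, -c 1] : Fin 2 → ℂ) 0, -(![c 0, -c 1] : Fin 2 → ℂ) 1] = c :=
        funext (Fin.forall_fin_two.mpr ⟨by simp, by simp⟩)
      rw [hcc, Pi.add_apply, Pi.smul_apply, ← hc x hx]
      simp
    choose c hc using hL
    choose d hd using hR
    have htL : ∀ n, ∀ ν : ℝ, ∀ x ∈ Iic δ, M.transmission k (Iic δ) ν (u₁ (n + 1)) x
        = M.transmission k univ ν u x + M.transmission k (Iic δ) ν (wave k l₁ l₂ δ (c n)) x := by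
      intro n ν x hx
      rw [Medium.transmission_congr (hc n) hx, Medium.transmission_add_smul hUL
        (huL.contDiffOn.of_le h12) (contDiff_wave k l₁ l₂ δ (c n)).contDiffOn 1 hx,
        Medium.transmission_of_univ hUL (hu.solution.contDiffOn.of_le h12) hx, one_smul]
    have htR : ∀ n, ∀ ν : ℝ, ∀ x ∈ Ici (0 : ℝ), M.transmission k (Ici 0) ν (u₂ (n + 1)) x
        = M.transmission k univ ν u x
          + M.transmission k (Ici 0) ν (wave k (-l₁) (-l₂) 0 ![d n 0, -d n 1]) x := by
      intro n ν x hx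
      rw [Medium.transmission_congr (hd n) hx, Medium.transmission_add_smul hUR
        (huR.contDiffOn.of_le h12) (contDiff_wave k (-l₁) (-l₂) 0 _).contDiffOn 1 hx,
        Medium.transmission_of_univ hUR (hu.solution.contDiffOn.of_le h12) hx, one_smul]
    have hinv : ∀ a b : Fin 2 → ℂ, P.mulVec a = G.mulVec b → a = (P⁻¹ * G).mulVec b := by
      intro a b h
      rw [← Matrix.mulVec_mulVec, ← h, Matrix.mulVec_mulVec, hPinv', Matrix.one_mulVec]
    -- the transmission conditions as recursions for the amplitudes
    have hrecc : ∀ n, c (n + 1) = (P⁻¹ * G).mulVec (d n) := by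
      intro n
      have h := hseq.transmission₁ (n + 1)
      rw [htL _ 1 δ self_mem_Iic, htR _ 1 δ (mem_Ici.mpr hδ), add_right_inj,
        Medium.transmission_left_wave hdisp, Medium.transmission_right_wave_far hdisp hδ] at h
      exact hinv _ _ h
    have hrecd : ∀ n, d (n + 1) = (P⁻¹ * G).mulVec (c n) := by
      intro n
      have h := hseq.transmission₂ (n + 1)
      rw [htL _ (-1) 0 (mem_Iic.mpr hδ), htR _ (-1) 0 self_mem_Ici, add_right_inj,
        Medium.transmission_right_wave hdisp, Medium.transmission_left_wave_far hdisp hδ] at h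
      refine hinv _ _ (funext (Fin.forall_fin_two.mpr ⟨?_, ?_⟩))
      · exact neg_injective (congrFun h 0)
      · exact congrFun h 1
    have hbound := norm_le_of_alternating_recursion hCr hrecc hrecd hC hr0.le
    refine ⟨(B₁ + B₂) * C * (‖c 0‖ + ‖d 0‖) / r, fun n hn => ?_⟩
    obtain ⟨m, rfl⟩ : ∃ m, n = m + 1 := ⟨n - 1, by omega⟩
    have hpow : (B₁ + B₂) * C * (‖c 0‖ + ‖d 0‖) / r * r ^ (m + 1)
        = (B₁ + B₂) * (C * r ^ m * (‖c 0‖ + ‖d 0‖)) := by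
      field_simp
      ring
    rw [hpow]
    have hnn : 0 ≤ C * r ^ m * (‖c 0‖ + ‖d 0‖) := by positivity
    refine ⟨fun x hx => ?_, fun x hx => ?_⟩
    · have h1 : u₁ (m + 1) x - u x = wave k l₁ l₂ δ (c m) x := by
        rw [hc m x hx]
        simp
      rw [h1]
      refine (hwave₁ _ x (hreL l₁ hre₁ x hx) (hreL l₂ hre₂ x hx)).trans ?_
      exact mul_le_mul (by linarith) (hbound m).1 (norm_nonneg _) (by linarith)
    · have h1 : u₂ (m + 1) x - u x = wave k (-l₁) (-l₂) 0 ![d m 0, -d m 1] x := by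
        rw [hd m x hx]
        simp
      have h2 : ‖(![d m 0, -d m 1] : Fin 2 → ℂ)‖ ≤ ‖d m‖ := by
        rw [pi_norm_le_iff_of_nonneg (norm_nonneg _)]
        refine Fin.forall_fin_two.mpr ⟨?_, ?_⟩
        · exact norm_le_pi_norm (d m) 0
        · simpa using norm_le_pi_norm (d m) 1
      rw [h1]
      refine (hwave₂ _ x (hreR l₁ hre₁ x hx) (hreR l₂ hre₂ x hx)).trans ?_
      exact mul_le_mul (by linarith) (h2.trans (hbound m).2) (norm_nonneg _) (by linarith)

/-- In units of length `Cₛ / ω`, the pencil of traces has the determinant studied in `Stable`. -/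
theorem Medium.schwarzConverges_of_stableSymbol {M : Medium} (hM : M.IsPhysical) {k δ : ℝ}
    (hδ : 0 ≤ δ) {l₁ l₂ : ℂ} (h₁ : M.rootS k = (M.omega / M.Cs : ℝ) * l₁)
    (h₂ : M.rootP k = (M.omega / M.Cs : ℝ) * l₂)
    (h : StableSymbol (M.Cp / M.Cs) (k * M.Cs / M.omega) (δ * M.omega / M.Cs) l₁ l₂) :
    M.SchwarzConverges k δ := by
  have hs := M.Cs_pos hM
  have hw := hM.omega_pos
  have hr := hM.rho_pos
  obtain ⟨c, hc⟩ : ∃ c, c = M.Cp / M.Cs := ⟨_, rfl⟩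
  obtain ⟨κ, hκ⟩ : ∃ κ, κ = k * M.Cs / M.omega := ⟨_, rfl⟩
  have hCp : M.Cp = c * M.Cs := by rw [hc]; field_simp
  have hk : k = κ * (M.omega / M.Cs) := by rw [hκ]; field_simp
  have hmu := M.rho_mul_Cs_sq hM
  have hsC : (M.Cs : ℂ) ≠ 0 := by exact_mod_cast hs.ne'
  have hw2 : (M.rho * M.omega ^ 2 : ℂ) ≠ 0 := by
    exact_mod_cast (mul_pos hr (pow_pos hw 2)).ne'
  have hE : ∀ l : ℂ, -((M.omega / M.Cs : ℝ) * l * δ) = -(l * (δ * M.omega / M.Cs : ℝ)) :=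
    fun l => by push_cast; ring
  have hB : ∀ a b : ℂ, M.boundaryMatrix k 1 ((M.omega / M.Cs : ℝ) * a) ((M.omega / M.Cs : ℝ) * b)
      = (M.rho * M.omega ^ 2 : ℂ) • !![2 * κ ^ 2 - 1 + Complex.I * c * b,
        2 * κ * Complex.I * a - c * κ; 2 * κ * Complex.I * b - κ,
        -(2 * κ ^ 2 - 1) - Complex.I * a] := by
    intro a b
    rw [Medium.boundaryMatrix, ← hmu, hCp, hk]
    ext i j
    fin_cases i <;> fin_cases j <;> simp <;> field_simp
  rw [← hc, ← hκ, StableSymbol] at h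
  refine M.schwarzConverges_of_stable_pencil hM hδ ?_ fun z hz => ?_
  · rw [h₁, h₂, hB, Matrix.det_smul, Matrix.det_fin_two_of]
    refine mul_ne_zero (pow_ne_zero _ hw2) ?_
    convert h.1 using 1
    rw [symbolX, symbolY]
    linear_combination (-(c * l₁ * l₂) - 4 * κ ^ 2 * l₁ * l₂) * Complex.I_sq
  · refine h.2 z ?_
    rw [Medium.couplingMatrix, h₁, h₂, hB, ← mul_neg, ← mul_neg, hB, hE, hE] at hz
    generalize Complex.exp (-(l₁ * (δ * M.omega / M.Cs : ℝ))) = e₁ at hz ⊢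
    generalize Complex.exp (-(l₂ * (δ * M.omega / M.Cs : ℝ))) = e₂ at hz ⊢
    rw [Matrix.smul_mul, smul_comm, ← smul_sub, Matrix.det_smul] at hz
    have hz' := (mul_eq_zero.mp hz).resolve_left (pow_ne_zero _ hw2)
    rw [Matrix.det_fin_two] at hz'
    simp at hz'
    rw [symbolX, symbolY, symbolZ, symbolV, ← hz']
    ring_nf
    simp only [Complex.I_sq]
    ring

/-! ### Stability beyond the critical overlap -/

theorem principalSqrt_of_pos {a : ℝ} (ha : 0 < a) : principalSqrt a = (√a : ℝ) := by
  rw [principalSqrt, Real.sqrt_eq_zero_of_nonpos (by linarith : -a ≤ 0)]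
  simp

theorem principalSqrt_of_neg {a : ℝ} (ha : a < 0) :
    principalSqrt a = Complex.I * (√(-a) : ℝ) := by
  rw [principalSqrt, Real.sqrt_eq_zero_of_nonpos ha.le]
  simp

theorem principalSqrt_sq_mul {t : ℝ} (ht : 0 ≤ t) (a : ℝ) :
    principalSqrt (t ^ 2 * a) = t * principalSqrt a := by
  rw [principalSqrt, principalSqrt, ← mul_neg, Real.sqrt_mul (sq_nonneg t),
    Real.sqrt_mul (sq_nonneg t), Real.sqrt_sq ht]
  push_cast
  ring

/-- Away from the two cut-off frequencies the normalised problem is stable once the overlap exceeds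
the critical one. -/
theorem stableSymbol_of_overlap {c k d α : ℝ} (hc : 0 < c) (hc2 : 2 < c ^ 2) (hk : 0 ≤ k)
    (hd : 0 < d) (hkc : k ≠ 1 / c) (hk1 : k ≠ 1) (hα : 0 < α)
    (hroot : α * c ^ 2 * (c * Real.cosh α + 1) = (c ^ 3 + 3 * c ^ 2 - 4) * Real.sinh α)
    (hαd : α < √(1 - 1 / c ^ 2) * d) :
    StableSymbol c k d (principalSqrt (k ^ 2 - 1)) (principalSqrt (k ^ 2 - 1 / c ^ 2)) := by
  have hcinv : 1 / c ^ 2 < 1 / 2 := one_div_lt_one_div_of_lt two_pos hc2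
  have hcc : (1 / c) ^ 2 = 1 / c ^ 2 := by rw [div_pow, one_pow]
  have hc0 : 0 < 1 / c := by positivity
  rcases lt_or_gt_of_ne hkc with h1 | h1
  · have hk2 : k ^ 2 < 1 / c ^ 2 := by
      rw [← hcc]
      exact pow_lt_pow_left₀ h1 hk two_ne_zero
    rw [principalSqrt_of_neg (by linarith), principalSqrt_of_neg (by linarith)]
    exact stableSymbol_of_propagating hc (Real.sqrt_pos.mpr (by linarith))
      (Real.sqrt_pos.mpr (by linarith)) (by linarith)
  have hk2 : 1 / c ^ 2 < k ^ 2 := by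
    rw [← hcc]
    exact pow_lt_pow_left₀ h1 hc0.le two_ne_zero
  rw [principalSqrt_of_pos (sub_pos.mpr hk2)]
  rcases lt_or_gt_of_ne hk1 with h2 | h2
  · have hk1' : k ^ 2 < 1 := pow_lt_one₀ hk h2 two_ne_zero
    rw [principalSqrt_of_neg (by linarith)]
    exact stableSymbol_of_mixed hc hc2 (hc0.trans h1) hd (Real.sqrt_pos.mpr (by linarith))
      (Real.sqrt_pos.mpr (by linarith)) (by rw [Real.sq_sqrt (by linarith)]; ring)
      (Real.sq_sqrt (by linarith))
  · have hk1' : 1 < k ^ 2 := one_lt_pow₀ h2 two_ne_zero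
    rw [principalSqrt_of_pos (sub_pos.mpr hk1')]
    exact stableSymbol_of_evanescent hc hc2 (Real.sqrt_pos.mpr (by linarith))
      (Real.sqrt_pos.mpr (by linarith)) (Real.sq_sqrt (by linarith)) (Real.sq_sqrt (by linarith))
      hα hroot hαd

end ElasticSchwarz

theorem theorem3p5 (M : ElasticSchwarz.Medium) (hM : M.IsPhysical) :
    (∃! α : ℝ, M.IsPositiveRoot α) ∧
    ∀ α : ℝ, M.IsPositiveRoot α →
      ∀ δ : ℝ, M.criticalOverlap α < δ →
        ∀ k : ℝ, 0 ≤ k → k ≠ M.omega / M.Cp → k ≠ M.omega / M.Cs →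
          M.SchwarzConverges k δ := by
  have hs := M.Cs_pos hM
  have hp := M.Cp_pos hM
  have hw := hM.omega_pos
  have hc : 0 < M.Cp / M.Cs := div_pos hp hs
  have hc2 := M.two_lt_speed_ratio_sq hM
  have hm : 0 < √(1 - 1 / (M.Cp / M.Cs) ^ 2) := Real.sqrt_pos.mpr (by
    have : 1 / (M.Cp / M.Cs) ^ 2 < 1 / 2 := one_div_lt_one_div_of_lt two_pos hc2
    linarith)
  refine ⟨?_, fun α hα δ hδ k hk hkp hks => ?_⟩
  · simp only [M.isPositiveRoot_iff hM]
    exact ElasticSchwarz.existsUnique_overlap_root hc hc2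
  have hcrit := M.sqrt_mul_criticalOverlap hM hα
  obtain ⟨hα0, hroot⟩ := (M.isPositiveRoot_iff hM).mp hα
  have hcrit0 : 0 < M.criticalOverlap α * M.omega / M.Cs :=
    pos_of_mul_pos_right (hcrit.symm ▸ hα0) hm.le
  have hlt : M.criticalOverlap α * M.omega / M.Cs < δ * M.omega / M.Cs := by gcongr
  have hd := hcrit0.trans hlt
  have hδ0 : 0 < δ := by
    rw [mul_div_assoc] at hd
    exact pos_of_mul_pos_left hd (div_pos hw hs).le
  refine M.schwarzConverges_of_stableSymbol hM hδ0.le ?_ ?_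
    (ElasticSchwarz.stableSymbol_of_overlap hc hc2 (by positivity) hd ?_ ?_ hα0 hroot ?_)
  · rw [← ElasticSchwarz.principalSqrt_sq_mul (by positivity), ElasticSchwarz.Medium.rootS]
    congr 1
    field_simp
  · rw [← ElasticSchwarz.principalSqrt_sq_mul (by positivity), ElasticSchwarz.Medium.rootP]
    congr 1
    field_simp
  · intro h
    refine hkp ?_
    field_simp at h ⊢
    linarith
  · intro h
    refine hks ?_
    field_simp at h ⊢
    linarith
  · calc α = √(1 - 1 / (M.Cp / M.Cs) ^ 2) * (M.criticalOverlap α * M.omega / M.Cs) := hcrit.symm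
      _ < _ := mul_lt_mul_of_pos_left hlt hm
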